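/- **Theorem (Factorization of Hermitian matrix Laurent polynomials).** Let $\mathbb F$ be $\mathbb R$, $\mathbb C$ or the quaternions $\mathbb H$, let $d\ge 0$, let $\mathbb F_d$ be the ring of $d\times d$ matrices over $\mathbb F$, and let $A=\sum_r z^r a_r\in\mathbb F_d[z,z^{-1}]$ be a matrix Laurent polynomial ($z$ commutes with the coefficients). Put $A^\dagger=\sum_r z^{-r}a_r^\dagger$, where $a_r^\dagger$ is the conjugate transpose. Through $\mathbb R\subset\mathbb C$, respectively through the representation of $\mathbb H$ by complex $2\times 2$ matrices $a+bi+cj+dk\mapsto\begin{pmatrix}a+bi&c+di\\-c+di&a-bi\end{pmatrix}$, matrix (Laurent) polynomials over $\mathbb F$ are regarded as complex ones, of size $N=d$ if $\mathbb F=\mathbb R,\mathbb C$ and $N=2d$ if $\mathbb F=\mathbb H$; evaluation at $z\in\mathbb C$, invertibility and eigenvalues are understood in this sense. Assume that $A=A^\dagger$ and that $A(z)$ is invertible for all $z\in\mathbb C$ with $|z|=1$. *Partial indices.* As a complex matrix Laurent polynomial $A$ has a Wiener–Hopf factorization $A=B_+DB_-$, in which $B_+$ is a polynomial in $z$ with $B_+(z)$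 invertible for $|z|\le 1$, $B_-$ is a polynomial in $z^{-1}$ which is invertible for $|z^{-1}|\le 1$ (including $z^{-1}=0$), and $D=\operatorname{diag}(z^{\lambda_1},\dots,z^{\lambda_N})$ with integers $\lambda_1\ge\dots\ge\lambda_N$; these integers depend only on $A$. If $\mathbb F=\mathbb R$ or $\mathbb C$, let $\kappa_m=\lambda_m$ for $m=1,\dots,d$. If $\mathbb F=\mathbb H$, the $\lambda$'s occur in equal pairs, and $\kappa_1\ge\dots\ge\kappa_d$ are the integers with $(\lambda_1,\dots,\lambda_{2d})=(\kappa_1,\kappa_1,\kappa_2,\kappa_2,\dots,\kappa_d,\kappa_d)$. Let $\mathcal M_+=\{m:\kappa_m>0\}$, $\mathcal M_0=\{m:\kappa_m=0\}$ and $\bar m=d+1-m$. *Signature.* Let $s$ be the number of positive eigenvalues minus the number of negative eigenvalues, counted with multiplicity, of the Hermitian complex matrix $A(1)$ if $\mathbb F=\mathbb R$ or $\mathbb C$, and half of this difference if $\mathbb F=\mathbb H$. Then there are a matrix polynomial $A_+\in\mathbb F_d[z]$ with $A_+(z)$ invertible for all $z\in\mathbb C$ with $|z|\le 1$, and signs $s_m\in\{1,-1\}$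 for $m\in\mathcal M_0$ with $s_{m'}\le s_m$ whenever $m'<m$, such that $$A=A_+D_1A_+^\dagger,\qquad D_1=\sum_{m\in\mathcal M_+}\bigl(z^{\kappa_m}|\bar m\rangle\langle m|+z^{-\kappa_m}|m\rangle\langle\bar m|\bigr)+\sum_{m\in\mathcal M_0}s_m|m\rangle\langle m| ,$$ where $|m\rangle\langle m'|\in\mathbb F_d$ is the matrix unit with entry $1$ in position $(m,m')$; moreover $$\sum_{m\in\mathcal M_0}s_m=s .$$ -/

import Mathlib

namespace HermitianWH

open Matrix

/-- Matrix Laurent polynomials `∑ z ^ r a_r` with `n × n` matrix coefficients over `R`.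
The variable `z` commutes with the coefficients. -/
abbrev MatLaurent (R n : Type) [Ring R] [Fintype n] [DecidableEq n] : Type :=
  LaurentPolynomial (Matrix n n R)

/-- Matrix polynomials `∑ z ^ r a_r`, `r ≥ 0`, with `n × n` matrix coefficients over `R`. -/
abbrev MatPoly (R n : Type) [Ring R] [Fintype n] [DecidableEq n] : Type :=
  Polynomial (Matrix n n R)

section General

variable {R n : Type} [Ring R] [Fintype n] [DecidableEq n]

/-- The monomial `z ^ r a`. -/
noncomputable def mono (r : ℤ) (a : Matrix n n R) : MatLaurent R n :=
  LaurentPolynomial.C a * LaurentPolynomial.T r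

/-- The adjoint of `∑ z ^ r a_r` is `∑ z ^ (-r) (a_r)ᴴ`. -/
noncomputable def dagger [StarRing R] (A : MatLaurent R n) : MatLaurent R n :=
  A.coeff.sum fun r a => mono (-r) aᴴ

/-- A matrix polynomial `∑ z ^ r a_r`, regarded as a matrix Laurent polynomial in `z`. -/
noncomputable def inZ (P : MatPoly R n) : MatLaurent R n :=
  Polynomial.toLaurent P

/-- The matrix Laurent polynomial `∑ z ^ (-r) a_r` obtained from `∑ w ^ r a_r` by putting
`w = z⁻¹`. -/
noncomputable def inZInv (P : MatPoly R n) : MatLaurent R n :=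
  P.sum fun r a => mono (-(r : ℤ)) a

/-- `D = ∑ₘ z ^ κₘ |m⟩⟨m|`. -/
noncomputable def diagonalFactor (κ : n → ℤ) : MatLaurent R n :=
  ∑ m, mono (κ m) (Matrix.single m m 1)

end General

section Complex

variable {ι : Type} [Fintype ι] [DecidableEq ι]

/-- The value at `z ≠ 0` of a complex matrix Laurent polynomial. -/
noncomputable def evalAt (A : MatLaurent ℂ ι) (z : ℂ) : Matrix ι ι ℂ :=
  A.coeff.sum fun r a => z ^ r • a

/-- The value at `z` of a complex matrix polynomial. -/
noncomputable def polyEvalAt (P : MatPoly ℂ ι) (z : ℂ) : Matrix ι ι ℂ :=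
  P.sum fun r a => z ^ r • a

/-- Invertibility on the unit circle. -/
def InvertibleOnCircle (A : MatLaurent ℂ ι) : Prop :=
  ∀ z : ℂ, ‖z‖ = 1 → IsUnit (evalAt A z)

/-- Invertibility on the closed unit disk. -/
def InvertibleOnDisk (P : MatPoly ℂ ι) : Prop :=
  ∀ z : ℂ, ‖z‖ ≤ 1 → IsUnit (polyEvalAt P z)

/-- `A = A₊(z) D(z) A₋(z⁻¹)` is a Wiener-Hopf factorization with exponents `κ`: the factor `A₊`
is a polynomial in `z`, invertible for `|z| ≤ 1`, and `A₋` is a polynomial in `z⁻¹`, invertible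
for `|z⁻¹| ≤ 1` (the point `z = ∞`, that is `z⁻¹ = 0`, included). -/
structure IsWienerHopf (A : MatLaurent ℂ ι) (κ : ι → ℤ) (Ap Am : MatPoly ℂ ι) : Prop where
  eq : A = inZ Ap * diagonalFactor κ * inZInv Am
  plus_invertible : InvertibleOnDisk Ap
  minus_invertible : InvertibleOnDisk Am

/-- The signature of a (Hermitian) complex matrix: the number of positive eigenvalues minus the
number of negative eigenvalues, with multiplicities. -/
noncomputable def signature (M : Matrix ι ι ℂ) : ℤ :=
  open Classical in
  (M.charpoly.roots.countP (fun x : ℂ => 0 < x.re ∧ x.im = 0) : ℤ)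
    - (M.charpoly.roots.countP (fun x : ℂ => x.re < 0 ∧ x.im = 0) : ℤ)

end Complex

/-- `κ₁ ≥ … ≥ κ_d` are the partial indices of the complex `d × d` matrix Laurent polynomial `A`. -/
def IsPartialIndices {d : ℕ} (A : MatLaurent ℂ (Fin d)) (κ : Fin d → ℤ) : Prop :=
  Antitone κ ∧ ∃ Ap Am : MatPoly ℂ (Fin d), IsWienerHopf A κ Ap Am

/-- `κ₁ ≥ … ≥ κ_d` are such that the partial indices of the complex `2d × 2d` matrix Laurent
polynomial `A` are `κ₁, κ₁, κ₂, κ₂, …, κ_d, κ_d`, that is, two copies of each `κₘ`. Rows and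
columns of `A` are labelled by `Fin d × Fin 2`, with the label `(m, a)` standing for
`2 m + a`. -/
def IsDoubledPartialIndices {d : ℕ} (A : MatLaurent ℂ (Fin d × Fin 2)) (κ : Fin d → ℤ) : Prop :=
  Antitone κ ∧ ∃ Ap Am : MatPoly ℂ (Fin d × Fin 2), IsWienerHopf A (fun p => κ p.1) Ap Am

/-- The middle factor
`∑_{κₘ > 0} (z ^ κₘ |m̄⟩⟨m| + z ^ (-κₘ) |m⟩⟨m̄|) + ∑_{κₘ = 0} sₘ |m⟩⟨m|`,
where `m̄ = d + 1 - m` for labels `1, …, d`. -/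
noncomputable def middleFactor {R : Type} [Ring R] {d : ℕ} (κ s : Fin d → ℤ) :
    MatLaurent R (Fin d) :=
  (∑ m with 0 < κ m,
    (mono (κ m) (Matrix.single m.rev m 1) + mono (-κ m) (Matrix.single m m.rev 1)))
  + ∑ m with κ m = 0, mono 0 (Matrix.single m m (s m : R))

/-- Real matrices as complex matrices. -/
noncomputable def realRep (d : ℕ) : Matrix (Fin d) (Fin d) ℝ →+* Matrix (Fin d) (Fin d) ℂ :=
  Complex.ofRealHom.mapMatrix

/-- The representation of the quaternions by complex `2 × 2` matrices:
`a + b i + c j + d k ↦ !![a + b i, c + d i; -c + d i, a - b i]`. -/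
noncomputable def quaternionRep : Quaternion ℝ →+* Matrix (Fin 2) (Fin 2) ℂ where
  toFun q := !![⟨q.re, q.imI⟩, ⟨q.imJ, q.imK⟩; ⟨-q.imJ, q.imK⟩, ⟨q.re, -q.imI⟩]
  map_one' := by
    ext i j; fin_cases i <;> fin_cases j <;> simp [Complex.ext_iff] <;> exact ⟨rfl, rfl⟩
  map_mul' p q := by
    ext i j; fin_cases i <;> fin_cases j <;> simp [Complex.ext_iff, Matrix.mul_apply] <;>
      constructor <;> ring
  map_zero' := by
    ext i j; fin_cases i <;> fin_cases j <;> simp [Complex.ext_iff] <;> exact ⟨rfl, rfl⟩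
  map_add' p q := by
    ext i j; fin_cases i <;> fin_cases j <;> simp [Complex.ext_iff] <;> ring

/-- Quaternionic `d × d` matrices as complex `2d × 2d` matrices. -/
noncomputable def quaternionMatrixRep (d : ℕ) :
    Matrix (Fin d) (Fin d) (Quaternion ℝ) →+* Matrix (Fin d × Fin 2) (Fin d × Fin 2) ℂ :=
  (Matrix.compRingEquiv (Fin d) (Fin 2) ℂ).toRingHom.comp quaternionRep.mapMatrix

/-- A matrix Laurent polynomial as a complex one, through a representation of the coefficients. -/
noncomputable def mapLaurent {R n ι : Type} [Ring R] [Fintype n] [DecidableEq n] [Fintype ι]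
    [DecidableEq ι] (ρ : Matrix n n R →+* Matrix ι ι ℂ) (A : MatLaurent R n) : MatLaurent ℂ ι :=
  A.coeff.sum fun r a => mono r (ρ a)

end HermitianWH

open HermitianWH

/-! The zeros of a Hermitian A off the unit circle come in pairs reflected in it, and A₊ takes the
outer ones. There is a B with AB = qr·1, where q and r are real polynomials with zeros outside,
respectively inside, the circle. The Laurent rows of the form q⁻¹yA, with y polynomial, form a
module over the polynomials, and `exists_reduced_basis` gives it a basis H with independent leading
coefficients. Then A = EH and EY = q·1 with E, Y polynomial, so E is invertible on the closed disk.
Since A is self-adjoint, H = UE† with U self-adjoint, and coprimality of q with q† and of r with r†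
makes U and U⁻¹ Laurent (`exists_unimodular_factor`).

If k lists the row degrees of H, then U has row degrees at most kᵢ and U⁻¹ has column degrees at
most -kⱼ. By self-adjointness the exponents in entry (i, j) of U lie between -kⱼ and kᵢ. For sorted
k this makes U block triangular about the antidiagonal, with a constant Hermitian middle block, and
invertibility forces k to be symmetric under negation. Polynomial congruences clear the superfluous
blocks and reduce the middle one to signs (`exists_normalForm`). The partial indices are κ = -k.

The middle factor is J·diag(z^κ) with J a constant Hermitian involution, so (A₊J)·diag(z^κ)·A₊† is a
Wiener–Hopf factorization, and its exponents are unique by a Liouville argument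
(`IsWienerHopf.card_le`). At z = 1 the matrix A is congruent to J, so Sylvester's law of inertia
gives its signature as the trace of J, which is the sum of the signs up to the rank of the
representation.

All three cases are treated at once, over a division algebra with involution whose self-adjoint
elements are real (`RealStarField`). Determinants are taken only of complex matrices; B is brought
back to the division algebra by a left-linear projection (`IsMatrixRep`). -/

namespace HermitianWH

open Matrix LaurentPolynomial

/-! ### Additive maps on Laurent polynomials -/

section LaurentBasics

variable {R S : Type} [Ring R] [Ring S]

/-- Apply an additive map to the coefficients of a Laurent polynomial. -/
noncomputable def mapCoeff (f : R →+ S) : R[T;T⁻¹] →+ S[T;T⁻¹] where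
  toFun x := .ofCoeff (x.coeff.mapRange f f.map_zero)
  map_zero' := by ext; simp
  map_add' x y := by ext; simp

@[simp] lemma coeff_mapCoeff (f : R →+ S) (x : R[T;T⁻¹]) (i : ℤ) :
    (mapCoeff f x).coeff i = f (x.coeff i) := by
  simp [mapCoeff]

@[simp] lemma mapCoeff_monomial (f : R →+ S) (a : R) (i : ℤ) :
    mapCoeff f (C a * T i) = C (f a) * T i := by
  ext j
  rw [← single_eq_C_mul_T, ← single_eq_C_mul_T, coeff_mapCoeff]
  simp only [AddMonoidAlgebra.coeff_single, Finsupp.single_apply]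
  split_ifs <;> simp

lemma monomial_mul_monomial (a b : R) (i j : ℤ) :
    (C a * T i * (C b * T j) : R[T;T⁻¹]) = C (a * b) * T (i + j) := by
  simp only [← single_eq_C_mul_T, AddMonoidAlgebra.single_mul_single]

lemma coeff_monomial (a : R) (i j : ℤ) :
    (C a * T i : R[T;T⁻¹]).coeff j = if i = j then a else 0 := by
  rw [← single_eq_C_mul_T, AddMonoidAlgebra.coeff_single, Finsupp.single_apply]

/-- Two additive maps out of the Laurent polynomials which agree on monomials are equal. -/
lemma addHom_ext {G : Type*} [AddCommMonoid G] {f g : R[T;T⁻¹] →+ G}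
    (h : ∀ a i, f (C a * T i) = g (C a * T i)) : f = g := by
  refine DFunLike.ext _ _ fun x => ?_
  induction x using LaurentPolynomial.induction_on' with
  | add p q hp hq => rw [map_add, map_add, hp, hq]
  | C_mul_T n a => exact h a n

/-- The sum of an additive family over the coefficients of a Laurent polynomial. -/
noncomputable def coeffSum {G : Type*} [AddCommMonoid G] (f : ℤ → R →+ G) :
    R[T;T⁻¹] →+ G where
  toFun x := x.coeff.sum fun i a => f i a
  map_zero' := by simp
  map_add' x y := by
    rw [AddMonoidAlgebra.coeff_add]
    exact Finsupp.sum_add_index' (fun i => (f i).map_zero) fun i => (f i).map_add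

lemma coeffSum_monomial {G : Type*} [AddCommMonoid G] (f : ℤ → R →+ G) (a : R) (i : ℤ) :
    coeffSum f (C a * T i) = f i a := by
  rw [← single_eq_C_mul_T]
  exact Finsupp.sum_single_index (f i).map_zero

end LaurentBasics

/-! ### The involution on Laurent polynomials -/

section Star

variable {R : Type} [Ring R] [StarRing R]

/-- The involution `∑ a_r T ^ r ↦ ∑ (star a_r) T ^ (-r)` as an additive map. -/
noncomputable def laurentStar : R[T;T⁻¹] →+ R[T;T⁻¹] :=
  coeffSum fun i => ((AddMonoidHom.mulRight (T (-i))).comp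
    (C : R →+* R[T;T⁻¹]).toAddMonoidHom).comp (starAddEquiv : R ≃+ R).toAddMonoidHom

lemma laurentStar_monomial (a : R) (i : ℤ) :
    laurentStar (C a * T i : R[T;T⁻¹]) = C (star a) * T (-i) := by
  rw [laurentStar, coeffSum_monomial]; rfl

lemma coeff_laurentStar (x : R[T;T⁻¹]) (i : ℤ) :
    (laurentStar x).coeff i = star (x.coeff (-i)) := by
  induction x using LaurentPolynomial.induction_on' with
  | add p q hp hq => simp [hp, hq]
  | C_mul_T n a =>
    rw [laurentStar_monomial, coeff_monomial, coeff_monomial]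
    by_cases h : -n = i
    · rw [if_pos h, if_pos (by omega)]
    · rw [if_neg h, if_neg (by omega), star_zero]

/-- With `R` a matrix ring this involution is `dagger`; with `R` a division ring, entrywise use
gives the adjoint of a matrix of Laurent polynomials. -/
noncomputable instance : StarRing R[T;T⁻¹] where
  star := laurentStar
  star_involutive x := by
    ext i
    rw [coeff_laurentStar, coeff_laurentStar, neg_neg, star_star]
  star_mul x y := by
    induction x using LaurentPolynomial.induction_on' with
    | add p q hp hq =>
      change laurentStar _ = laurentStar _ * laurentStar _ at hp
      change laurentStar _ = laurentStar _ * laurentStar _ at hq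
      rw [add_mul, map_add, hp, hq, map_add, mul_add]
    | C_mul_T n a =>
      induction y using LaurentPolynomial.induction_on' with
      | add p q hp hq =>
        change laurentStar _ = laurentStar _ * laurentStar _ at hp
        change laurentStar _ = laurentStar _ * laurentStar _ at hq
        rw [mul_add, map_add, hp, hq, map_add, add_mul]
      | C_mul_T m b =>
        rw [monomial_mul_monomial, laurentStar_monomial, laurentStar_monomial,
          laurentStar_monomial, monomial_mul_monomial, star_mul, neg_add_rev]
  star_add x y := map_add laurentStar x y

@[simp] lemma coeff_star (x : R[T;T⁻¹]) (i : ℤ) : (star x).coeff i = star (x.coeff (-i)) :=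
  coeff_laurentStar x i

lemma star_monomial (a : R) (i : ℤ) : star (C a * T i : R[T;T⁻¹]) = C (star a) * T (-i) :=
  laurentStar_monomial a i

@[simp] lemma star_T (i : ℤ) : star (T i : R[T;T⁻¹]) = T (-i) := by
  simpa using star_monomial (1 : R) i

@[simp] lemma star_C (a : R) : star (C a : R[T;T⁻¹]) = C (star a) := by
  simpa using star_monomial a 0

end Star

/-! ### Bounds on the exponents that occur -/

section Support

variable {R : Type} [Ring R]

/-- No exponents above `k` occur. -/
def ExpLE (x : R[T;T⁻¹]) (k : ℤ) : Prop := ∀ i, k < i → x.coeff i = 0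

/-- No exponents below `k` occur. -/
def ExpGE (x : R[T;T⁻¹]) (k : ℤ) : Prop := ∀ i, i < k → x.coeff i = 0

variable {x y : R[T;T⁻¹]} {k l : ℤ}

lemma ExpLE.mono (h : ExpLE x k) (hkl : k ≤ l) : ExpLE x l := fun i hi => h i (by omega)
lemma ExpGE.mono (h : ExpGE x k) (hkl : l ≤ k) : ExpGE x l := fun i hi => h i (by omega)
lemma ExpLE.zero : ExpLE (0 : R[T;T⁻¹]) k := fun i _ => by simp
lemma ExpGE.zero : ExpGE (0 : R[T;T⁻¹]) k := fun i _ => by simp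
lemma ExpLE.add (hx : ExpLE x k) (hy : ExpLE y k) : ExpLE (x + y) k := fun i hi => by
  simp [hx i hi, hy i hi]
lemma ExpGE.add (hx : ExpGE x k) (hy : ExpGE y k) : ExpGE (x + y) k := fun i hi => by
  simp [hx i hi, hy i hi]
lemma ExpLE.neg (hx : ExpLE x k) : ExpLE (-x) k := fun i hi => by simp [hx i hi]
lemma ExpGE.neg (hx : ExpGE x k) : ExpGE (-x) k := fun i hi => by simp [hx i hi]
lemma ExpLE.sub (hx : ExpLE x k) (hy : ExpLE y k) : ExpLE (x - y) k := by
  rw [sub_eq_add_neg]; exact hx.add hy.neg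
lemma ExpGE.sub (hx : ExpGE x k) (hy : ExpGE y k) : ExpGE (x - y) k := by
  rw [sub_eq_add_neg]; exact hx.add hy.neg

lemma ExpLE.sum {ι : Type*} {s : Finset ι} {f : ι → R[T;T⁻¹]} (h : ∀ i ∈ s, ExpLE (f i) k) :
    ExpLE (∑ i ∈ s, f i) k := by
  intro j hj
  simp only [AddMonoidAlgebra.coeff_sum, Finsupp.finsetSum_apply]
  exact Finset.sum_eq_zero fun i hi => h i hi j hj

lemma ExpGE.sum {ι : Type*} {s : Finset ι} {f : ι → R[T;T⁻¹]} (h : ∀ i ∈ s, ExpGE (f i) k) :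
    ExpGE (∑ i ∈ s, f i) k := by
  intro j hj
  simp only [AddMonoidAlgebra.coeff_sum, Finsupp.finsetSum_apply]
  exact Finset.sum_eq_zero fun i hi => h i hi j hj

lemma expLE_monomial (a : R) (k : ℤ) : ExpLE (C a * T k) k := fun i hi => by
  rw [coeff_monomial, if_neg (by omega)]
lemma expGE_monomial (a : R) (k : ℤ) : ExpGE (C a * T k) k := fun i hi => by
  rw [coeff_monomial, if_neg (by omega)]
lemma expGE_C (a : R) : ExpGE (C a) 0 := by simpa using expGE_monomial a 0
lemma expLE_T (k : ℤ) : ExpLE (T k : R[T;T⁻¹]) k := by simpa using expLE_monomial (1 : R) k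
lemma expGE_T (k : ℤ) : ExpGE (T k : R[T;T⁻¹]) k := by simpa using expGE_monomial (1 : R) k

lemma ExpLE.coeff_mul (hx : ExpLE x k) (hy : ExpLE y l) :
    (x * y).coeff (k + l) = x.coeff k * y.coeff l := by
  rw [AddMonoidAlgebra.coeff_mul_apply_left, Finsupp.sum_eq_single k]
  · rw [neg_add_cancel_left]
  · intro i hi hik
    have : i < k := lt_of_le_of_ne (not_lt.mp fun h => hi (hx i h)) hik
    rw [hy _ (by omega), mul_zero]
  · simp

lemma ExpGE.coeff_mul (hx : ExpGE x k) (hy : ExpGE y l) :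
    (x * y).coeff (k + l) = x.coeff k * y.coeff l := by
  rw [AddMonoidAlgebra.coeff_mul_apply_left, Finsupp.sum_eq_single k]
  · rw [neg_add_cancel_left]
  · intro i hi hik
    have : k < i := lt_of_le_of_ne (not_lt.mp fun h => hi (hx i h)) (Ne.symm hik)
    rw [hy _ (by omega), mul_zero]
  · simp

lemma ExpLE.mul (hx : ExpLE x k) (hy : ExpLE y l) : ExpLE (x * y) (k + l) := by
  intro i hi
  have := (hx.mono (l := i - l) (by omega)).coeff_mul hy
  rw [sub_add_cancel, hx _ (by omega), zero_mul] at this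
  exact this

lemma ExpGE.mul (hx : ExpGE x k) (hy : ExpGE y l) : ExpGE (x * y) (k + l) := by
  intro i hi
  have := (hx.mono (l := i - l) (by omega)).coeff_mul hy
  rw [sub_add_cancel, hx _ (by omega), zero_mul] at this
  exact this

lemma ExpGE.eq_zero (hx : ExpGE x k) (hx' : ExpLE x l) (h : l < k) : x = 0 := by
  ext i
  rcases lt_or_ge i k with hi | hi
  · rw [hx i hi]; rfl
  · rw [hx' i (by omega)]; rfl

lemma exists_expLE (x : R[T;T⁻¹]) : ∃ k : ℕ, ExpLE x k := by
  refine ⟨x.coeff.support.sup Int.natAbs, fun i hi => ?_⟩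
  by_contra h
  have := Finset.le_sup (f := Int.natAbs) (Finsupp.mem_support_iff.mpr h)
  omega

lemma exists_expGE (x : R[T;T⁻¹]) : ∃ k : ℕ, ExpGE x (-k) := by
  refine ⟨x.coeff.support.sup Int.natAbs, fun i hi => ?_⟩
  by_contra h
  have := Finset.le_sup (f := Int.natAbs) (Finsupp.mem_support_iff.mpr h)
  omega

lemma ExpLE.star [StarRing R] (hx : ExpLE x k) : ExpGE (star x) (-k) := fun i hi => by
  rw [coeff_star, hx _ (by omega), star_zero]
lemma ExpGE.star [StarRing R] (hx : ExpGE x k) : ExpLE (star x) (-k) := fun i hi => by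
  rw [coeff_star, hx _ (by omega), star_zero]

lemma ExpGE.eq_C (hx : ExpGE x 0) (hx' : ExpLE x 0) : x = C (x.coeff 0) := by
  ext i
  rw [C_apply]
  split_ifs with h
  · rw [h]
  · rcases lt_or_gt_of_ne h with h | h
    · rw [hx i h]
    · rw [hx' i h]

lemma exists_toLaurent (hx : ExpGE x 0) : ∃ p : Polynomial R, Polynomial.toLaurent p = x := by
  refine ⟨LaurentPolynomial.trunc x, ?_⟩
  have hx' : x = ∑ i ∈ x.coeff.support, C (x.coeff i) * T i := by
    ext j
    simp only [AddMonoidAlgebra.coeff_sum, Finsupp.finsetSum_apply, coeff_monomial]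
    simp only [Finset.sum_ite_eq', Finsupp.mem_support_iff]
    split_ifs with h
    · rfl
    · simpa using h
  rw [hx', map_sum, map_sum]
  refine Finset.sum_congr rfl fun i hi => ?_
  have h0 : 0 ≤ i := by
    by_contra h
    exact (Finsupp.mem_support_iff.mp hi) (hx i (by omega))
  lift i to ℕ using h0
  rw [trunc_C_mul_T, if_pos (by omega), Int.toNat_natCast, Polynomial.toLaurent_C_mul_T]

lemma expGE_toLaurent (p : Polynomial R) : ExpGE (Polynomial.toLaurent p) 0 := by
  induction p using Polynomial.induction_on' with
  | add p q hp hq => rw [map_add]; exact hp.add hq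
  | monomial n a =>
    rw [Polynomial.toLaurent_C_mul_T]; exact (expGE_monomial a n).mono (by omega)

lemma coeff_toLaurent_natCast (p : Polynomial R) (n : ℕ) :
    (Polynomial.toLaurent p).coeff n = p.coeff n := by
  induction p using Polynomial.induction_on' with
  | add p q hp hq =>
    rw [map_add, AddMonoidAlgebra.coeff_add, Finsupp.add_apply, hp, hq, Polynomial.coeff_add]
  | monomial m a =>
    rw [Polynomial.toLaurent_C_mul_T, coeff_monomial, Polynomial.coeff_monomial]
    simp

end Support

end HermitianWH

namespace HermitianWH

open Matrix LaurentPolynomial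

/-! ### Splitting a self-adjoint element symmetrically -/

section Abstract

variable {S M : Type*} [CommRing S] [StarRing S] [Ring M] [StarRing M] [Algebra S M]
  [StarModule S M]

/-- If `A = E H` is self-adjoint, `E` is invertible up to the scalar `q`, `H` is invertible up to
the scalar `r`, `E⁻¹ A = H` and each of `q`, `r` is coprime to its adjoint, then
`A = E U E†` with `U` self-adjoint and invertible. -/
theorem exists_selfAdjoint_unit_factor {A E H Y K : M} {q r : S} (hA : star A = A)
    (hYA : Y * A = q • H) (hEY : E * Y = q • 1) (hYE : Y * E = q • 1)
    (hKH : K * H = r • 1) (hq : IsCoprime q (star q)) (hr : IsCoprime r (star r))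
    (tq : ∀ x : M, q • x = 0 → x = 0) (tq' : ∀ x : M, star q • x = 0 → x = 0)
    (tr : ∀ x : M, r • x = 0 → x = 0) (tr' : ∀ x : M, star r • x = 0 → x = 0) :
    ∃ U U' : M, star U = U ∧ U * star E = H ∧ U * U' = 1 ∧ U' * U = 1 ∧ U' * H = star E := by
  have cq : ∀ x y : M, q • x = q • y → x = y := fun x y h =>
    sub_eq_zero.mp (tq _ (by rw [smul_sub, h, sub_self]))
  have cq' : ∀ x y : M, star q • x = star q • y → x = y := fun x y h =>
    sub_eq_zero.mp (tq' _ (by rw [smul_sub, h, sub_self]))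
  have cr : ∀ x y : M, r • x = r • y → x = y := fun x y h =>
    sub_eq_zero.mp (tr _ (by rw [smul_sub, h, sub_self]))
  have cr' : ∀ x y : M, star r • x = star r • y → x = y := fun x y h =>
    sub_eq_zero.mp (tr' _ (by rw [smul_sub, h, sub_self]))
  obtain ⟨a, b, hab⟩ := hq
  obtain ⟨a', b', hab'⟩ := hr
  -- The left side is Y A Y†, which is self-adjoint.
  have h1 : q • (H * star Y) = star q • (Y * star H) := by
    have e1 : q • (H * star Y) = Y * A * star Y := by rw [hYA, smul_mul_assoc]
    have e2 : star (Y * A * star Y) = Y * A * star Y := by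
      simp only [star_mul, star_star, hA, mul_assoc]
    rw [e1, ← e2, ← e1, star_smul, star_mul, star_star]
  -- The element sought is H(E†)⁻¹, which equals both YH†/q and HY†/q†. The Bézout relation aq + bq†
  -- = 1 combines the two fractions into one without denominator.
  set U := a • (Y * star H) + b • (H * star Y) with hU
  have hU1 : star q • U = H * star Y := by
    rw [hU, smul_add, smul_comm _ a, ← h1, smul_smul, smul_smul, ← add_smul, mul_comm _ b, hab,
      one_smul]
  have hU2 : q • U = Y * star H := by
    rw [hU, smul_add, smul_comm _ b, h1, smul_smul, smul_smul, ← add_smul, mul_comm _ a, hab,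
      one_smul]
  have hUs : star U = U := by
    apply cq
    have := congrArg star hU1
    rw [star_smul, star_star, star_mul, star_star] at this
    rw [this, hU2]
  have hUE : U * star E = H := by
    apply cq'
    rw [← smul_mul_assoc, hU1, mul_assoc, ← star_mul, hEY, star_smul, star_one, mul_smul_comm,
      mul_one]
  have hYE' : star E * star Y = star q • 1 := by rw [← star_mul, hYE, star_smul, star_one]
  -- The inverse of U should be E†H⁻¹ = E†K/r. Its denominator is removed below in the same way,
  -- with the coprimality of r and r†.
  have hKU : star E * K * U = r • 1 := by
    apply cq'
    have : star E * K * U * (star E * star Y) = r • (star E * star Y) := by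
      calc star E * K * U * (star E * star Y) = star E * (K * (U * star E)) * star Y := by
            simp only [mul_assoc]
        _ = r • (star E * star Y) := by rw [hUE, hKH, mul_smul_comm, mul_one, smul_mul_assoc]
    rw [hYE', mul_smul_comm, mul_one, smul_comm] at this
    exact this
  set N := star E * K with hN
  have hUN : U * star N = star r • 1 := by
    have := congrArg star hKU
    rwa [star_mul, hUs, star_smul, star_one] at this
  have hNN : star r • N = r • star N := by
    have : N * (U * star N) = N * U * star N := (mul_assoc _ _ _).symm
    rwa [hUN, hKU, mul_smul_comm, mul_one, smul_mul_assoc, one_mul] at this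
  set U' := a' • N + b' • star N with hU'
  have hU'1 : r • U' = N := by
    rw [hU', smul_add, smul_comm _ b', ← hNN, smul_smul, smul_smul, ← add_smul, mul_comm _ a',
      hab', one_smul]
  have hU'2 : star r • U' = star N := by
    rw [hU', smul_add, smul_comm _ a', hNN, smul_smul, smul_smul, ← add_smul, mul_comm _ b',
      hab', one_smul]
  have hU'U : U' * U = 1 := by
    apply cr
    rw [← smul_mul_assoc, hU'1, hKU]
  refine ⟨U, U', hUs, hUE, ?_, hU'U, ?_⟩
  · apply cr'
    rw [← mul_smul_comm, hU'2, hUN]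
  · rw [← hUE, ← mul_assoc, hU'U, one_mul]

end Abstract

/-- Division algebras with involution in which the self-adjoint elements are the real numbers. -/
class RealStarField (F : Type) [DivisionRing F] [StarRing F] [Algebra ℝ F] : Prop where
  star_algebraMap : ∀ r : ℝ, star (algebraMap ℝ F r) = algebraMap ℝ F r
  exists_real : ∀ a : F, star a = a → ∃ r : ℝ, algebraMap ℝ F r = a

/-! ### Real Laurent polynomials as central scalars -/

section RealScalars

variable (F : Type) [DivisionRing F] [Algebra ℝ F]

/-- Real Laurent polynomials as Laurent polynomials over `F`. -/
noncomputable def realLaurent : ℝ[T;T⁻¹] →+* F[T;T⁻¹] :=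
  AddMonoidAlgebra.mapRingHom ℤ (algebraMap ℝ F)

variable {F}

@[simp] lemma coeff_realLaurent (x : ℝ[T;T⁻¹]) (i : ℤ) :
    (realLaurent F x).coeff i = algebraMap ℝ F (x.coeff i) :=
  AddMonoidAlgebra.coeff_mapRingHom _ _ _

lemma realLaurent_monomial (a : ℝ) (i : ℤ) :
    realLaurent F (C a * T i) = C (algebraMap ℝ F a) * T i := by
  ext j
  rw [coeff_realLaurent, coeff_monomial, coeff_monomial]
  split_ifs <;> simp

lemma realLaurent_commute (x : ℝ[T;T⁻¹]) (y : F[T;T⁻¹]) : Commute (realLaurent F x) y := by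
  induction x using LaurentPolynomial.induction_on' with
  | add p q hp hq => rw [map_add]; exact hp.add_left hq
  | C_mul_T n a =>
    induction y using LaurentPolynomial.induction_on' with
    | add p q hp hq => exact hp.add_right hq
    | C_mul_T m b =>
      rw [Commute, SemiconjBy, realLaurent_monomial, monomial_mul_monomial,
        monomial_mul_monomial, Algebra.commutes, add_comm]

lemma realLaurent_injective : Function.Injective (realLaurent F) := by
  intro x y h
  ext i
  have := congrArg (fun z => AddMonoidAlgebra.coeff z i) h
  simpa using this

noncomputable instance realLaurentAlgebra : Algebra ℝ[T;T⁻¹] F[T;T⁻¹] :=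
  (realLaurent F).toAlgebra' realLaurent_commute

lemma realLaurent_smul (x : ℝ[T;T⁻¹]) (y : F[T;T⁻¹]) : x • y = realLaurent F x * y := rfl

lemma eq_zero_of_realLaurent_smul {x : ℝ[T;T⁻¹]} (hx : x ≠ 0) {y : F[T;T⁻¹]} (h : x • y = 0) :
    y = 0 := by
  rw [realLaurent_smul] at h
  exact (mul_eq_zero.mp h).resolve_left fun h0 => hx (realLaurent_injective (by rw [h0, map_zero]))

lemma matrix_eq_zero_of_realLaurent_smul {n : Type} {x : ℝ[T;T⁻¹]} (hx : x ≠ 0)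
    {y : Matrix n n F[T;T⁻¹]} (h : x • y = 0) : y = 0 := by
  ext1 i j
  exact eq_zero_of_realLaurent_smul hx (congrFun (congrFun h i) j)

lemma ExpGE.realLaurent {x : ℝ[T;T⁻¹]} {k : ℤ} (h : ExpGE x k) : ExpGE (realLaurent F x) k :=
  fun i hi => by rw [coeff_realLaurent, h i hi, map_zero]

lemma ExpLE.realLaurent {x : ℝ[T;T⁻¹]} {k : ℤ} (h : ExpLE x k) : ExpLE (realLaurent F x) k :=
  fun i hi => by rw [coeff_realLaurent, h i hi, map_zero]

variable [StarRing F] [RealStarField F]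

instance : StarModule ℝ[T;T⁻¹] F[T;T⁻¹] where
  star_smul x y := by
    rw [realLaurent_smul, realLaurent_smul, star_mul, (realLaurent_commute (star x) (star y)).eq]
    congr 1
    ext i
    rw [coeff_star, coeff_realLaurent, coeff_realLaurent, coeff_star,
      RealStarField.star_algebraMap, star_trivial (x.coeff (-i))]

end RealScalars

/-! ### Row reduced bases -/

section Reduced

variable {F : Type} [DivisionRing F] {n : Type} [Fintype n]

/-- The predictable degree property of row reduced matrices. -/
lemma expLE_of_sum_mul {m : Type} {x : n → F[T;T⁻¹]} {H : n → m → F[T;T⁻¹]} {k : n → ℤ} {t : ℤ}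
    (hH : ∀ i j, ExpLE (H i j) (k i))
    (hlead : ∀ c : n → F, (∀ j, ∑ i, c i * (H i j).coeff (k i) = 0) → c = 0)
    (hx : ∀ j, ExpLE (∑ i, x i * H i j) t) (i : n) : ExpLE (x i) (t - k i) := by
  -- The bounds hold with some common excess N, which is then lowered one step at a time.
  suffices h : ∀ N : ℕ, (∀ i, ExpLE (x i) (t - k i + N)) → ∀ i, ExpLE (x i) (t - k i) by
    choose d hd using fun i => exists_expLE (x i)
    refine h (∑ i, ((d i : ℤ) - (t - k i)).toNat) (fun i => (hd i).mono ?_) i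
    have := Finset.single_le_sum (f := fun i => ((d i : ℤ) - (t - k i)).toNat)
      (fun _ _ => Nat.zero_le _) (Finset.mem_univ i)
    push_cast
    zify at this
    have h2 := Int.self_le_toNat ((d i : ℤ) - (t - k i))
    linarith
  intro N
  induction N with
  | zero => intro h; simpa using h
  | succ N ih =>
    intro h
    apply ih
    -- This row of extreme coefficients times the leading coefficient matrix of H is the coefficient
    -- of exponent t + N + 1 in the product, which vanishes.
    have h0 : (fun i => (x i).coeff (t - k i + (N + 1 : ℕ))) = 0 := by
      refine hlead _ fun j => ?_
      have h1 := hx j (t + (N + 1 : ℕ)) (by push_cast; omega)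
      rw [AddMonoidAlgebra.coeff_sum, Finsupp.finsetSum_apply] at h1
      rw [← h1]
      refine Finset.sum_congr rfl fun i _ => ?_
      rw [← (h i).coeff_mul (hH i j)]
      congr 1
      ring
    intro i e he
    rcases lt_or_ge (t - k i + (N + 1 : ℕ)) e with h' | h'
    · exact h i e h'
    · have : e = t - k i + (N + 1 : ℕ) := by push_cast at *; omega
      rw [this]
      exact congrFun h0 i

variable [DecidableEq n]

/-- Steinitz exchange: since `c i` is nonzero, `v i` is recovered from the new family, which
therefore still spans. -/
lemma linearIndependent_update {v : n → n → F} (hv : LinearIndependent F v) (c : n → F) {i : n}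
    (hi : c i ≠ 0) : LinearIndependent F (Function.update v i (∑ j, c j • v j)) := by
  have hcard : Fintype.card n = Module.finrank F (n → F) := by simp
  refine linearIndependent_of_top_le_span_of_card_eq_finrank ?_ hcard
  rw [← hv.span_eq_top_of_card_eq_finrank' hcard, Submodule.span_le]
  set W := Submodule.span F (Set.range (Function.update v i (∑ j, c j • v j))) with hW
  have h1 : ∀ j, j ≠ i → v j ∈ W := fun j hj =>
    Submodule.subset_span ⟨j, by rw [Function.update_of_ne hj]⟩
  have h2 : ∑ j, c j • v j ∈ W := Submodule.subset_span ⟨i, by rw [Function.update_self]⟩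
  rintro _ ⟨j, rfl⟩
  by_cases hj : j = i
  · subst hj
    have h3 : c j • v j ∈ W := by
      rw [← Finset.add_sum_erase _ _ (Finset.mem_univ j)] at h2
      refine (Submodule.add_mem_iff_left _ (Submodule.sum_mem _ fun l hl => ?_)).mp h2
      exact Submodule.smul_mem _ _ (h1 l (Finset.ne_of_mem_erase hl))
    exact (Submodule.smul_mem_iff _ hi).mp h3
  · exact h1 j hj

/-- A module of Laurent row vectors over the polynomials, of full rank and with degrees bounded
below, has a basis with independent leading coefficients. -/
theorem exists_reduced_basis (N : AddSubgroup (n → F[T;T⁻¹]))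
    (hN : ∀ (p : F[T;T⁻¹]) (u : n → F[T;T⁻¹]), ExpGE p 0 → u ∈ N → p • u ∈ N)
    (b : ℤ) (hb : ∀ u ∈ N, (∀ j, ExpLE (u j) b) → u = 0)
    (hfull : ∃ (k : n → ℤ) (H : n → n → F[T;T⁻¹]), (∀ i, H i ∈ N) ∧
      (∀ i j, ExpLE (H i j) (k i)) ∧ LinearIndependent F (fun i j => (H i j).coeff (k i))) :
    ∃ (k : n → ℤ) (H : n → n → F[T;T⁻¹]), (∀ i, H i ∈ N) ∧
      (∀ i j, ExpLE (H i j) (k i)) ∧ LinearIndependent F (fun i j => (H i j).coeff (k i)) ∧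
      -- Among all families with independent leading coefficients one with least degree sum is
      -- taken. The sum is bounded below because a row of degree at most b is zero.
      ∀ u ∈ N, ∃ p : n → F[T;T⁻¹], (∀ i, ExpGE (p i) 0) ∧ u = ∑ i, p i • H i := by
  classical
  obtain ⟨m, ⟨k, H, hHN, hHk, hind, hkm⟩, hmin⟩ := Int.exists_least_of_bdd
    (P := fun m => ∃ (k : n → ℤ) (H : n → n → F[T;T⁻¹]), (∀ i, H i ∈ N) ∧
      (∀ i j, ExpLE (H i j) (k i)) ∧ LinearIndependent F (fun i j => (H i j).coeff (k i)) ∧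
      ∑ i, k i = m)
    (by
      refine ⟨∑ _i : n, b, ?_⟩
      rintro m ⟨k, H, hHN, hHk, hind, rfl⟩
      refine Finset.sum_le_sum fun i _ => ?_
      by_contra hlt
      have h0 := hb (H i) (hHN i) fun j => (hHk i j).mono (by omega)
      refine hind.ne_zero i ?_
      ext j
      simp [h0])
    (by
      obtain ⟨k, H, h1, h2, h3⟩ := hfull
      exact ⟨_, k, H, h1, h2, h3, rfl⟩)
  refine ⟨k, H, hHN, hHk, hind, ?_⟩
  have hcard : Fintype.card n = Module.finrank F (n → F) := by simp
  have key : ∀ (s : ℕ), ∀ u ∈ N, (∀ j, ExpLE (u j) (b + s)) →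
      ∃ p : n → F[T;T⁻¹], (∀ i, ExpGE (p i) 0) ∧ u = ∑ i, p i • H i := by
    intro s
    induction s with
    | zero =>
      intro u hu hu'
      refine ⟨0, fun i => ExpGE.zero, ?_⟩
      rw [hb u hu (by simpa using hu')]
      simp
    | succ s ih =>
      intro u hu hu'
      set t : ℤ := b + (s + 1 : ℕ) with ht
      have hspan : (fun j => (u j).coeff t) ∈
          Submodule.span F (Set.range fun i j => (H i j).coeff (k i)) := by
        rw [hind.span_eq_top_of_card_eq_finrank' hcard]; trivial
      obtain ⟨c, hc⟩ := (Submodule.mem_span_range_iff_exists_fun F).mp hspan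
      -- Otherwise replacing the row H i by u would keep the leading coefficients independent and
      -- lower the degree sum.
      have hct : ∀ i, c i ≠ 0 → k i ≤ t := by
        intro i hi
        by_contra hlt
        have := hmin (∑ l, Function.update k i t l)
          ⟨Function.update k i t, Function.update H i u, ?_, ?_, ?_, rfl⟩
        · rw [Finset.sum_update_of_mem (Finset.mem_univ i), ← hkm,
            ← Finset.add_sum_erase _ _ (Finset.mem_univ i), Finset.sdiff_singleton_eq_erase] at this
          omega
        · intro l
          by_cases hl : l = i
          · subst hl; simpa using hu
          · simpa [hl] using hHN l
        · intro l j
          by_cases hl : l = i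
          · subst hl; simpa using hu' j
          · simpa [hl] using hHk l j
        · convert linearIndependent_update hind c hi using 1
          ext l j
          by_cases hl : l = i
          · subst hl; simp [hc]
          · simp [hl]
      -- The coefficient of exponent t cancels; the multipliers are polynomials because of `hct`.
      set u' := u - ∑ i, (C (c i) * T (t - k i)) • H i with hu'def
      have hmon : ∀ i, ExpGE (C (c i) * T (t - k i)) 0 := by
        intro i
        by_cases hi : c i = 0
        · rw [hi, map_zero, zero_mul]; exact ExpGE.zero
        · exact (expGE_monomial _ _).mono (by linarith [hct i hi])
      have hu'N : u' ∈ N :=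
        N.sub_mem hu (N.sum_mem fun i _ => hN _ _ (hmon i) (hHN i))
      obtain ⟨p, hp, hpu⟩ := ih u' hu'N (by
        intro j e he
        have hsum : u' j = u j - ∑ i, C (c i) * T (t - k i) * H i j := by
          simp [hu'def, Finset.sum_apply]
        have hle : ∀ i, ExpLE (C (c i) * T (t - k i) * H i j) t := fun i => by
          simpa using (expLE_monomial (c i) (t - k i)).mul (hHk i j)
        rw [hsum]
        rcases lt_or_ge t e with h' | h'
        · exact (hu' j).sub (ExpLE.sum fun i _ => hle i) e h'
        · have he' : e = t := by push_cast at ht; omega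
          subst he'
          rw [AddMonoidAlgebra.coeff_sub, Finsupp.sub_apply, AddMonoidAlgebra.coeff_sum,
            Finsupp.finsetSum_apply, sub_eq_zero]
          have := congrFun hc j
          rw [← this, Finset.sum_apply]
          refine Finset.sum_congr rfl fun i _ => ?_
          have h2 := (expLE_monomial (c i) (t - k i)).coeff_mul (hHk i j)
          rw [sub_add_cancel, coeff_monomial, if_pos rfl] at h2
          rw [h2]; rfl)
      refine ⟨fun i => p i + C (c i) * T (t - k i), fun i => (hp i).add (hmon i), ?_⟩
      simp only [add_smul, Finset.sum_add_distrib, ← hpu, hu'def, sub_add_cancel]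
  intro u hu
  choose d hd using fun j => exists_expLE (u j)
  refine key (∑ j, ((d j : ℤ) - b).toNat) u hu fun j => (hd j).mono ?_
  have := Finset.single_le_sum (f := fun j => ((d j : ℤ) - b).toNat)
    (fun _ _ => Nat.zero_le _) (Finset.mem_univ j)
  have h2 := Int.self_le_toNat ((d j : ℤ) - b)
  zify at this
  push_cast at this ⊢
  linarith

end Reduced

end HermitianWH

namespace HermitianWH

open Matrix LaurentPolynomial

/-! ### Moving the outer zeros into a polynomial factor -/

section Unimodular

lemma exists_top_coeff {R : Type} [Ring R] {x : R[T;T⁻¹]} (hx : x ≠ 0) :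
    ∃ e, ExpLE x e ∧ x.coeff e ≠ 0 := by
  have hne : x.coeff.support.Nonempty := by
    rw [Finsupp.support_nonempty_iff]
    exact fun h => hx (AddMonoidAlgebra.coeff_injective h)
  refine ⟨x.coeff.support.max' hne, fun i hi => ?_, ?_⟩
  · by_contra h
    exact absurd (Finset.le_max' _ _ (Finsupp.mem_support_iff.mpr h)) (not_le.mpr hi)
  · exact Finsupp.mem_support_iff.mp (Finset.max'_mem _ hne)

/-- The adjoint relation B†A = c† supplies a left inverse up to a scalar, and evaluating B†AB in two
ways compares it with B. This replaces a determinant argument. -/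
lemma mul_comm_of_selfAdjoint {S M : Type*} [CommRing S] [StarRing S] [Ring M] [StarRing M]
    [Algebra S M] [StarModule S M] {A B : M} {c : S} (hA : star A = A) (hAB : A * B = c • 1)
    (tc : ∀ x : M, star c • x = 0 → x = 0) : B * A = c • 1 := by
  have h1 : star B * A = star c • 1 := by
    have := congrArg star hAB
    rwa [star_mul, hA, star_smul, star_one] at this
  have h2 : star c • B = c • star B := by
    have : star B * (A * B) = star B * A * B := (mul_assoc _ _ _).symm
    rw [hAB, h1, mul_smul_comm, mul_one, smul_mul_assoc, one_mul] at this
    exact this.symm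
  refine sub_eq_zero.mp (tc _ ?_)
  rw [smul_sub, ← smul_mul_assoc, h2, smul_mul_assoc, h1, smul_comm, sub_self]

variable {F : Type} [DivisionRing F]

lemma exists_forall_expLE {n m : Type} [Fintype n] [Fintype m] (A : Matrix n m F[T;T⁻¹]) :
    ∃ d : ℕ, ∀ i j, ExpLE (A i j) d := by
  choose d hd using fun i j => exists_expLE (A i j)
  refine ⟨∑ i, ∑ j, d i j, fun i j => (hd i j).mono ?_⟩
  exact_mod_cast (Finset.single_le_sum (f := fun j => d i j) (fun _ _ => Nat.zero_le _)
    (Finset.mem_univ j)).trans (Finset.single_le_sum (f := fun i => ∑ j, d i j)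
    (fun _ _ => Nat.zero_le _) (Finset.mem_univ i))

lemma exists_forall_expGE {n m : Type} [Fintype n] [Fintype m] (A : Matrix n m F[T;T⁻¹]) :
    ∃ d : ℕ, ∀ i j, ExpGE (A i j) (-d) := by
  choose d hd using fun i j => exists_expGE (A i j)
  refine ⟨∑ i, ∑ j, d i j, fun i j => (hd i j).mono ?_⟩
  have h : d i j ≤ ∑ i, ∑ j, d i j :=
    (Finset.single_le_sum (f := fun j => d i j) (fun _ _ => Nat.zero_le _)
    (Finset.mem_univ j)).trans (Finset.single_le_sum (f := fun i => ∑ j, d i j)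
    (fun _ _ => Nat.zero_le _) (Finset.mem_univ i))
  zify at h
  push_cast at h ⊢
  omega

variable [Algebra ℝ F]

lemma ExpGE.real_smul {x : ℝ[T;T⁻¹]} {y : F[T;T⁻¹]} {k l : ℤ} (hx : ExpGE x k)
    (hy : ExpGE y l) : ExpGE (x • y) (k + l) :=
  hx.realLaurent.mul hy

/-- The 1 × 1 case of the predictable degree property. -/
lemma ExpLE.of_real_smul {x : ℝ[T;T⁻¹]} {y : F[T;T⁻¹]} {t : ℤ} (hx : ExpLE x 0)
    (hx0 : x.coeff 0 ≠ 0) (hy : ExpLE (x • y) t) : ExpLE y t := by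
  have := expLE_of_sum_mul (n := Unit) (m := Unit) (x := fun _ => y)
    (H := fun _ _ => HermitianWH.realLaurent F x) (k := fun _ => 0) (t := t) (fun _ _ => hx.realLaurent)
    (fun c hc => ?_) (fun _ => ?_) ()
  · simpa using this
  · ext
    have := hc ()
    rw [Fintype.sum_unique, coeff_realLaurent] at this
    exact (mul_eq_zero.mp this).resolve_right (by simpa using hx0)
  · rw [Fintype.sum_unique, ← (realLaurent_commute x y).eq]
    exact hy

variable [StarRing F] [RealStarField F] {n : Type} [Fintype n] [DecidableEq n]

/-- A nonsingular Hermitian matrix Laurent polynomial `A` is `E U E†`, where the zeros outside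
the unit circle have been moved to `E`, `U` is invertible over the Laurent polynomials, and the
degrees of the rows of `U` and of the columns of `U⁻¹` match. -/
theorem exists_unimodular_factor {A B : Matrix n n F[T;T⁻¹]} (hA : star A = A)
    {q r : ℝ[T;T⁻¹]} (hq0 : ExpGE q 0) (hr0 : ExpGE r 0) (hq00 : q.coeff 0 ≠ 0) (hr : r ≠ 0)
    (hAB : A * B = (q * r) • 1) (hqc : IsCoprime q (star q)) (hrc : IsCoprime r (star r)) :
    ∃ (k : n → ℤ) (E Y U U' : Matrix n n F[T;T⁻¹]),
      (∀ i j, ExpGE (E i j) 0) ∧ (∀ i j, ExpGE (Y i j) 0) ∧ E * Y = q • 1 ∧ Y * E = q • 1 ∧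
      star U = U ∧ A = E * U * star E ∧ U * U' = 1 ∧ U' * U = 1 ∧
      (∀ i j, ExpLE (U i j) (k i)) ∧ ∀ i j, ExpLE (U' i j) (-k j) := by
  have hq : q ≠ 0 := fun h => hq00 (by rw [h]; rfl)
  have hsq : star q ≠ 0 := by simpa using hq
  have hsr : star r ≠ 0 := by simpa using hr
  have hqr : q * r ≠ 0 := mul_ne_zero hq hr
  have hBA : B * A = (q * r) • 1 := mul_comm_of_selfAdjoint hA hAB fun x hx =>
    matrix_eq_zero_of_realLaurent_smul (by simpa using hqr) hx
  obtain ⟨dB, hdB⟩ := exists_forall_expLE B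
  obtain ⟨m, hm⟩ := exists_forall_expGE B
  obtain ⟨e, hre, hre0⟩ := exists_top_coeff hr
  -- The Laurent rows q⁻¹yA with y polynomial: the row module of A, enlarged so as to remove the
  -- zeros that A has at the zeros of q.
  let N : AddSubgroup (n → F[T;T⁻¹]) :=
    { carrier := {u | ∃ y : n → F[T;T⁻¹], (∀ i, ExpGE (y i) 0) ∧ y ᵥ* A = q • u}
      zero_mem' := ⟨0, fun _ => ExpGE.zero, by simp⟩
      add_mem' := by
        rintro u v ⟨y, hy, hyu⟩ ⟨z, hz, hzv⟩
        exact ⟨y + z, fun i => (hy i).add (hz i), by rw [add_vecMul, hyu, hzv, smul_add]⟩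
      neg_mem' := by
        rintro u ⟨y, hy, hyu⟩
        exact ⟨-y, fun i => (hy i).neg, by rw [neg_vecMul, hyu, smul_neg]⟩ }
  have hNsmul : ∀ (p : F[T;T⁻¹]) (u : n → F[T;T⁻¹]), ExpGE p 0 → u ∈ N → p • u ∈ N := by
    rintro p u hp ⟨y, hy, hyu⟩
    refine ⟨p • y, fun i => by simpa using hp.mul (hy i), ?_⟩
    rw [smul_vecMul, hyu, smul_comm]
  -- Here uB = ry has no negative exponents, yet a small degree of u leaves it only negative ones.
  -- Hence y, and with it u, is zero.
  have hNb : ∀ u ∈ N, (∀ j, ExpLE (u j) (-dB - 1)) → u = 0 := by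
    rintro u ⟨y, hy, hyu⟩ hu
    have h1 : u ᵥ* B = r • y := by
      have h2 : q • (u ᵥ* B) = q • (r • y) := by
        rw [← smul_vecMul, ← hyu, vecMul_vecMul, hAB, vecMul_smul, vecMul_one, smul_smul]
      rw [← sub_eq_zero, ← smul_sub] at h2
      ext1 i
      exact sub_eq_zero.mp (eq_zero_of_realLaurent_smul hq (congrFun h2 i))
    have h3 : y = 0 := by
      ext1 i
      refine eq_zero_of_realLaurent_smul hr ?_
      have h4 : ExpGE (r • y i) 0 := by simpa using hr0.real_smul (hy i)
      refine h4.eq_zero (l := -1) ?_ (by omega)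
      rw [← Pi.smul_apply, ← h1]
      refine ExpLE.sum fun j _ => ((hu j).mul (hdB j i)).mono (by omega)
    rw [h3, zero_vecMul] at hyu
    ext1 i
    exact eq_zero_of_realLaurent_smul hq (congrFun hyu.symm i)
  -- The witness is y = T^m times row i of B, polynomial by the choice of m, since BA = qr·1. These
  -- multiples of the unit rows show that the module has full rank.
  have hrow : ∀ i, (fun j => if i = j then realLaurent F r * T (m : ℤ) else 0) ∈ N := by
    intro i
    refine ⟨(T (m : ℤ) : F[T;T⁻¹]) • B i, fun j => ?_, ?_⟩
    · simpa using (expGE_T (R := F) m).mul (hm i j)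
    · have h1 : B i ᵥ* A = (B * A) i := rfl
      rw [smul_vecMul, h1, hBA]
      ext1 j
      simp only [Pi.smul_apply, Matrix.smul_apply, Matrix.one_apply]
      split_ifs with h
      · simp only [realLaurent_smul, smul_eq_mul, map_mul, mul_one, T_mul, mul_assoc]
      · simp
  obtain ⟨k, H, hHN, hHk, hind, hspan⟩ := exists_reduced_basis N hNsmul (-dB - 1) hNb
    ⟨fun _ => e + m, fun i j => if i = j then realLaurent F r * T (m : ℤ) else 0, hrow,
      fun i j => by
        beta_reduce
        split_ifs
        · exact hre.realLaurent.mul (expLE_T _)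
        · exact ExpLE.zero, by
      rw [Fintype.linearIndependent_iff]
      intro c hc i
      have := congrFun hc i
      simp only [Finset.sum_apply, Pi.smul_apply, smul_eq_mul, Pi.zero_apply] at this
      rw [Finset.sum_eq_single i (fun j _ hj => by simp [hj]) (by simp), if_pos rfl,
        hre.realLaurent.coeff_mul (expLE_T _), coeff_realLaurent] at this
      simpa [hre0] using this⟩
  have hlead : ∀ c : n → F, (∀ j, ∑ i, c i * (H i j).coeff (k i) = 0) → c = 0 := by
    intro c hc
    rw [Fintype.linearIndependent_iff] at hind
    ext1 i
    refine hind c ?_ i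
    ext j
    simpa using hc j
  let H' : Matrix n n F[T;T⁻¹] := Matrix.of H
  have hmulH : ∀ p : n → F[T;T⁻¹], ∑ i, p i • H i = p ᵥ* H' := fun p => by
    ext1 j
    simp [H', vecMul, dotProduct, Finset.sum_apply]
  -- The zero product has degree at most t for every t, so by the predictable degree property the
  -- entries of X have arbitrarily low degree.
  have hrightcancel : ∀ X : Matrix n n F[T;T⁻¹], X * H' = 0 → X = 0 := by
    intro X hX
    ext1 i j
    have h1 : ∀ t, ExpLE (X i j) (t - k j) := fun t =>
      expLE_of_sum_mul (x := X i) (H := H) hHk hlead (fun l => by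
        have : ∑ s, X i s * H s l = (X * H') i l := rfl
        rw [this, hX]; exact ExpLE.zero) j
    obtain ⟨g, hg⟩ := exists_expGE (X i j)
    exact hg.eq_zero (h1 (k j - g - 1)) (by omega)
  choose Y hY hYA using hHN
  have hAN : ∀ i, A i ∈ N := by
    intro i
    refine ⟨q • Pi.single i 1, fun j => ?_, ?_⟩
    · by_cases hj : j = i
      · subst hj
        simpa using hq0.real_smul (expGE_C (1 : F))
      · simpa [hj] using ExpGE.zero
    · rw [smul_vecMul, single_one_vecMul]; rfl
  choose E hE hAE using fun i => hspan _ (hAN i)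
  choose K _ hKH using fun i => hspan _ (hrow i)
  have hAE' : A = Matrix.of E * H' := by
    refine funext fun i => ?_
    rw [hAE i, hmulH]; rfl
  have hYA' : Matrix.of Y * A = q • H' := by
    exact funext hYA
  -- EYA = qEH = qA, and A can be cancelled on the right by means of B.
  have hEY : Matrix.of E * Matrix.of Y = q • 1 := by
    refine sub_eq_zero.mp (matrix_eq_zero_of_realLaurent_smul hqr ?_)
    have h1 : (Matrix.of E * Matrix.of Y - q • 1) * (A * B) = 0 := by
      rw [← mul_assoc, sub_mul, mul_assoc, hYA', mul_smul_comm, ← hAE', smul_mul_assoc, one_mul,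
        sub_self, zero_mul]
    rwa [hAB, mul_smul_comm, mul_one] at h1
  have hYE : Matrix.of Y * Matrix.of E = q • 1 := by
    refine sub_eq_zero.mp (hrightcancel _ ?_)
    rw [sub_mul, mul_assoc, ← hAE', hYA', smul_mul_assoc, one_mul, sub_self]
  have hKH' : ((T (-m : ℤ) : F[T;T⁻¹]) • Matrix.of K) * H' = r • (1 : Matrix n n F[T;T⁻¹]) := by
    rw [smul_mul_assoc]
    ext1 i j
    have h1 : (Matrix.of K * H') i j = if i = j then realLaurent F r * T (m : ℤ) else 0 := by
      have := congrFun (hKH i) j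
      rw [hmulH] at this
      exact this.symm
    rw [Matrix.smul_apply, h1, Matrix.smul_apply, Matrix.one_apply]
    split_ifs with h
    · rw [smul_eq_mul, T_mul, mul_assoc, ← T_add, realLaurent_smul]; simp
    · simp
  obtain ⟨U, U', hU, hUE, hUU', hU'U, hU'H⟩ := exists_selfAdjoint_unit_factor hA hYA' hEY hYE hKH'
    hqc hrc (fun x => matrix_eq_zero_of_realLaurent_smul hq)
    (fun x => matrix_eq_zero_of_realLaurent_smul hsq)
    (fun x => matrix_eq_zero_of_realLaurent_smul hr)
    (fun x => matrix_eq_zero_of_realLaurent_smul hsr)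
  refine ⟨k, Matrix.of E, Matrix.of Y, U, U', fun i j => hE i j, fun i j => hY i j, hEY, hYE, hU,
    ?_, hUU', hU'U, ?_, ?_⟩
  · rw [mul_assoc, hUE, hAE']
  · intro i j
    -- Y† has no positive exponents, so row i of the product has degree at most k i. Division by q†
    -- preserves the bound because q† has degree zero with leading coefficient q(0).
    have h1 : star q • U = H' * star (Matrix.of Y) := by
      rw [← hUE, mul_assoc, ← star_mul, hYE, star_smul, star_one, mul_smul_comm, mul_one]
    refine ExpLE.of_real_smul (x := star q) ?_ ?_ ?_
    · simpa using hq0.star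
    · simpa using hq00
    · rw [← Matrix.smul_apply, h1]
      refine ExpLE.sum fun l _ => ?_
      have h2 : ExpLE (star (Y j l)) 0 := by simpa using (hY j l).star
      have := (hHk i l).mul h2
      rwa [add_zero] at this
  · intro i j
    -- U'H = E† has no positive exponents, and the predictable degree property bounds the columns of
    -- U'.
    have := expLE_of_sum_mul (x := U' i) (H := H) (t := 0) hHk hlead (fun l => by
      have h1 : ∑ s, U' i s * H s l = (U' * H') i l := rfl
      rw [h1, hU'H]
      simpa using (hE l i).star) j
    simpa using this

end Unimodular

end HermitianWH

namespace HermitianWH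

open Matrix

/-! ### Counting indices through zero patterns -/

section Counting

/-- If an invertible matrix vanishes where `k i < k' j`, then the values of `k` dominate those
of `k'`. -/
lemma card_lt_le_of_invertible {F : Type} [DivisionRing F] {n : Type} [Fintype n] [DecidableEq n]
    {U U' : Matrix n n F} (hU : U * U' = 1) {k k' : n → ℤ}
    (h : ∀ i j, k i < k' j → U i j = 0) (a : ℤ) :
    Fintype.card {i // k i < a} ≤ Fintype.card {j // k' j < a} := by
  -- The rows with k i < a vanish outside the columns with k' j < a, so restricting them to those
  -- columns keeps them independent.
  have hind : LinearIndependent F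
      (fun (i : {i // k i < a}) (j : {j // k' j < a}) => U i.1 j.1) := by
    rw [Fintype.linearIndependent_iff]
    intro c hc
    let c' : n → F := fun i => if hi : k i < a then c ⟨i, hi⟩ else 0
    have hsum : ∀ j, (c' ᵥ* U) j = ∑ i : {i // k i < a}, c i * U i.1 j := by
      intro j
      have h1 : ∀ i : {i // k i < a}, c i * U i.1 j = c' i.1 * U i.1 j := fun i => by
        simp [c', i.2]
      rw [Finset.sum_congr rfl fun i _ => h1 i,
        ← Finset.sum_subtype (Finset.univ.filter fun i => k i < a) (by simp)
          (fun i => c' i * U i j), Finset.sum_filter_of_ne]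
      · rfl
      · intro i _ hi
        by_contra hlt
        exact hi (by simp [c', hlt])
    have h0 : c' ᵥ* U = 0 := by
      ext1 j
      rw [hsum]
      by_cases hj : k' j < a
      · simpa using congrFun hc ⟨j, hj⟩
      · refine Finset.sum_eq_zero fun i _ => ?_
        rw [h _ _ (lt_of_lt_of_le i.2 (not_lt.mp hj)), mul_zero]
    have h1 : c' = 0 := by
      have : c' ᵥ* (U * U') = 0 := by rw [← vecMul_vecMul, h0, zero_vecMul]
      rwa [hU, vecMul_one] at this
    intro i
    have := congrFun h1 i.1
    simpa [c', i.2] using this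
  simpa using hind.fintype_card_le_finrank

/-- If k i < k' i, count the values below a = k' i: for k all indices from i on qualify, for k' only
indices strictly after i. -/
lemma antitone_le_of_card_lt_le {d : ℕ} {k k' : Fin d → ℤ} (hk : Antitone k) (hk' : Antitone k')
    (h : ∀ a, Fintype.card {i // k i < a} ≤ Fintype.card {i // k' i < a}) (i : Fin d) :
    k' i ≤ k i := by
  by_contra hlt
  push Not at hlt
  have h1 := h (k' i)
  rw [Fintype.card_subtype, Fintype.card_subtype] at h1
  have h2 : Finset.Ici i ⊆ Finset.univ.filter fun j => k j < k' i := by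
    intro j hj
    simp only [Finset.mem_Ici] at hj
    simpa using (hk hj).trans_lt hlt
  have h3 : Finset.univ.filter (fun j => k' j < k' i) ⊆ Finset.Ioi i := by
    intro j hj
    simp only [Finset.mem_filter, Finset.mem_univ, true_and] at hj
    simp only [Finset.mem_Ioi]
    by_contra hji
    exact absurd (hk' (not_lt.mp hji)) (not_le.mpr hj)
  have h4 := (Finset.card_le_card h2).trans (h1.trans (Finset.card_le_card h3))
  rw [Fin.card_Ici, Fin.card_Ioi] at h4
  omega

lemma antitone_eq_of_card_lt_eq {d : ℕ} {k k' : Fin d → ℤ} (hk : Antitone k) (hk' : Antitone k')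
    (h : ∀ a, Fintype.card {i // k i < a} = Fintype.card {i // k' i < a}) : k = k' := by
  ext i
  exact le_antisymm (antitone_le_of_card_lt_le hk' hk (fun a => (h a).ge) i)
    (antitone_le_of_card_lt_le hk hk' (fun a => (h a).le) i)

end Counting

/-! ### Hermitian forms over the division algebra -/

section Diagonalization

lemma two_ne_zero_of_real {F : Type} [DivisionRing F] [Algebra ℝ F] : (2 : F) ≠ 0 := by
  have : (algebraMap ℝ F) 2 ≠ 0 := by simp
  simpa only [map_ofNat] using this

variable {F : Type} [DivisionRing F] [StarRing F]

/-- The sesquilinear form with matrix `c`. -/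
def sesqForm {n : Type} [Fintype n] (c : Matrix n n F) (x y : n → F) : F := (x ᵥ* c) ⬝ᵥ star y

variable {n : Type} [Fintype n] {c : Matrix n n F}

lemma sesqForm_add_left (x y z : n → F) :
    sesqForm c (x + y) z = sesqForm c x z + sesqForm c y z := by
  simp [sesqForm, add_vecMul, add_dotProduct]

lemma sesqForm_smul_left (a : F) (x z : n → F) :
    sesqForm c (a • x) z = a * sesqForm c x z := by
  simp [sesqForm, smul_vecMul]

lemma sesqForm_sum_left {ι : Type} (s : Finset ι) (x : ι → n → F) (z : n → F) :
    sesqForm c (∑ i ∈ s, x i) z = ∑ i ∈ s, sesqForm c (x i) z := by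
  classical
  induction s using Finset.induction_on with
  | empty => simp [sesqForm]
  | insert i s hi ih => rw [Finset.sum_insert hi, Finset.sum_insert hi, sesqForm_add_left, ih]

lemma star_sesqForm (hc : cᴴ = c) (x y : n → F) : star (sesqForm c x y) = sesqForm c y x := by
  rw [sesqForm, sesqForm, ← star_dotProduct_star, star_star, star_vecMul, hc, dotProduct_mulVec]

lemma sesqForm_add_right (hc : cᴴ = c) (x y z : n → F) :
    sesqForm c x (y + z) = sesqForm c x y + sesqForm c x z := by
  rw [← star_sesqForm hc, sesqForm_add_left, star_add, star_sesqForm hc, star_sesqForm hc]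

lemma sesqForm_smul_right (hc : cᴴ = c) (a : F) (x z : n → F) :
    sesqForm c x (a • z) = sesqForm c x z * star a := by
  rw [← star_sesqForm hc, sesqForm_smul_left, star_mul, star_sesqForm hc]

lemma sesqForm_nondegenerate [DecidableEq n] {c' : Matrix n n F} (hcc : c * c' = 1) (hc : cᴴ = c) {y : n → F}
    (hy : ∀ x, sesqForm c x y = 0) : y = 0 := by
  have h1 : y ᵥ* c = 0 := by
    ext1 i
    have := hy (Pi.single i 1)
    rw [← star_sesqForm hc, star_eq_zero] at this
    have hs : star (Pi.single i (1 : F)) = (Pi.single i 1 : n → F) := by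
      ext j; by_cases h : j = i <;> simp [h]
    rwa [sesqForm, hs, dotProduct_single_one] at this
  have : y ᵥ* (c * c') = 0 := by rw [← vecMul_vecMul, h1, zero_vecMul]
  rwa [hcc, vecMul_one] at this

/-- A family of vectors which is orthonormal up to signs. -/
def IsSignedOrthonormal {ι : Type} [DecidableEq ι] (c : Matrix n n F) (v : ι → n → F)
    (ε : ι → ℤ) : Prop :=
  (∀ i, ε i = 1 ∨ ε i = -1) ∧ ∀ i j, sesqForm c (v i) (v j) = if i = j then (ε i : F) else 0

variable [Algebra ℝ F] [RealStarField F]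

/-- An anisotropic vector can be scaled to have length `1` or `-1`. -/
lemma exists_unit_scaling (hc : cᴴ = c) {y : n → F} (hy : sesqForm c y y ≠ 0) :
    ∃ (t : F) (ε : ℤ), (ε = 1 ∨ ε = -1) ∧ sesqForm c (t • y) (t • y) = ε := by
  obtain ⟨r, hr⟩ := RealStarField.exists_real _ (star_sesqForm hc y y)
  have hr0 : r ≠ 0 := by rintro rfl; exact hy (by rw [← hr, map_zero])
  have h1 : ∀ s : ℝ, sesqForm c (algebraMap ℝ F s • y) (algebraMap ℝ F s • y)
      = algebraMap ℝ F (s * r * s) := by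
    intro s
    rw [sesqForm_smul_left, sesqForm_smul_right hc, RealStarField.star_algebraMap, ← hr, map_mul,
      map_mul, mul_assoc]
  have h2 : 0 < |r| := abs_pos.mpr hr0
  have h3 : (√|r|)⁻¹ * |r| * (√|r|)⁻¹ = 1 := by
    have := Real.mul_self_sqrt h2.le
    have h4 : √|r| ≠ 0 := (Real.sqrt_pos.mpr h2).ne'
    field_simp
    rw [sq, this]
  refine ⟨algebraMap ℝ F (√|r|)⁻¹, if 0 < r then 1 else -1, by split_ifs <;> simp, ?_⟩
  rw [h1]
  split_ifs with h
  · rw [abs_of_pos h] at h3 ⊢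
    simp [h3]
  · rw [abs_of_neg (lt_of_le_of_ne (not_lt.mp h) hr0)] at h3 ⊢
    have : (√(-r))⁻¹ * r * (√(-r))⁻¹ = -1 := by linarith
    simp [this]

/-- An anisotropic vector orthogonal to the family can be normalized and appended. If there is none,
the orthogonal complement is totally isotropic by polarization, hence zero by nondegeneracy, and the
family already spans. -/
lemma IsSignedOrthonormal.exists_extension [DecidableEq n] {m : ℕ} (hc : cᴴ = c) {c' : Matrix n n F}
    (hcc : c * c' = 1) {v : Fin m → n → F} {ε : Fin m → ℤ} (h : IsSignedOrthonormal c v ε)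
    (hm : m < Fintype.card n) :
    ∃ (w : Fin (m + 1) → n → F) (δ : Fin (m + 1) → ℤ), IsSignedOrthonormal c w δ := by
  by_cases hW : ∃ y, (∀ i, sesqForm c y (v i) = 0) ∧ sesqForm c y y ≠ 0
  · obtain ⟨y, hy, hyy⟩ := hW
    obtain ⟨t, e, he, hte⟩ := exists_unit_scaling hc hyy
    refine ⟨Fin.snoc v (t • y), Fin.snoc ε e, fun i => ?_, fun i j => ?_⟩
    · refine Fin.lastCases ?_ (fun i => ?_) i
      · simpa using he
      · simpa using h.1 i
    · have h1 : ∀ i, sesqForm c (t • y) (v i) = 0 := fun i => by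
        rw [sesqForm_smul_left, hy, mul_zero]
      have h2 : ∀ i, sesqForm c (v i) (t • y) = 0 := fun i => by
        rw [← star_sesqForm hc, h1, star_zero]
      refine Fin.lastCases ?_ (fun i => ?_) i
      · refine Fin.lastCases ?_ (fun j => ?_) j
        · simpa using hte
        · simpa [(Fin.castSucc_lt_last j).ne'] using h1 j
      · refine Fin.lastCases ?_ (fun j => ?_) j
        · simpa [(Fin.castSucc_lt_last i).ne] using h2 i
        · simpa using h.2 i j
  · exfalso
    push Not at hW
    have hiso : ∀ x y, (∀ i, sesqForm c x (v i) = 0) → (∀ i, sesqForm c y (v i) = 0) →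
        sesqForm c x y = 0 := by
      intro x y hx hy
      set a := sesqForm c x y with ha
      -- With the scalar a† both cross terms equal a†a, so polarization works over noncommutative
      -- scalars too.
      have h1 := hW (star a • x + y) fun i => by
        rw [sesqForm_add_left, sesqForm_smul_left, hx, hy, mul_zero, add_zero]
      rw [sesqForm_add_left, sesqForm_add_right hc, sesqForm_add_right hc, hW y hy,
        sesqForm_smul_left, sesqForm_smul_left, sesqForm_smul_right hc, hW x hx, zero_mul, mul_zero,
        zero_add, add_zero, sesqForm_smul_right hc, ← star_sesqForm hc x y, ← ha, star_star,
        ← two_mul] at h1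
      rcases mul_eq_zero.mp ((mul_eq_zero.mp h1).resolve_left two_ne_zero_of_real) with h2 | h2
      · exact star_eq_zero.mp h2
      · exact h2
    have hεε : ∀ i, (ε i : F) * ε i = 1 := fun i => by rcases h.1 i with h1 | h1 <;> simp [h1]
    have hproj : ∀ x i, sesqForm c (x - ∑ j, (sesqForm c x (v j) * ε j) • v j) (v i) = 0 := by
      intro x i
      rw [sub_eq_add_neg, sesqForm_add_left, ← neg_one_smul F, sesqForm_smul_left,
        sesqForm_sum_left, Finset.sum_eq_single i]
      · rw [sesqForm_smul_left, h.2, if_pos rfl, mul_assoc, hεε]; simp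
      · intro j _ hj
        rw [sesqForm_smul_left, h.2, if_neg hj, mul_zero]
      · simp
    have hzero : ∀ y, (∀ i, sesqForm c y (v i) = 0) → y = 0 := by
      intro y hy
      refine sesqForm_nondegenerate hcc hc fun x => ?_
      have h1 := hiso _ y (hproj x) hy
      have h2 : x = (x - ∑ j, (sesqForm c x (v j) * ε j) • v j)
          + ∑ j, (sesqForm c x (v j) * ε j) • v j := by abel
      rw [h2, sesqForm_add_left, h1, zero_add, sesqForm_sum_left]
      refine Finset.sum_eq_zero fun j _ => ?_
      rw [sesqForm_smul_left, ← star_sesqForm hc y (v j), hy, star_zero, mul_zero]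
    have hspan : Submodule.span F (Set.range v) = ⊤ := by
      rw [eq_top_iff]
      intro x _
      rw [sub_eq_zero.mp (hzero _ (hproj x))]
      exact Submodule.sum_mem _ fun j _ => Submodule.smul_mem _ _ (Submodule.subset_span ⟨j, rfl⟩)
    have := finrank_range_le_card (R := F) v
    rw [Set.finrank, hspan, finrank_top] at this
    simp at this
    omega

/-- Nonsingular Hermitian forms have a signed orthonormal basis, with the signs sorted. -/
theorem exists_signed_diagonalization [DecidableEq n] [LinearOrder n] (hc : cᴴ = c) {c' : Matrix n n F}
    (hcc : c * c' = 1) :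
    ∃ (Q Q' : Matrix n n F) (ε : n → ℤ), Q * Q' = 1 ∧ Q' * Q = 1 ∧ (∀ i, ε i = 1 ∨ ε i = -1) ∧
      Monotone ε ∧ Q * c * Qᴴ = diagonal fun i => (ε i : F) := by
  have hex : ∀ m ≤ Fintype.card n, ∃ (v : Fin m → n → F) (ε : Fin m → ℤ),
      IsSignedOrthonormal c v ε := by
    intro m
    induction m with
    | zero => intro _; exact ⟨Fin.elim0, Fin.elim0, fun i => i.elim0, fun i => i.elim0⟩
    | succ m ih =>
      intro hm
      obtain ⟨v, ε, h⟩ := ih (by omega)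
      exact h.exists_extension hc hcc (by omega)
  obtain ⟨v, ε, hε, hv⟩ := hex _ le_rfl
  let e : n ≃o Fin (Fintype.card n) := (Fintype.orderIsoFinOfCardEq n rfl).symm
  let σ := Tuple.sort ε
  -- Permuting the basis vectors puts the negative signs first.
  have hσ : Monotone (ε ∘ σ) := Tuple.monotone_sort ε
  let Q : Matrix n n F := Matrix.of fun i => v (σ (e i))
  have hQ : Q * c * Qᴴ = diagonal fun i => (ε (σ (e i)) : F) := by
    ext i j
    have h1 : (Q * c * Qᴴ) i j = sesqForm c (v (σ (e i))) (v (σ (e j))) := rfl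
    rw [h1, hv, diagonal_apply]
    simp
  have hQQ : Q * (c * Qᴴ * diagonal fun i => (ε (σ (e i)) : F)) = 1 := by
    rw [← mul_assoc, ← mul_assoc, hQ, diagonal_mul_diagonal, ← diagonal_one]
    congr 1
    ext i
    rcases hε (σ (e i)) with h | h <;> simp [h]
  exact ⟨Q, _, fun i => ε (σ (e i)), hQQ, mul_eq_one_comm.mp hQQ, fun i => hε _,
    hσ.comp e.monotone, hQ⟩

end Diagonalization

end HermitianWH

namespace HermitianWH

open Matrix LaurentPolynomial

/-! ### Block elimination with orthogonal idempotents -/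

section Idempotents

variable {S M : Type*} [CommRing S] [StarRing S] [Ring M] [StarRing M] [Algebra S M]
  [StarModule S M]

/-- Block elimination for a self-adjoint unit whose block form, with respect to a decomposition
`1 = p + z + m`, is block triangular with respect to the antidiagonal. -/
lemma exists_block_elimination {p z m U U' : M} (hsp : star p = p) (hsz : star z = z)
    (hone : p + z + m = 1) {c : S} (hc : c + c = 1) (hsc : star c = c)
    (hU : star U = U) (hU' : star U' = U') (hUU' : U * U' = 1) (hU'U : U' * U = 1)
    (hmm : m * U * m = 0) (hmz : m * U * z = 0) (hzm : z * U * m = 0)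
    (hpp' : p * U' * p = 0) (hpz' : p * U' * z = 0) :
    (((c • p + z) * U * p * U') * ((c • p + z) * U * p * U') = 0) ∧
    (1 - (c • p + z) * U * p * U') * U * star (1 - (c • p + z) * U * p * U') =
      p * U * m + m * U * p + z * U * z := by
  -- The blocks to be removed are cleared by X = gUpU' from the left and X† from the right. Both act
  -- on the (p, p) block, which is why p carries the factor 1/2.
  set g := c • p + z with hg
  have hsg : star g = g := by rw [hg, star_add, star_smul, hsp, hsz, hsc]
  have hpg : p * U' * g = 0 := by
    rw [hg, mul_add, mul_smul_comm, hpp', hpz', smul_zero, add_zero]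
  constructor
  · calc g * U * p * U' * (g * U * p * U') = g * U * (p * U' * g) * (U * p * U') := by
          simp only [mul_assoc]
      _ = 0 := by rw [hpg, mul_zero, zero_mul]
  · have h1 : star (g * U * p * U') = U' * p * U * g := by
      simp only [star_mul, hsg, hU, hU', hsp, mul_assoc]
    have h2 : g * U * p * U' * U = g * U * p := by rw [mul_assoc, hU'U, mul_one]
    have h3 : U * (U' * p * U * g) = p * U * g := by
      rw [← mul_assoc, ← mul_assoc, ← mul_assoc, hUU', one_mul]
    have h4 : g * U * p * (U' * p * U * g) = 0 := by
      calc g * U * p * (U' * p * U * g) = g * U * (p * U' * p) * U * g := by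
            simp only [mul_assoc]
        _ = 0 := by rw [hpp', mul_zero, zero_mul, zero_mul]
    have h5 : (p + z + m) * U * (p + z + m) = p * U * p + (p * U * z + z * U * p) +
        (p * U * m + m * U * p + z * U * z) := by
      simp only [add_mul, mul_add, hmm, hmz, hzm]
      abel
    have h6 : g * U * p + p * U * g = p * U * p + (p * U * z + z * U * p) := by
      have : p * U * p = c • (p * U * p) + c • (p * U * p) := by rw [← add_smul, hc, one_smul]
      rw [hg]
      simp only [add_mul, mul_add, smul_mul_assoc, mul_smul_comm]
      nth_rewrite 3 [this]
      abel
    rw [hone, one_mul, mul_one, ← h6] at h5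
    rw [star_sub, star_one, h1, sub_mul, one_mul, h2, mul_sub, mul_one, sub_mul, h3, h4, sub_zero]
    nth_rewrite 1 [h5]
    abel

/-- Normalization of the blocks left by the elimination. -/
lemma exists_block_normalization {p z m U U' h Q Q' : M} (hsp : star p = p) (hsz : star z = z)
    (hsm : star m = m) (hone : p + z + m = 1) (hp2 : p * p = p) (hm2 : m * m = m)
    (hpz : p * z = 0) (hzp : z * p = 0) (hpm : p * m = 0) (hmp : m * p = 0) (hzm : z * m = 0)
    (hmz : m * z = 0)
    (hU' : star U' = U') (hUU' : U * U' = 1) (hU'U : U' * U = 1)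
    (hUmm : m * U * m = 0) (hUmz : m * U * z = 0) (hUzm : z * U * m = 0)
    (hUpp' : p * U' * p = 0) (hUzp' : z * U' * p = 0)
    (hhm : h * m = h) (hph : p * h = h) (hhh : h * star h = p) (hhh' : star h * h = m)
    (hzQ : z * Q = Q) (hQz : Q * z = Q) (hzQ' : z * Q' = Q') (hQz' : Q' * z = Q')
    (hQQ' : Q * Q' = z) (hQQ : Q' * Q = z) :
    (m + Q + h * U' * p) * (m + Q' + p * U * star h) = 1 ∧
    (m + Q' + p * U * star h) * (m + Q + h * U' * p) = 1 ∧
    (m + Q + h * U' * p) * (p * U * m + m * U * p + z * U * z) * star (m + Q + h * U' * p) =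
      h + star h + Q * U * star Q := by
  have kill {a e f b : M} (ha : a * e = a) (hb : f * b = b) (hef : e * f = 0) : a * b = 0 := by
    rw [← ha, ← hb, mul_assoc, ← mul_assoc e, hef, zero_mul, mul_zero]
  have hmh : m * star h = star h := by rw [← hsm, ← star_mul, hhm]
  have hhp : star h * p = star h := by rw [← hsp, ← star_mul, hph]
  have hzQs : z * star Q = star Q := by rw [← hsz, ← star_mul, hQz]
  have hz2 : z * z = z := by
    nth_rewrite 2 [← hQQ']
    rw [← mul_assoc, hzQ, hQQ']
  have rt (a b e : M) (he : b * e = b) : a * b * e = a * b := by rw [mul_assoc, he]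
  have lt (a b c e : M) (he : e * a = a) : e * (a * b * c) = a * b * c := by
    rw [← mul_assoc, ← mul_assoc, he]
  have hUm : U * m = p * U * m := by
    have : (p + z + m) * (U * m) = U * m := by rw [hone, one_mul]
    simpa only [add_mul, ← mul_assoc, hUzm, hUmm, add_zero] using this.symm
  have hmU : m * U = m * U * p := by
    have : m * U * (p + z + m) = m * U := by rw [hone, mul_one]
    simpa only [mul_add, hUmz, hUmm, add_zero] using this.symm
  have hU'p : U' * p = m * U' * p := by
    have : (p + z + m) * (U' * p) = U' * p := by rw [hone, one_mul]
    simpa only [add_mul, ← mul_assoc, hUzp', hUpp', zero_add] using this.symm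
  -- The vanishing blocks make the (p, m) block of U and the (m, p) block of U' inverse to each
  -- other. Multiplying by hU'p therefore turns the former into h.
  have h1 : U' * p * (U * m) = m := by
    rw [mul_assoc, ← mul_assoc p, ← hUm, ← mul_assoc, hU'U, one_mul]
  have h2 : p * U * m * (U' * p) = p := by
    rw [mul_assoc, ← mul_assoc m, ← hU'p, mul_assoc, ← mul_assoc U, hUU', one_mul, hp2]
  have h3 : m * U * p * (U' * m) = m := by
    rw [← hmU, mul_assoc, ← mul_assoc U, hUU', one_mul, hm2]
  refine ⟨?_, ?_, ?_⟩
  · have e1 : m * Q' = 0 := kill hm2 hzQ' hmz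
    have e2 : m * (p * U * star h) = 0 := kill hm2 (lt _ _ _ _ hp2) hmp
    have e3 : Q * m = 0 := kill hQz hm2 hzm
    have e4 : Q * (p * U * star h) = 0 := kill hQz (lt _ _ _ _ hp2) hzp
    have e5 : h * U' * p * m = 0 := kill (rt _ _ _ hp2) hm2 hpm
    have e6 : h * U' * p * Q' = 0 := kill (rt _ _ _ hp2) hzQ' hpz
    have e7 : h * U' * p * (p * U * star h) = p := by
      calc h * U' * p * (p * U * star h) = h * (U' * (p * p) * (U * star h)) := by
            simp only [mul_assoc]
        _ = h * (U' * p * (U * m)) * star h := by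
            rw [hp2, ← hmh, ← hmh]; simp only [mul_assoc, hmh]
        _ = p := by rw [h1, hhm, hhh]
    rw [add_mul, add_mul, mul_add, mul_add, mul_add, mul_add, mul_add, mul_add, hm2, e1, e2, e3,
      hQQ', e4, e5, e6, e7, ← hone]
    abel
  · have e1 : m * Q = 0 := kill hm2 hzQ hmz
    have e2 : m * (h * U' * p) = 0 := kill hm2 (lt _ _ _ _ hph) hmp
    have e3 : Q' * m = 0 := kill hQz' hm2 hzm
    have e4 : Q' * (h * U' * p) = 0 := kill hQz' (lt _ _ _ _ hph) hzp
    have e5 : p * U * star h * m = 0 := kill (rt _ _ _ hhp) hm2 hpm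
    have e6 : p * U * star h * Q = 0 := kill (rt _ _ _ hhp) hzQ hpz
    have e7 : p * U * star h * (h * U' * p) = p := by
      calc p * U * star h * (h * U' * p) = p * U * (star h * h) * (U' * p) := by
            simp only [mul_assoc]
        _ = p := by rw [hhh', h2]
    rw [add_mul, add_mul, mul_add, mul_add, mul_add, mul_add, mul_add, mul_add, hm2, e1, e2, e3,
      hQQ, e4, e5, e6, e7, ← hone]
    abel
  · have e1 : m * (p * U * m) = 0 := kill hm2 (lt _ _ _ _ hp2) hmp
    have e2 : m * (m * U * p) = m * U * p := lt _ _ _ _ hm2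
    have e3 : m * (z * U * z) = 0 := kill hm2 (lt _ _ _ _ hz2) hmz
    have e4 : Q * (p * U * m) = 0 := kill hQz (lt _ _ _ _ hp2) hzp
    have e5 : Q * (m * U * p) = 0 := kill hQz (lt _ _ _ _ hm2) hzm
    have e6 : Q * (z * U * z) = Q * U * z := by rw [← mul_assoc, ← mul_assoc, hQz]
    have e7 : h * U' * p * (p * U * m) = h := by
      calc h * U' * p * (p * U * m) = h * (U' * (p * p) * (U * m)) := by
            simp only [mul_assoc]
        _ = h := by rw [hp2, h1, hhm]
    have e8 : h * U' * p * (m * U * p) = 0 := kill (rt _ _ _ hp2) (lt _ _ _ _ hm2) hpm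
    have e9 : h * U' * p * (z * U * z) = 0 := kill (rt _ _ _ hp2) (lt _ _ _ _ hz2) hpz
    have f1 : h * star Q = 0 := kill hhm hzQs hmz
    have f2 : h * (p * U' * star h) = 0 := kill hhm (lt _ _ _ _ hp2) hmp
    have f3 : m * U * p * m = 0 := kill (rt _ _ _ hp2) hm2 hpm
    have f4 : m * U * p * star Q = 0 := kill (rt _ _ _ hp2) hzQs hpz
    have f5 : m * U * p * (p * U' * star h) = star h := by
      calc m * U * p * (p * U' * star h) = m * U * (p * p) * (U' * m) * star h := by
            rw [mul_assoc _ (U' * m), mul_assoc U' m, hmh]; simp only [mul_assoc]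
        _ = star h := by rw [hp2, h3, hmh]
    have f6 : Q * U * z * m = 0 := kill (rt _ _ _ hz2) hm2 hzm
    have f7 : Q * U * z * star Q = Q * U * star Q := by rw [mul_assoc, hzQs]
    have f8 : Q * U * z * (p * U' * star h) = 0 := kill (rt _ _ _ hz2) (lt _ _ _ _ hp2) hzp
    have hs : star (m + Q + h * U' * p) = m + star Q + p * U' * star h := by
      rw [star_add, star_add, hsm, star_mul, star_mul, hsp, hU', mul_assoc]
    rw [hs]
    simp only [add_mul, mul_add, e1, e2, e3, e4, e5, e6, e7, e8, e9, zero_add, add_zero, f1, f2,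
      f3, f4, f5, f6, f7, f8, hhm]
    abel

end Idempotents

/-! ### Reduction of the unimodular factor to normal form -/

section NormalForm

variable {F : Type} [DivisionRing F]

/-- All entries are polynomials. -/
def IsPolyMatrix {n m : Type} (A : Matrix n m F[T;T⁻¹]) : Prop := ∀ i j, ExpGE (A i j) 0

namespace IsPolyMatrix

variable {n m l : Type} {A B : Matrix n m F[T;T⁻¹]}

lemma add (hA : IsPolyMatrix A) (hB : IsPolyMatrix B) : IsPolyMatrix (A + B) :=
  fun i j => (hA i j).add (hB i j)

lemma sub (hA : IsPolyMatrix A) (hB : IsPolyMatrix B) : IsPolyMatrix (A - B) :=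
  fun i j => (hA i j).sub (hB i j)

lemma mul [Fintype m] {D : Matrix m l F[T;T⁻¹]} (hA : IsPolyMatrix A) (hD : IsPolyMatrix D) :
    IsPolyMatrix (A * D) :=
  fun i j => ExpGE.sum fun t _ => by simpa using (hA i t).mul (hD t j)

lemma diagonal [DecidableEq n] {x : n → F[T;T⁻¹]} (hx : ∀ i, ExpGE (x i) 0) :
    IsPolyMatrix (Matrix.diagonal x) := fun i j => by
  rw [diagonal_apply]
  split_ifs
  · exact hx i
  · exact ExpGE.zero

lemma one [DecidableEq n] : IsPolyMatrix (1 : Matrix n n F[T;T⁻¹]) :=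
  IsPolyMatrix.diagonal fun _ => by simpa using expGE_C (1 : F)

lemma mapMatrix [Fintype n] [DecidableEq n] (Q : Matrix n n F) :
    IsPolyMatrix ((C : F →+* F[T;T⁻¹]).mapMatrix Q) := fun _ _ => expGE_C _

end IsPolyMatrix

/-- The normal form of Hermitian matrices with row degrees `k`. -/
noncomputable def normalForm {d : ℕ} (k s : Fin d → ℤ) : Matrix (Fin d) (Fin d) F[T;T⁻¹] :=
  Matrix.of fun i j => if k i = 0 then (if i = j then C (s i : F) else 0)
    else if j = i.rev then T (k i) else 0

variable [StarRing F] [Algebra ℝ F] [RealStarField F]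

-- Self-adjointness confines the exponents of U i j to [-k j, k i] and those of U' i j to [k i, -k
-- j]. Split the indices by the projections p, z, m onto positive, zero and negative k. Then U
-- vanishes in the blocks mm, mz, zm, and U' in pp, pz, zp. This is the shape needed for block
-- elimination, and it leaves a constant zz block for signed diagonalization.
set_option maxHeartbeats 1000000 in
theorem exists_normalForm {d : ℕ} {k : Fin d → ℤ} (hrev : ∀ i, k i.rev = -k i)
    {U U' : Matrix (Fin d) (Fin d) F[T;T⁻¹]} (hU : star U = U) (hUU' : U * U' = 1)
    (hU'U : U' * U = 1) (hUk : ∀ i j, ExpLE (U i j) (k i)) (hU'k : ∀ i j, ExpLE (U' i j) (-k j)) :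
    ∃ (P P' : Matrix (Fin d) (Fin d) F[T;T⁻¹]) (s : Fin d → ℤ), IsPolyMatrix P ∧ IsPolyMatrix P' ∧
      P * P' = 1 ∧ P' * P = 1 ∧ (∀ i, s i = 1 ∨ s i = -1) ∧
      (∀ i j, k i = 0 → k j = 0 → j < i → s j ≤ s i) ∧ P * U * star P = normalForm k s := by
  have hU' : star U' = U' := by
    have h1 : star U' * U = 1 := by
      have := congrArg star hUU'
      rwa [star_mul, hU, star_one] at this
    calc star U' = star U' * (U * U') := by rw [hUU', mul_one]
      _ = U' := by rw [← mul_assoc, h1, one_mul]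
  have hUk' : ∀ i j, ExpGE (U i j) (-k j) := fun i j => by
    have : U i j = star (U j i) := congrFun (congrFun hU.symm i) j
    rw [this]; exact (hUk j i).star
  have hU'k' : ∀ i j, ExpGE (U' i j) (k i) := fun i j => by
    have : U' i j = star (U' j i) := congrFun (congrFun hU'.symm i) j
    rw [this]; simpa using (hU'k j i).star
  have hU0 : ∀ i j, k i + k j < 0 → U i j = 0 := fun i j h =>
    (hUk' i j).eq_zero (hUk i j) (by omega)
  have hU'0 : ∀ i j, 0 < k i + k j → U' i j = 0 := fun i j h =>
    (hU'k' i j).eq_zero (hU'k i j) (by omega)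
  let p : Matrix (Fin d) (Fin d) F[T;T⁻¹] := diagonal fun i => if 0 < k i then 1 else 0
  let z : Matrix (Fin d) (Fin d) F[T;T⁻¹] := diagonal fun i => if k i = 0 then 1 else 0
  let m : Matrix (Fin d) (Fin d) F[T;T⁻¹] := diagonal fun i => if k i < 0 then 1 else 0
  have diag01 : ∀ (q : Fin d → Prop) [DecidablePred q],
      star (diagonal fun i => if q i then (1 : F[T;T⁻¹]) else 0) =
        diagonal fun i => if q i then (1 : F[T;T⁻¹]) else 0 := fun q _ => by
    rw [star_eq_conjTranspose, diagonal_conjTranspose]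
    congr 1
    ext1 i
    simp only [Pi.star_apply]
    split_ifs <;> simp
  have hsp : star p = p := diag01 _
  have hsz : star z = z := diag01 _
  have hsm : star m = m := diag01 _
  have hone : p + z + m = 1 := by
    simp only [p, z, m, diagonal_add, ← diagonal_one]
    congr 1
    ext1 i
    rcases lt_trichotomy (k i) 0 with h | h | h
    · simp [h, h.ne, h.le]
    · simp [h]
    · simp [h, h.ne', h.le]
  have diagmul : ∀ (q q' : Fin d → Prop) [DecidablePred q] [DecidablePred q'],
      (∀ i, q i → q' i → False) →
      (diagonal fun i => if q i then (1 : F[T;T⁻¹]) else 0) *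
        (diagonal fun i => if q' i then (1 : F[T;T⁻¹]) else 0) = 0 := fun q q' _ _ h => by
    rw [diagonal_mul_diagonal, ← diagonal_zero]
    congr 1
    ext1 i
    by_cases h1 : q i
    · by_cases h2 : q' i
      · exact (h i h1 h2).elim
      · simp [h2]
    · simp [h1]
  have diagself : ∀ (q : Fin d → Prop) [DecidablePred q],
      (diagonal fun i => if q i then (1 : F[T;T⁻¹]) else 0) *
        (diagonal fun i => if q i then (1 : F[T;T⁻¹]) else 0) =
      (diagonal fun i => if q i then (1 : F[T;T⁻¹]) else 0) := fun q _ => by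
    rw [diagonal_mul_diagonal]
    congr 1
    ext1 i
    split_ifs <;> simp
  have hp2 : p * p = p := diagself _
  have hz2 : z * z = z := diagself _
  have hm2 : m * m = m := diagself _
  have hpz : p * z = 0 := diagmul _ _ fun i h h' => by omega
  have hzp : z * p = 0 := diagmul _ _ fun i h h' => by omega
  have hpm : p * m = 0 := diagmul _ _ fun i h h' => by omega
  have hmp : m * p = 0 := diagmul _ _ fun i h h' => by omega
  have hzm : z * m = 0 := diagmul _ _ fun i h h' => by omega
  have hmz : m * z = 0 := diagmul _ _ fun i h h' => by omega
  have compress : ∀ (q q' : Fin d → Prop) [DecidablePred q] [DecidablePred q']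
      (X : Matrix (Fin d) (Fin d) F[T;T⁻¹]), (∀ i j, q i → q' j → X i j = 0) →
      (diagonal fun i => if q i then (1 : F[T;T⁻¹]) else 0) * X *
        (diagonal fun i => if q' i then (1 : F[T;T⁻¹]) else 0) = 0 := fun q q' _ _ X h => by
    ext1 i j
    rw [mul_diagonal, diagonal_mul]
    by_cases h1 : q i
    · by_cases h2 : q' j
      · simp [h i j h1 h2]
      · simp [h2]
    · simp [h1]
  have hUmm : m * U * m = 0 := compress _ _ _ fun i j h h' => hU0 i j (by omega)
  have hUmz : m * U * z = 0 := compress _ _ _ fun i j h h' => hU0 i j (by omega)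
  have hUzm : z * U * m = 0 := compress _ _ _ fun i j h h' => hU0 i j (by omega)
  have hUpp' : p * U' * p = 0 := compress _ _ _ fun i j h h' => hU'0 i j (by omega)
  have hUpz' : p * U' * z = 0 := compress _ _ _ fun i j h h' => hU'0 i j (by omega)
  have hUzp' : z * U' * p = 0 := compress _ _ _ fun i j h h' => hU'0 i j (by omega)
  have poly01 : ∀ (q : Fin d → Prop) [DecidablePred q],
      IsPolyMatrix (diagonal fun i => if q i then (1 : F[T;T⁻¹]) else 0) := fun q _ =>
    IsPolyMatrix.diagonal fun i => by
      split_ifs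
      · simpa using expGE_C (1 : F)
      · exact ExpGE.zero
  -- elimination
  let c : ℝ[T;T⁻¹] := C (1 / 2)
  have hc : c + c = 1 := by
    simp only [c]
    rw [← map_add]; norm_num
  have hsc : star c = c := by simp [c]
  obtain ⟨hXX, hX⟩ := exists_block_elimination hsp hsz hone hc hsc hU hU' hUU' hU'U hUmm hUmz hUzm
    hUpp' hUpz'
  set X := (c • p + z) * U * p * U' with hXdef
  -- In each term of UpU' the lower exponent bounds -k l and k l cancel.
  have hXpoly : IsPolyMatrix X := by
    have h1 : IsPolyMatrix (U * p * U') := fun i j => ExpGE.sum fun l _ => by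
      change ExpGE ((U * p) i l * U' l j) 0
      rw [mul_diagonal]
      have h2 := (hUk' i l).mul (hU'k' l j)
      rw [neg_add_cancel] at h2
      split_ifs
      · simpa using h2
      · simpa using ExpGE.zero
    have h2 : IsPolyMatrix (c • p + z) := by
      refine IsPolyMatrix.add (fun i j => ?_) (poly01 _)
      exact (expGE_C (1 / 2 : ℝ)).real_smul (poly01 (fun i => 0 < k i) i j)
    have h3 : X = (c • p + z) * (U * p * U') := by rw [hXdef]; simp only [mul_assoc]
    rw [h3]
    exact h2.mul h1
  -- the antidiagonal blocks
  let h : Matrix (Fin d) (Fin d) F[T;T⁻¹] := Matrix.of fun i j =>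
    if j = i.rev then (if 0 < k i then T (k i) else 0) else 0
  have hentry : ∀ (A : Matrix (Fin d) (Fin d) F[T;T⁻¹]) i j,
      (h * A) i j = (if 0 < k i then T (k i) else 0) * A i.rev j := fun A i j => by
    simp only [h, Matrix.mul_apply, Matrix.of_apply]
    rw [Finset.sum_eq_single i.rev (fun l _ hl => by rw [if_neg hl, zero_mul]) (by simp),
      if_pos rfl]
  have hsh : ∀ i j, (star h) i j = if j = i.rev then (if k i < 0 then T (k i) else 0) else 0 := by
    intro i j
    have h1 : (star h) i j = star (h j i) := rfl
    rw [h1]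
    simp only [h, Matrix.of_apply]
    by_cases hij : j = i.rev
    · subst hij
      rw [if_pos (Fin.rev_rev i).symm, if_pos rfl, hrev]
      by_cases h2 : k i < 0
      · rw [if_pos h2, if_pos (by omega), star_T, neg_neg]
      · rw [if_neg h2, if_neg (by omega), star_zero]
    · rw [if_neg hij, if_neg, star_zero]
      rintro rfl
      exact hij (Fin.rev_rev j).symm
  have hentry' : ∀ (A : Matrix (Fin d) (Fin d) F[T;T⁻¹]) i j,
      (star h * A) i j = (if k i < 0 then T (k i) else 0) * A i.rev j := fun A i j => by
    rw [Matrix.mul_apply]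
    rw [Finset.sum_eq_single i.rev (fun l _ hl => by rw [hsh, if_neg hl, zero_mul]) (by simp),
      hsh, if_pos rfl]
  have hhm : h * m = h := by
    ext1 i j
    rw [mul_diagonal]
    simp only [h, Matrix.of_apply]
    by_cases hij : j = i.rev
    · subst hij
      rw [if_pos rfl, hrev]
      by_cases h2 : 0 < k i
      · rw [if_pos h2, if_pos (by omega), mul_one]
      · rw [if_neg h2, zero_mul]
    · rw [if_neg hij, zero_mul]
  have hph : p * h = h := by
    ext1 i j
    rw [diagonal_mul]
    simp only [h, Matrix.of_apply]
    by_cases h2 : 0 < k i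
    · rw [if_pos h2, one_mul]
    · simp [h2]
  have hhh : h * star h = p := by
    ext1 i j
    rw [hentry, hsh, hrev, Fin.rev_rev]
    simp only [p, diagonal_apply]
    by_cases hij : i = j
    · subst hij
      by_cases h2 : 0 < k i
      · rw [if_pos h2, if_pos rfl, if_pos (by omega), if_pos rfl, if_pos h2, ← T_add,
          add_neg_cancel, T_zero]
      · simp [h2]
    · simp [hij, Ne.symm hij]
  have hhh' : star h * h = m := by
    ext1 i j
    rw [hentry']
    simp only [h, m, diagonal_apply, Matrix.of_apply, hrev, Fin.rev_rev]
    by_cases hij : i = j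
    · subst hij
      by_cases h2 : k i < 0
      · rw [if_pos h2, if_pos rfl, if_pos (by omega), if_pos rfl, if_pos h2, ← T_add,
          add_neg_cancel, T_zero]
      · simp [h2]
    · simp [hij, Ne.symm hij]
  -- the constant block
  let ι := {i : Fin d // k i = 0}
  let V : Matrix (Fin d) ι F[T;T⁻¹] := Matrix.of fun i a => if i = a.1 then 1 else 0
  have hVA : ∀ {t : Type} (A : Matrix ι t F[T;T⁻¹]) i j,
      (V * A) i j = if hi : k i = 0 then A ⟨i, hi⟩ j else 0 := fun A i j => by
    simp only [V, Matrix.mul_apply, Matrix.of_apply, ite_mul, one_mul, zero_mul]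
    split_ifs with hi
    · rw [Finset.sum_eq_single ⟨i, hi⟩ (fun b _ hb => if_neg fun h => hb (Subtype.ext h.symm))
        (by simp), if_pos rfl]
    · refine Finset.sum_eq_zero fun b _ => if_neg ?_
      rintro rfl
      exact hi b.2
  have hVtA : ∀ {t : Type} (A : Matrix (Fin d) t F[T;T⁻¹]) (a : ι) j,
      (Vᵀ * A) a j = A a.1 j := fun A a j => by
    simp [V, Matrix.mul_apply]
  have hVtV : Vᵀ * V = 1 := by
    ext1 a b
    rw [hVtA, Matrix.one_apply]
    by_cases hab : a = b
    · simp [V, hab]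
    · have : a.1 ≠ b.1 := fun h => hab (Subtype.ext h)
      simp [V, hab, this]
  have hVVt : V * Vᵀ = z := by
    ext1 i j
    rw [hVA]
    simp only [z, V, Matrix.transpose_apply, Matrix.of_apply, diagonal_apply]
    by_cases hi : k i = 0
    · by_cases hij : i = j
      · subst hij; simp [hi]
      · simp [hij, Ne.symm hij]
    · simp [hi]
  have hzV : z * V = V := by rw [← hVVt, Matrix.mul_assoc, hVtV, Matrix.mul_one]
  have hVtz : Vᵀ * z = Vᵀ := by rw [← hVVt, ← Matrix.mul_assoc, hVtV, Matrix.one_mul]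
  have hVs : Vᴴ = Vᵀ := by
    ext1 a i
    simp only [V, conjTranspose_apply, transpose_apply, of_apply]
    split_ifs <;> simp
  let φ := (C : F →+* F[T;T⁻¹]).mapMatrix (m := ι)
  have hφ : Function.Injective φ := fun A B hAB => by
    ext i j
    have := congrArg (fun x => AddMonoidAlgebra.coeff x 0) (congrFun (congrFun hAB i) j)
    simpa [φ] using this
  let c0 : Matrix ι ι F := Matrix.of fun a b => (U a.1 b.1).coeff 0
  let c0' : Matrix ι ι F := Matrix.of fun a b => (U' a.1 b.1).coeff 0
  have hVAV : ∀ (A : Matrix (Fin d) (Fin d) F[T;T⁻¹]) (a b : ι), (Vᵀ * A * V) a b = A a b := by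
    intro A a b
    rw [Matrix.mul_assoc, hVtA]
    simp [V, Matrix.mul_apply]
  -- On the zero block the exponents are bounded by 0 from both sides, so the entries are constants.
  have hc0 : φ c0 = Vᵀ * U * V := by
    ext1 a b
    rw [hVAV]
    have h1 := hUk a.1 b.1
    have h2 := hUk' a.1 b.1
    rw [a.2] at h1
    rw [b.2, neg_zero] at h2
    exact (h2.eq_C h1).symm
  have hc0' : φ c0' = Vᵀ * U' * V := by
    ext1 a b
    rw [hVAV]
    have h1 := hU'k a.1 b.1
    have h2 := hU'k' a.1 b.1
    rw [b.2, neg_zero] at h1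
    rw [a.2] at h2
    exact (h2.eq_C h1).symm
  -- Insert 1 = p + z + m between U and U': the m term dies from zUm = 0, the p term from pU'z = 0.
  -- Hence the zz blocks are mutually inverse.
  have hzUUz : z * U * z * U' * z = z := by
    have h1 : z * U * (p + z + m) * U' * z = z := by
      rw [hone, mul_one, mul_assoc z, hUU', mul_one, hz2]
    have h2 : z * U * p * U' * z = 0 := by
      calc z * U * p * U' * z = z * U * (p * U' * z) := by simp only [mul_assoc]
        _ = 0 := by rw [hUpz', mul_zero]
    simpa only [mul_add, add_mul, hUzm, h2, zero_mul, zero_add, add_zero] using h1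
  have hcc : c0 * c0' = 1 := by
    apply hφ
    rw [map_mul, map_one, hc0, hc0']
    calc Vᵀ * U * V * (Vᵀ * U' * V) = Vᵀ * z * U * (V * Vᵀ) * U' * (z * V) := by
          rw [hVtz, hzV]; simp only [Matrix.mul_assoc]
      _ = Vᵀ * (z * U * z * U' * z) * V := by rw [hVVt]; simp only [Matrix.mul_assoc]
      _ = 1 := by rw [hzUUz, hVtz, hVtV]
  have hc0s : c0ᴴ = c0 := by
    ext a b
    have h1 : U a.1 b.1 = star (U b.1 a.1) := congrFun (congrFun hU.symm a.1) b.1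
    simp only [c0, conjTranspose_apply, of_apply]
    rw [h1, coeff_star, neg_zero]
  obtain ⟨Q0, Q0', ε, hQ, hQ', hε, hεm, hQc⟩ := exists_signed_diagonalization hc0s hcc
  let Q := V * φ Q0 * Vᵀ
  let Q' := V * φ Q0' * Vᵀ
  have hsand : ∀ A B : Matrix ι ι F, V * φ A * Vᵀ * (V * φ B * Vᵀ) = V * φ (A * B) * Vᵀ := by
    intro A B
    calc V * φ A * Vᵀ * (V * φ B * Vᵀ) = V * φ A * (Vᵀ * V) * φ B * Vᵀ := by
          simp only [Matrix.mul_assoc]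
      _ = V * φ (A * B) * Vᵀ := by rw [hVtV, Matrix.mul_one, map_mul]; simp only [Matrix.mul_assoc]
  have hzs : ∀ A : Matrix ι ι F, z * (V * φ A * Vᵀ) = V * φ A * Vᵀ := fun A => by
    rw [← Matrix.mul_assoc, ← Matrix.mul_assoc, hzV]
  have hsz' : ∀ A : Matrix ι ι F, V * φ A * Vᵀ * z = V * φ A * Vᵀ := fun A => by
    rw [Matrix.mul_assoc, hVtz]
  have hQQ' : Q * Q' = z := by rw [hsand, hQ, map_one, Matrix.mul_one, hVVt]
  have hQ'Q : Q' * Q = z := by rw [hsand, hQ', map_one, Matrix.mul_one, hVVt]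
  have hVpoly : IsPolyMatrix V := fun i a => by
    simp only [V, of_apply]
    split_ifs
    · simpa using expGE_C (1 : F)
    · exact ExpGE.zero
  have hVtpoly : IsPolyMatrix Vᵀ := fun a i => hVpoly i a
  obtain ⟨hR1, hR2, hR3⟩ := exists_block_normalization hsp hsz hsm hone hp2 hm2 hpz hzp hpm hmp hzm
    hmz hU' hUU' hU'U hUmm hUmz hUzm hUpp' hUzp' hhm hph hhh hhh' (hzs Q0) (hsz' Q0) (hzs Q0')
    (hsz' Q0') hQQ' hQ'Q
  have hQUQ : Q * U * star Q = V * φ (diagonal fun i => (ε i : F)) * Vᵀ := by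
    have h1 : star Q = V * φ (Q0ᴴ) * Vᵀ := by
      have h2 : (φ Q0)ᴴ = φ (Q0ᴴ) := by
        ext1 a b
        simp [φ]
      rw [star_eq_conjTranspose, conjTranspose_mul, conjTranspose_mul, ← hVs,
        conjTranspose_conjTranspose, h2, Matrix.mul_assoc]
    rw [h1, ← hQc, map_mul, map_mul, hc0]
    simp only [Q, Matrix.mul_assoc]
  -- The default 1 only keeps all values in {1, -1}; the normal form ignores it.
  let s : Fin d → ℤ := fun i => if hi : k i = 0 then ε ⟨i, hi⟩ else 1
  refine ⟨(m + Q + h * U' * p) * (1 - X), (1 + X) * (m + Q' + p * U * star h), s, ?_, ?_, ?_, ?_,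
    ?_, ?_, ?_⟩
  · refine IsPolyMatrix.mul (((poly01 _).add ((hVpoly.mul (IsPolyMatrix.mapMatrix _)).mul
      hVtpoly)).add (IsPolyMatrix.mul (fun i j => ?_) (poly01 _))) (IsPolyMatrix.one.sub hXpoly)
    -- Row i of hU' is T^(k i) times row `i.rev` of U', whose exponents are at least k i.rev = -k i.
    rw [hentry]
    split_ifs
    · have := (expGE_T (R := F) (k i)).mul (hU'k' i.rev j)
      rwa [hrev, add_neg_cancel] at this
    · simpa using ExpGE.zero
  · refine IsPolyMatrix.mul (IsPolyMatrix.one.add hXpoly) (((poly01 _).add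
      ((hVpoly.mul (IsPolyMatrix.mapMatrix _)).mul hVtpoly)).add ?_)
    rw [mul_assoc]
    refine IsPolyMatrix.mul (poly01 _) fun i j => ExpGE.sum fun l _ => ?_
    change ExpGE (U i l * (star h) l j) 0
    rw [hsh]
    split_ifs with h1 h2
    · have := (hUk' i l).mul (expGE_T (R := F) (k l))
      rwa [neg_add_cancel] at this
    · simpa using ExpGE.zero
    · simpa using ExpGE.zero
  -- X squares to zero.
  · have h1 : (1 - X) * (1 + X) = 1 := by
      rw [sub_mul, one_mul, mul_add, mul_one, hXX]; abel
    calc _ = (m + Q + h * U' * p) * ((1 - X) * (1 + X)) * (m + Q' + p * U * star h) := by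
          simp only [mul_assoc]
      _ = 1 := by rw [h1, mul_one, hR1]
  · have h1 : (1 + X) * (1 - X) = 1 := by
      rw [add_mul, one_mul, mul_sub, mul_one, hXX]; abel
    calc _ = (1 + X) * ((m + Q' + p * U * star h) * (m + Q + h * U' * p)) * (1 - X) := by
          simp only [mul_assoc]
      _ = 1 := by rw [hR2, mul_one, h1]
  · intro i
    simp only [s]
    split_ifs
    · exact hε _
    · exact Or.inl rfl
  · intro i j hi hj hij
    simp only [s, dif_pos hi, dif_pos hj]
    exact hεm (le_of_lt hij)
  · rw [star_mul]
    calc _ = (m + Q + h * U' * p) * ((1 - X) * U * star (1 - X)) * star (m + Q + h * U' * p) := by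
          simp only [mul_assoc]
      _ = h + star h + V * φ (diagonal fun i => (ε i : F)) * Vᵀ := by rw [hX, hR3, hQUQ]
      _ = normalForm k s := by
        ext1 i j
        rw [Matrix.add_apply, Matrix.add_apply, hsh, Matrix.mul_assoc, hVA]
        simp only [normalForm, of_apply, h]
        by_cases hi : k i = 0
        · have hlt : ¬ 0 < k i := by omega
          have hlt' : ¬ k i < 0 := by omega
          rw [if_neg hlt, if_neg hlt', ite_self, dif_pos hi, if_pos hi, zero_add, zero_add]
          simp only [s, dif_pos hi]
          have h1 : φ (diagonal fun i => (ε i : F)) = diagonal fun i => C (ε i : F) := by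
            ext1 a b
            simp only [φ, RingHom.mapMatrix_apply, map_apply, diagonal_apply]
            split_ifs <;> simp
          rw [h1, diagonal_mul]
          simp only [V, transpose_apply, of_apply]
          by_cases hij : i = j
          · rw [if_pos hij, if_pos hij.symm, mul_one]
          · rw [if_neg hij, if_neg (Ne.symm hij), mul_zero]
        · rw [dif_neg hi, if_neg hi, add_zero]
          by_cases hij : j = i.rev
          · rw [if_pos hij, if_pos hij, if_pos hij]
            rcases lt_or_gt_of_ne hi with h1 | h1
            · rw [if_neg (by omega), if_pos h1, zero_add]
            · rw [if_pos h1, if_neg (by omega), add_zero]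
          · rw [if_neg hij, if_neg hij, if_neg hij, add_zero]

end NormalForm

end HermitianWH

namespace HermitianWH

open Matrix LaurentPolynomial

/-! ### The factorization over the division algebra -/

section Factorization

variable {F : Type} [DivisionRing F]

/-- The value at `1`. -/
noncomputable def evalOne : F[T;T⁻¹] →+* F :=
  AddMonoidAlgebra.liftNCRingHom (RingHom.id F) 1 fun _ _ => Commute.one_right _

variable [StarRing F] [Algebra ℝ F] [RealStarField F]

/-- Sorting the degrees of the unimodular factor, and permuting its rows and columns accordingly,
permits `exists_normalForm`; the normalizing matrix P and its inverse P' are absorbed as EP' and PY,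
so the product stays q. -/
theorem exists_hermitian_factorization {d : ℕ} {A B : Matrix (Fin d) (Fin d) F[T;T⁻¹]}
    (hA : star A = A) {q r : ℝ[T;T⁻¹]} (hq0 : ExpGE q 0) (hr0 : ExpGE r 0) (hq00 : q.coeff 0 ≠ 0)
    (hr : r ≠ 0) (hAB : A * B = (q * r) • 1) (hqc : IsCoprime q (star q))
    (hrc : IsCoprime r (star r)) :
    ∃ κ : Fin d → ℤ, Antitone κ ∧ (∀ i, κ i.rev = -κ i) ∧
      ∃ (s : Fin d → ℤ) (E Y : Matrix (Fin d) (Fin d) F[T;T⁻¹]),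
        (∀ i, s i = 1 ∨ s i = -1) ∧ (∀ i j, κ i = 0 → κ j = 0 → j < i → s j ≤ s i) ∧
        IsPolyMatrix E ∧ IsPolyMatrix Y ∧ E * Y = q • 1 ∧ Y * E = q • 1 ∧
        A = E * normalForm (fun i => -κ i) s * star E := by
  obtain ⟨k₀, E₀, Y₀, U₀, U₀', hE₀, hY₀, hEY₀, hYE₀, hU₀, hAE₀, hUU₀, hUU₀', hUk₀, hUk₀'⟩ :=
    exists_unimodular_factor hA hq0 hr0 hq00 hr hAB hqc hrc
  let σ := Tuple.sort k₀
  let k := k₀ ∘ σ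
  have hk : Monotone k := Tuple.monotone_sort k₀
  let U := U₀.submatrix σ σ
  let U' := U₀'.submatrix σ σ
  let E := E₀.submatrix id σ
  let Y := Y₀.submatrix σ id
  have hU : star U = U := by
    change (U₀.submatrix σ σ)ᴴ = _
    rw [conjTranspose_submatrix, ← star_eq_conjTranspose, hU₀]
  have hUU' : U * U' = 1 := by
    rw [submatrix_mul_equiv, hUU₀, submatrix_one_equiv]
  have hU'U : U' * U = 1 := by
    rw [submatrix_mul_equiv, hUU₀', submatrix_one_equiv]
  have hEY : E * Y = q • 1 := by
    rw [submatrix_mul_equiv, hEY₀, submatrix_id_id]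
  have hYE : Y * E = q • 1 := by
    change Y₀.submatrix σ id * E₀.submatrix id σ = _
    rw [← submatrix_mul Y₀ E₀ σ id σ Function.bijective_id, hYE₀]
    change q • ((1 : Matrix (Fin d) (Fin d) F[T;T⁻¹]).submatrix σ σ) = _
    rw [submatrix_one_equiv]
  have hAE : A = E * U * star E := by
    change _ = E₀.submatrix id σ * U₀.submatrix σ σ * (E₀.submatrix id σ)ᴴ
    rw [submatrix_mul_equiv, conjTranspose_submatrix, submatrix_mul_equiv, submatrix_id_id, hAE₀,
      star_eq_conjTranspose]
  have hUk : ∀ i j, ExpLE (U i j) (k i) := fun i j => hUk₀ _ _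
  have hUk' : ∀ i j, ExpLE (U' i j) (-k j) := fun i j => hUk₀' _ _
  have hU's : star U' = U' := by
    have h1 : star U' * U = 1 := by
      have := congrArg star hUU'
      rwa [star_mul, hU, star_one] at this
    calc star U' = star U' * (U * U') := by rw [hUU', mul_one]
      _ = U' := by rw [← mul_assoc, h1, one_mul]
  have hU0 : ∀ i j, k i < -k j → U i j = 0 := fun i j h => by
    have h1 : U i j = star (U j i) := congrFun (congrFun hU.symm i) j
    refine ExpGE.eq_zero (k := -k j) ?_ (hUk i j) h
    rw [h1]; exact (hUk j i).star
  have hU'0 : ∀ i j, -k i < k j → U' i j = 0 := fun i j h => by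
    have h1 : U' i j = star (U' j i) := congrFun (congrFun hU's.symm i) j
    refine ExpGE.eq_zero (k := k i) ?_ (hUk' i j) (by omega)
    rw [h1]; simpa using (hUk' j i).star
  -- U and U' are inverse and vanish where k i < -k j, respectively -k i < k j. Evaluated at 1, they
  -- give opposite inequalities between the counts for k and for -k.
  have hrev' : (fun i => -k i) = fun i => k i.rev := by
    refine antitone_eq_of_card_lt_eq (fun i j h => neg_le_neg (hk h))
      (fun i j h => hk (Fin.rev_le_rev.mpr h)) fun a => ?_
    have h1 : (evalOne : F[T;T⁻¹] →+* F).mapMatrix U * evalOne.mapMatrix U' = 1 := by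
      rw [← map_mul, hUU', map_one]
    have h2 : (evalOne : F[T;T⁻¹] →+* F).mapMatrix U' * evalOne.mapMatrix U = 1 := by
      rw [← map_mul, hU'U, map_one]
    have h3 : Fintype.card {i : Fin d // k i.rev < a} = Fintype.card {i : Fin d // k i < a} :=
      Fintype.card_congr (Fin.revPerm.subtypeEquiv fun i => by simp)
    rw [h3]
    refine le_antisymm ?_ ?_
    · exact card_lt_le_of_invertible h2 (k := fun i => -k i) (k' := k)
        (fun i j h => by simp [hU'0 i j h]) a
    · exact card_lt_le_of_invertible h1 (k := k) (k' := fun i => -k i)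
        (fun i j h => by simp [hU0 i j h]) a
  have hrev : ∀ i, k i.rev = -k i := fun i => (congrFun hrev' i).symm
  obtain ⟨P, P', s, hP, hP', hPP', hP'P, hs, hsm, hNF⟩ :=
    exists_normalForm hrev hU hUU' hU'U hUk hUk'
  refine ⟨fun i => -k i, fun i j h => neg_le_neg (hk h), fun i => congrArg Neg.neg (hrev i), s, E * P', P * Y,
    hs, fun i j hi hj => hsm i j (neg_eq_zero.mp hi) (neg_eq_zero.mp hj), ?_, ?_, ?_, ?_, ?_⟩
  · exact IsPolyMatrix.mul (fun i j => hE₀ _ _) hP'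
  · exact IsPolyMatrix.mul hP (fun i j => hY₀ _ _)
  · calc E * P' * (P * Y) = E * (P' * P) * Y := by simp only [mul_assoc]
      _ = q • 1 := by rw [hP'P, mul_one, hEY]
  · calc P * Y * (E * P') = P * (Y * E) * P' := by simp only [mul_assoc]
      _ = q • 1 := by rw [hYE, mul_smul_comm, mul_one, smul_mul_assoc, hPP']
  · simp only [neg_neg]
    rw [← hNF, hAE, star_mul]
    have h1 : star P * star P' = 1 := by rw [← star_mul, hP'P, star_one]
    calc E * U * star E = E * (P' * P) * U * (star P * star P') * star E := by
          rw [hP'P, h1, mul_one, mul_one]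
      _ = _ := by simp only [mul_assoc]

end Factorization

/-! ### Matrix coefficients versus Laurent polynomial entries -/

section ToMatrix

variable {R n : Type} [Ring R] [Fintype n] [DecidableEq n]

/-- A matrix Laurent polynomial as a matrix of Laurent polynomials. -/
noncomputable def toMatrix : MatLaurent R n ≃+* Matrix n n R[T;T⁻¹] where
  toFun A := Matrix.of fun i j => mapCoeff (Matrix.entryAddMonoidHom R i j) A
  invFun M := ∑ i, ∑ j, mapCoeff (Matrix.singleAddMonoidHom i j) (M i j)
  left_inv A := by
    ext r
    simp only [of_apply, AddMonoidAlgebra.coeff_sum, Finsupp.finsetSum_apply, coeff_mapCoeff]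
    conv_rhs => rw [matrix_eq_sum_single (A.coeff r)]
    rfl
  right_inv M := by
    ext i j r
    simp only [of_apply, coeff_mapCoeff, AddMonoidAlgebra.coeff_sum, Finsupp.finsetSum_apply]
    conv_rhs => rw [← of_apply (fun i j => (M i j).coeff r) i j,
      matrix_eq_sum_single (Matrix.of fun i j => (M i j).coeff r)]
    rfl
  map_add' A B := by ext i j; simp
  map_mul' A B := by
    ext1 i j
    simp only [of_apply, Matrix.mul_apply]
    induction A using LaurentPolynomial.induction_on' with
    | add p q hp hq => simp only [add_mul, map_add, hp, hq, Finset.sum_add_distrib]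
    | C_mul_T r a =>
      induction B using LaurentPolynomial.induction_on' with
      | add p q hp hq => simp only [mul_add, map_add, hp, hq, Finset.sum_add_distrib]
      | C_mul_T t b =>
        simp only [monomial_mul_monomial, mapCoeff_monomial]
        simp only [Matrix.entryAddMonoidHom_apply, Matrix.mul_apply, map_sum, Finset.sum_mul]

@[simp] lemma coeff_toMatrix (A : MatLaurent R n) (i j : n) (r : ℤ) :
    (toMatrix A i j).coeff r = A.coeff r i j := by
  simp [toMatrix]

lemma toMatrix_monomial (a : Matrix n n R) (r : ℤ) (i j : n) :
    toMatrix (C a * T r : MatLaurent R n) i j = C (a i j) * T r := by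
  simp only [toMatrix, RingEquiv.coe_mk, Equiv.coe_fn_mk, of_apply, mapCoeff_monomial]
  rfl

lemma toMatrix_mono (a : Matrix n n R) (r : ℤ) (i j : n) :
    toMatrix (mono r a) i j = C (a i j) * T r := toMatrix_monomial a r i j

lemma isPolyMatrix_iff {F : Type} [DivisionRing F] {A : MatLaurent F n} :
    IsPolyMatrix (toMatrix A) ↔ ExpGE A 0 := by
  constructor
  · intro h r hr
    ext i j
    rw [← coeff_toMatrix, h i j r hr]; rfl
  · intro h i j r hr
    rw [coeff_toMatrix, h r hr]; rfl

lemma toMatrix_star [StarRing R] (A : MatLaurent R n) : toMatrix (star A) = star (toMatrix A) := by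
  ext i j r
  change (toMatrix (star A) i j).coeff r = (star (toMatrix A j i)).coeff r
  rw [coeff_toMatrix, coeff_star, coeff_star, coeff_toMatrix]
  rfl

lemma dagger_eq_star [StarRing R] (A : MatLaurent R n) : dagger A = star A := rfl

/-- The constant factor of the middle factor. -/
def middleConst {d : ℕ} (κ s : Fin d → ℤ) : Matrix (Fin d) (Fin d) ℤ :=
  Matrix.of fun i j => if κ i = 0 then (if i = j then s i else 0) else if j = i.rev then 1 else 0

lemma toMatrix_diagonalFactor (κ : n → ℤ) :
    toMatrix (diagonalFactor κ : MatLaurent R n) = diagonal fun i => T (κ i) := by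
  ext1 i j
  rw [diagonalFactor, map_sum, Matrix.sum_apply]
  simp only [toMatrix_mono, single_apply]
  rw [Finset.sum_eq_single i]
  · by_cases h : i = j
    · subst h; simp
    · simp [h]
  · intro b _ hb
    simp [hb]
  · simp

lemma toMatrix_middleFactor {F : Type} [DivisionRing F] {d : ℕ} {κ s : Fin d → ℤ}
    (hrev : ∀ i, κ i.rev = -κ i) :
    toMatrix (middleFactor κ s : MatLaurent F (Fin d)) = normalForm (fun i => -κ i) s := by
  ext1 i j
  simp only [middleFactor, map_add, map_sum, Matrix.add_apply, Matrix.sum_apply, toMatrix_mono,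
    single_apply, normalForm, of_apply, neg_eq_zero]
  have h1 : ∑ m with 0 < κ m, (C (if m.rev = i ∧ m = j then (1 : F) else 0) * T (κ m)
      + C (if m = i ∧ m.rev = j then (1 : F) else 0) * T (-κ m)) =
      if κ i ≠ 0 ∧ j = i.rev then T (-κ i) else 0 := by
    rw [Finset.sum_add_distrib, Finset.sum_filter, Finset.sum_filter,
      Finset.sum_eq_single i.rev (fun b _ hb => ?_) (by simp),
      Finset.sum_eq_single i (fun b _ hb => ?_) (by simp), hrev]
    · rcases lt_trichotomy (κ i) 0 with h | h | h
      · by_cases hij : i.rev = j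
        · subst hij; simp [h, h.ne, not_lt.mpr h.le]
        · simp [h, not_lt.mpr h.le, hij, Ne.symm hij]
      · simp [h]
      · by_cases hij : i.rev = j
        · subst hij; simp [h, h.ne', not_lt.mpr h.le]
        · simp [h, not_lt.mpr h.le, hij, Ne.symm hij]
    · simp [hb]
    · have : b.rev ≠ i := fun h => hb (by rw [← h, Fin.rev_rev])
      simp [this]
  have h2 : ∑ m with κ m = 0, C (if m = i ∧ m = j then ((s m : ℤ) : F) else 0) * T 0 =
      if κ i = 0 ∧ i = j then C ((s i : ℤ) : F) else 0 := by
    rw [Finset.sum_filter, Finset.sum_eq_single i (fun b _ hb => by simp [hb]) (by simp)]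
    by_cases h : κ i = 0
    · by_cases hij : i = j <;> simp [h, hij]
    · simp [h]
  rw [h1, h2]
  by_cases h : κ i = 0
  · simp [h]
  · simp [h]

/-- Splitting off the constant matrix on the left exposes the diagonal factor of a Wiener–Hopf
factorization. -/
lemma middleFactor_eq {F : Type} [DivisionRing F] {d : ℕ} {κ s : Fin d → ℤ}
    (hrev : ∀ i, κ i.rev = -κ i) :
    (middleFactor κ s : MatLaurent F (Fin d)) =
      mono 0 ((middleConst κ s).map (Int.cast : ℤ → F)) * diagonalFactor κ := by
  apply toMatrix.injective
  rw [toMatrix_middleFactor hrev, map_mul, toMatrix_diagonalFactor]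
  ext1 i j
  rw [mul_diagonal, toMatrix_mono]
  simp only [normalForm, middleConst, of_apply, map_apply, neg_eq_zero, T_zero, mul_one]
  by_cases h : κ i = 0
  · by_cases hij : i = j
    · subst hij; simp [h]
    · simp [h, hij]
  · by_cases hij : j = i.rev
    · subst hij; simp [h, hrev]
    · simp [h, hij]

end ToMatrix

end HermitianWH

namespace HermitianWH

open Matrix LaurentPolynomial

/-! ### Evaluation as a ring homomorphism -/

section Evaluation

variable {ι : Type} [Fintype ι] [DecidableEq ι]

lemma evalAt_eq {z : ℂ} (u : ℂˣ) (hu : (u : ℂ) = z) (A : MatLaurent ℂ ι) :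
    evalAt A z = (LaurentPolynomial.eval₂ (RingHom.id ℂ) u).mapMatrix (toMatrix A) := by
  let f : MatLaurent ℂ ι →+ Matrix ι ι ℂ :=
    coeffSum fun r => DistribSMul.toAddMonoidHom (Matrix ι ι ℂ) (z ^ r)
  let g : MatLaurent ℂ ι →+ Matrix ι ι ℂ :=
    (LaurentPolynomial.eval₂ (RingHom.id ℂ) u).mapMatrix.toAddMonoidHom.comp
      (toMatrix : MatLaurent ℂ ι ≃+* _).toRingHom.toAddMonoidHom
  have : f = g := by
    refine addHom_ext fun a r => ?_
    rw [coeffSum_monomial]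
    ext i j
    change z ^ r * a i j = LaurentPolynomial.eval₂ (RingHom.id ℂ) u (toMatrix (C a * T r) i j)
    rw [toMatrix_monomial, LaurentPolynomial.eval₂_C_mul_T, RingHom.id_apply,
      Units.val_zpow_eq_zpow_val, hu, mul_comm]
  exact DFunLike.congr_fun this A

lemma evalAt_mul {z : ℂ} (hz : z ≠ 0) (A B : MatLaurent ℂ ι) :
    evalAt (A * B) z = evalAt A z * evalAt B z := by
  have h : ∀ X : MatLaurent ℂ ι, evalAt X z =
      (LaurentPolynomial.eval₂ (RingHom.id ℂ) (Units.mk0 z hz)).mapMatrix (toMatrix X) :=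
    fun X => evalAt_eq (Units.mk0 z hz) (Units.val_mk0 hz) X
  rw [h, h, h, map_mul, map_mul]

lemma evalAt_add {z : ℂ} (hz : z ≠ 0) (A B : MatLaurent ℂ ι) :
    evalAt (A + B) z = evalAt A z + evalAt B z := by
  have h : ∀ X : MatLaurent ℂ ι, evalAt X z =
      (LaurentPolynomial.eval₂ (RingHom.id ℂ) (Units.mk0 z hz)).mapMatrix (toMatrix X) :=
    fun X => evalAt_eq (Units.mk0 z hz) (Units.val_mk0 hz) X
  rw [h, h, h, map_add, map_add]

lemma evalAt_monomial (a : Matrix ι ι ℂ) (r : ℤ) (z : ℂ) :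
    evalAt (C a * T r : MatLaurent ℂ ι) z = z ^ r • a := by
  rw [← single_eq_C_mul_T, evalAt, AddMonoidAlgebra.coeff_single]
  exact Finsupp.sum_single_index (smul_zero _)

lemma evalAt_one_star (A : MatLaurent ℂ ι) : evalAt (star A) 1 = (evalAt A 1)ᴴ := by
  induction A using LaurentPolynomial.induction_on' with
  | add p q hp hq =>
    rw [star_add, evalAt_add one_ne_zero, hp, hq, evalAt_add one_ne_zero, conjTranspose_add]
  | C_mul_T r a => rw [star_monomial, evalAt_monomial, evalAt_monomial]; simp; rfl

lemma polyEvalAt_eq (P : MatPoly ℂ ι) (z : ℂ) :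
    polyEvalAt P z = (Polynomial.evalRingHom z).mapMatrix (matPolyEquiv.symm P) := by
  obtain ⟨Q, rfl⟩ := matPolyEquiv.surjective P
  rw [AlgEquiv.symm_apply_apply]
  ext i j
  rw [polyEvalAt, Polynomial.sum_def, Matrix.sum_apply, RingHom.mapMatrix_apply, map_apply,
    Polynomial.coe_evalRingHom, Polynomial.eval_eq_sum, Polynomial.sum_def]
  simp only [Matrix.smul_apply, matPolyEquiv_coeff_apply, smul_eq_mul]
  symm
  rw [Finset.sum_subset (s₂ := (matPolyEquiv Q).support)]
  · simp only [mul_comm]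
  · exact support_subset_support_matPolyEquiv Q i j
  · intro r _ hr
    rw [Polynomial.notMem_support_iff.mp hr, zero_mul]

lemma polyEvalAt_mul (P Q : MatPoly ℂ ι) (z : ℂ) :
    polyEvalAt (P * Q) z = polyEvalAt P z * polyEvalAt Q z := by
  simp only [polyEvalAt_eq, map_mul]

lemma polyEvalAt_add (P Q : MatPoly ℂ ι) (z : ℂ) :
    polyEvalAt (P + Q) z = polyEvalAt P z + polyEvalAt Q z := by
  simp only [polyEvalAt_eq, map_add]

lemma polyEvalAt_monomial (a : Matrix ι ι ℂ) (r : ℕ) (z : ℂ) :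
    polyEvalAt (Polynomial.monomial r a) z = z ^ r • a :=
  Polynomial.sum_monomial_index a _ (smul_zero _)

lemma polyEvalAt_C (a : Matrix ι ι ℂ) (z : ℂ) : polyEvalAt (Polynomial.C a) z = a := by
  rw [← Polynomial.monomial_zero_left, polyEvalAt_monomial, pow_zero, one_smul]

lemma toMatrix_inZ (P : MatPoly ℂ ι) :
    toMatrix (inZ P) = (Polynomial.toLaurent : _ →+* ℂ[T;T⁻¹]).mapMatrix (matPolyEquiv.symm P) := by
  obtain ⟨Q, rfl⟩ := matPolyEquiv.surjective P
  rw [AlgEquiv.symm_apply_apply]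
  ext i j r
  rw [coeff_toMatrix, RingHom.mapMatrix_apply, map_apply]
  rcases lt_or_ge r 0 with hr | hr
  · rw [inZ, expGE_toLaurent _ r hr, expGE_toLaurent _ r hr]; rfl
  · lift r to ℕ using hr
    rw [inZ, coeff_toLaurent_natCast, coeff_toLaurent_natCast, matPolyEquiv_coeff_apply]

lemma inZInv_add (P Q : MatPoly ℂ ι) : inZInv (P + Q) = inZInv P + inZInv Q :=
  Polynomial.sum_add_index _ _ _ (fun r => by simp [mono]) fun r a b => by
    simp only [mono, map_add, add_mul]

lemma inZInv_monomial (a : Matrix ι ι ℂ) (r : ℕ) :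
    inZInv (Polynomial.monomial r a) = C a * T (-(r : ℤ)) :=
  Polynomial.sum_monomial_index a _ (by simp [mono])

lemma toMatrix_inZInv (P : MatPoly ℂ ι) :
    toMatrix (inZInv P) = ((invert : ℂ[T;T⁻¹] ≃ₐ[ℂ] _).toRingEquiv.toRingHom.comp
      Polynomial.toLaurent).mapMatrix (matPolyEquiv.symm P) := by
  induction P using Polynomial.induction_on' with
  | add P Q hP hQ => rw [inZInv_add, map_add, hP, hQ, map_add, map_add]
  | monomial r a =>
    ext1 i j
    rw [inZInv_monomial, toMatrix_monomial, RingHom.mapMatrix_apply, map_apply]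
    have : matPolyEquiv.symm (Polynomial.monomial r a) i j = Polynomial.monomial r (a i j) := by
      obtain ⟨Q, hQ⟩ := matPolyEquiv.surjective (Polynomial.monomial r a)
      rw [← hQ, AlgEquiv.symm_apply_apply]
      ext t
      rw [← matPolyEquiv_coeff_apply, hQ, Polynomial.coeff_monomial, Polynomial.coeff_monomial]
      split_ifs <;> simp
    rw [this]
    simp [Polynomial.toLaurent_C_mul_T]

end Evaluation

/-! ### Uniqueness of the partial indices -/

section Uniqueness

/-- A scalar form of Liouville's theorem. -/
lemma eq_zero_of_analytic_inside_outside {x p q y : Polynomial ℂ} {n : ℕ} (hn : 0 < n)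
    (hp : ∀ z : ℂ, ‖z‖ ≤ 1 → p.eval z ≠ 0) (hq : ∀ z : ℂ, ‖z‖ ≤ 1 → q.eval z ≠ 0)
    (h : Polynomial.toLaurent x * T n * invert (Polynomial.toLaurent q) =
      Polynomial.toLaurent p * invert (Polynomial.toLaurent y)) : x = 0 := by
  -- Multiplication by z^(deg y + deg q) clears the negative exponents.
  have h1 : x * (Polynomial.X ^ (n + y.natDegree) * q.reverse) =
      p * (y.reverse * Polynomial.X ^ q.natDegree) := by
    apply Polynomial.toLaurent_injective
    simp only [map_mul, Polynomial.toLaurent_X_pow, toLaurent_reverse]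
    calc _ = Polynomial.toLaurent x * T n * invert (Polynomial.toLaurent q) *
          (T y.natDegree * T q.natDegree) := by push_cast; rw [T_add]; ring
      _ = _ := by rw [h]; ring
  have hq0 : q.coeff 0 ≠ 0 := by
    rw [Polynomial.coeff_zero_eq_eval_zero]; exact hq 0 (by simp)
  have hqne : q ≠ 0 := by rintro rfl; simp at hq0
  -- The zeros of p lie outside the closed disk. Those of the other factor are 0 or reciprocals of
  -- zeros of q, hence inside.
  have hcop : IsCoprime p (Polynomial.X ^ (n + y.natDegree) * q.reverse) := by
    rw [Polynomial.isCoprime_iff_aeval_ne_zero_of_isAlgClosed ℂ ℂ]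
    intro z
    by_contra hcon
    push Not at hcon
    obtain ⟨hz1, hz2⟩ := hcon
    simp only [Polynomial.coe_aeval_eq_eval, Polynomial.eval_mul, Polynomial.eval_pow,
      Polynomial.eval_X] at hz1 hz2
    have hz : 1 < ‖z‖ := by
      by_contra hle
      exact hp z (not_lt.mp hle) hz1
    have hz0 : z ≠ 0 := by rintro rfl; simp at hz; linarith
    have hz3 : q.reverse.eval z = 0 := (mul_eq_zero.mp hz2).resolve_left (pow_ne_zero _ hz0)
    have : Invertible (z⁻¹) := invertibleOfNonzero (inv_ne_zero hz0)
    have hz4 := Polynomial.eval₂_reverse_eq_zero_iff (RingHom.id ℂ) z⁻¹ q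
    rw [invOf_eq_inv, inv_inv] at hz4
    refine hq z⁻¹ ?_ (hz4.mp hz3)
    rw [norm_inv]; exact inv_le_one_of_one_le₀ hz.le
  obtain ⟨u, rfl⟩ := hcop.dvd_of_dvd_mul_right (Dvd.intro _ h1.symm)
  by_contra hne
  have hp0 : p ≠ 0 := left_ne_zero_of_mul hne
  have hu0 : u ≠ 0 := right_ne_zero_of_mul hne
  rw [mul_assoc] at h1
  -- After cancelling p, the left degree is deg u + n + deg y + deg q, using q(0) ≠ 0, and the right
  -- degree is at most deg y + deg q. This contradicts n > 0.
  have h2 := congrArg Polynomial.natDegree (mul_left_cancel₀ hp0 h1)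
  have hrev : q.reverse ≠ 0 := by simpa using hqne
  rw [Polynomial.natDegree_mul hu0 (mul_ne_zero (pow_ne_zero _ Polynomial.X_ne_zero) hrev),
    Polynomial.natDegree_mul (pow_ne_zero _ Polynomial.X_ne_zero) hrev,
    Polynomial.natDegree_X_pow, Polynomial.reverse_natDegree,
    Polynomial.natTrailingDegree_eq_zero_of_constantCoeff_ne_zero hq0] at h2
  have h3 := Polynomial.natDegree_mul_le (p := y.reverse) (q := Polynomial.X ^ q.natDegree)
  rw [Polynomial.natDegree_X_pow] at h3
  have h4 := Polynomial.reverse_natDegree_le y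
  omega

variable {ι : Type} [Fintype ι] [DecidableEq ι]

lemma eval_det_ne_zero {P : MatPoly ℂ ι} (hP : InvertibleOnDisk P) {z : ℂ} (hz : ‖z‖ ≤ 1) :
    (matPolyEquiv.symm P).det.eval z ≠ 0 := by
  have h := hP z hz
  rw [polyEvalAt_eq, Matrix.isUnit_iff_isUnit_det, ← RingHom.map_det] at h
  exact h.ne_zero

/-- From PDQ = P'D'Q' follows P'⁻¹P·D = D'·Q'Q⁻¹. If κ' i < κ j, the (i, j) entry says that a
function analytic on the disk with a zero at 0 equals one analytic outside, ∞ included, so it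
vanishes. The invertible matrix P'⁻¹P at 0 then has the zero pattern needed for counting. Adjugates
stand in for inverses, so that everything remains polynomial. -/
lemma IsWienerHopf.card_le {A : MatLaurent ℂ ι} {κ κ' : ι → ℤ} {Ap Am Bp Bm : MatPoly ℂ ι}
    (hA : IsWienerHopf A κ Ap Am) (hB : IsWienerHopf A κ' Bp Bm) (a : ℤ) :
    Fintype.card {i // κ' i < a} ≤ Fintype.card {i // κ i < a} := by
  set P := matPolyEquiv.symm Ap with hP
  set Q := matPolyEquiv.symm Am with hQ
  set P' := matPolyEquiv.symm Bp with hP'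
  set Q' := matPolyEquiv.symm Bm with hQ'
  let L := (Polynomial.toLaurent : Polynomial ℂ →+* ℂ[T;T⁻¹])
  let I := (invert : ℂ[T;T⁻¹] ≃ₐ[ℂ] _).toRingEquiv.toRingHom.comp L
  have heq : L.mapMatrix P * diagonal (fun i => T (κ i)) * I.mapMatrix Q =
      L.mapMatrix P' * diagonal (fun i => T (κ' i)) * I.mapMatrix Q' := by
    rw [← toMatrix_inZ, ← toMatrix_inZ, ← toMatrix_inZInv, ← toMatrix_inZInv,
      ← toMatrix_diagonalFactor, ← toMatrix_diagonalFactor, ← map_mul, ← map_mul, ← map_mul,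
      ← map_mul, ← hA.eq, ← hB.eq]
  have hXY : ∀ i j, L ((P'.adjugate * P) i j) * T (κ j) * I Q.det =
      L P'.det * (T (κ' i) * I ((Q' * Q.adjugate) i j)) := by
    have h1 : L.mapMatrix (P'.adjugate * P) * diagonal (fun i => T (κ i)) *
        (I.mapMatrix (Q * Q.adjugate)) = L.mapMatrix (P'.adjugate * P') *
        diagonal (fun i => T (κ' i)) * I.mapMatrix (Q' * Q.adjugate) := by
      simp only [map_mul]
      calc _ = L.mapMatrix P'.adjugate * (L.mapMatrix P * diagonal (fun i => T (κ i)) *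
            I.mapMatrix Q) * I.mapMatrix Q.adjugate := by simp only [mul_assoc]
        _ = _ := by rw [heq]; simp only [mul_assoc]
    intro i j
    have h2 := congrFun (congrFun h1 i) j
    rw [mul_adjugate, adjugate_mul, ← Matrix.diagonal_one, ← Matrix.diagonal_smul,
      ← Matrix.diagonal_smul] at h2
    simp only [RingHom.mapMatrix_apply, diagonal_map, map_zero] at h2
    rw [Matrix.mul_assoc, diagonal_mul_diagonal, diagonal_mul_diagonal, mul_diagonal,
      diagonal_mul] at h2
    simpa [mul_assoc] using h2
  have hdet : ∀ {R : MatPoly ℂ ι}, InvertibleOnDisk R → ∀ z : ℂ, ‖z‖ ≤ 1 →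
      (matPolyEquiv.symm R).det.eval z ≠ 0 := fun h z hz => eval_det_ne_zero h hz
  have hzero : ∀ i j, κ' i < κ j → (P'.adjugate * P) i j = 0 := by
    intro i j hij
    obtain ⟨n, hn⟩ := Int.eq_ofNat_of_zero_le (sub_nonneg.mpr hij.le)
    refine eq_zero_of_analytic_inside_outside (n := n) (by omega) (hdet hB.plus_invertible)
      (hdet hA.minus_invertible) (y := (Q' * Q.adjugate) i j) ?_
    have h1 := hXY i j
    have h2 : (T (κ j) : ℂ[T;T⁻¹]) = T (κ' i) * T n := by rw [← T_add, ← hn]; congr 1; ring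
    have h3 : (T (κ' i) : ℂ[T;T⁻¹]) * (L ((P'.adjugate * P) i j) * T n * I Q.det) =
        T (κ' i) * (L P'.det * I ((Q' * Q.adjugate) i j)) := by
      rw [h2] at h1
      linear_combination h1
    exact (isUnit_T (κ' i)).mul_left_cancel h3
  let U := (Polynomial.evalRingHom (0 : ℂ)).mapMatrix (P'.adjugate * P)
  have hU : IsUnit U.det := by
    rw [← RingHom.map_det, det_mul, det_adjugate, map_mul, map_pow]
    exact ((isUnit_iff_ne_zero.mpr (hdet hB.plus_invertible 0 (by simp))).pow _).mul
      (isUnit_iff_ne_zero.mpr (hdet hA.plus_invertible 0 (by simp)))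
  refine card_lt_le_of_invertible (mul_nonsing_inv U hU) (fun i j h => ?_) a
  change Polynomial.eval 0 ((P'.adjugate * P) i j) = 0
  rw [hzero i j h, Polynomial.eval_zero]

lemma IsWienerHopf.card_eq {A : MatLaurent ℂ ι} {κ κ' : ι → ℤ} {Ap Am Bp Bm : MatPoly ℂ ι}
    (hA : IsWienerHopf A κ Ap Am) (hB : IsWienerHopf A κ' Bp Bm) (a : ℤ) :
    Fintype.card {i // κ i < a} = Fintype.card {i // κ' i < a} :=
  le_antisymm (hB.card_le hA a) (hA.card_le hB a)

end Uniqueness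

end HermitianWH

namespace HermitianWH

open Matrix

/-! ### Sylvester's law of inertia -/

section Signature

variable {ι : Type} [Fintype ι] [DecidableEq ι]

/-- Take c supported where a > 0 and keep the coordinates of cG where b > 0. If these vanish, the
form is at most 0 at c, but it is positive definite on such c. So this map is injective. -/
lemma card_pos_le_of_congruent {a b : ι → ℝ} {G : Matrix ι ι ℂ}
    (h : diagonal (fun i => (a i : ℂ)) = G * diagonal (fun i => (b i : ℂ)) * Gᴴ) :
    Fintype.card {i // 0 < a i} ≤ Fintype.card {i // 0 < b i} := by
  classical
  let ext : ({i // 0 < a i} → ℂ) →ₗ[ℂ] (ι → ℂ) := Function.ExtendByZero.linearMap ℂ Subtype.val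
  let f : ({i // 0 < a i} → ℂ) →ₗ[ℂ] ({i // 0 < b i} → ℂ) :=
    (LinearMap.funLeft ℂ ℂ Subtype.val).comp ((Matrix.vecMulLinear G).comp ext)
  have hform : ∀ c : ι → ℂ, ∑ i, a i * Complex.normSq (c i) =
      ∑ j, b j * Complex.normSq ((c ᵥ* G) j) := by
    intro c
    have h1 : c ᵥ* diagonal (fun i => (a i : ℂ)) ⬝ᵥ star c =
        (c ᵥ* G) ᵥ* diagonal (fun i => (b i : ℂ)) ⬝ᵥ star (c ᵥ* G) := by
      rw [h, star_vecMul, ← vecMul_vecMul, ← vecMul_vecMul, dotProduct_mulVec]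
    simp only [dotProduct, vecMul_diagonal, Pi.star_apply] at h1
    apply Complex.ofReal_injective
    push_cast
    convert h1 using 2
    · rename_i i _
      rw [Complex.normSq_eq_conj_mul_self, starRingEnd_apply]; ring
    · rename_i i _
      rw [Complex.normSq_eq_conj_mul_self, starRingEnd_apply]; ring
  have hf : Function.Injective f := by
    rw [injective_iff_map_eq_zero]
    intro c hc
    have h1 := hform (ext c)
    have h2 : ∑ j, b j * Complex.normSq ((ext c ᵥ* G) j) ≤ 0 := by
      refine Finset.sum_nonpos fun j _ => ?_
      by_cases hj : 0 < b j
      · have : (ext c ᵥ* G) j = 0 := congrFun hc ⟨j, hj⟩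
        rw [this]; simp
      · exact mul_nonpos_of_nonpos_of_nonneg (not_lt.mp hj) (Complex.normSq_nonneg _)
    have h3 : ∀ i ∈ Finset.univ, 0 ≤ a i * Complex.normSq (ext c i) := by
      intro i _
      by_cases hi : 0 < a i
      · exact mul_nonneg hi.le (Complex.normSq_nonneg _)
      · have : ext c i = 0 := Function.extend_apply' _ _ _ (by rintro ⟨x, rfl⟩; exact hi x.2)
        rw [this]; simp
    have h4 := (Finset.sum_eq_zero_iff_of_nonneg h3).mp
      (le_antisymm (h1.trans_le h2) (Finset.sum_nonneg h3))
    ext x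
    have h5 := h4 x (Finset.mem_univ _)
    have h6 : ext c x = c x := Subtype.val_injective.extend_apply _ _ _
    rw [h6] at h5
    exact Complex.normSq_eq_zero.mp ((mul_eq_zero.mp h5).resolve_left x.2.ne')
  have := LinearMap.finrank_le_finrank_of_injective hf
  simpa [Module.finrank_fintype_fun_eq_card] using this

lemma signature_eq_of_isHermitian {M : Matrix ι ι ℂ} (hM : M.IsHermitian) :
    signature M = (Fintype.card {i // 0 < hM.eigenvalues i} : ℤ) -
      Fintype.card {i // 0 < -hM.eigenvalues i} := by
  classical
  rw [signature, hM.roots_charpoly_eq_eigenvalues, Multiset.countP_map, Multiset.countP_map,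
    Fintype.card_subtype, Fintype.card_subtype]
  simp [Finset.card_def]

lemma exists_unitary_eigenvalues {M : Matrix ι ι ℂ} (hM : M.IsHermitian) :
    ∃ U : Matrix ι ι ℂ, Uᴴ * U = 1 ∧ U * Uᴴ = 1 ∧
      M = U * diagonal (fun i => (hM.eigenvalues i : ℂ)) * Uᴴ := by
  refine ⟨hM.eigenvectorUnitary, Unitary.coe_star_mul_self _, Unitary.coe_mul_star_self _, ?_⟩
  conv_lhs => rw [hM.spectral_theorem, Unitary.conjStarAlgAut_apply]
  rfl

lemma card_pos_eigenvalues_le {M N S : Matrix ι ι ℂ} (hM : M.IsHermitian) (hN : N.IsHermitian)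
    (h : N = S * M * Sᴴ) :
    Fintype.card {i // 0 < hN.eigenvalues i} ≤ Fintype.card {i // 0 < hM.eigenvalues i} ∧
      Fintype.card {i // 0 < -hN.eigenvalues i} ≤ Fintype.card {i // 0 < -hM.eigenvalues i} := by
  obtain ⟨U, hU, hU', hMU⟩ := exists_unitary_eigenvalues hM
  obtain ⟨V, hV, hV', hNV⟩ := exists_unitary_eigenvalues hN
  have h1 : diagonal (fun i => (hN.eigenvalues i : ℂ)) =
      (Vᴴ * S * U) * diagonal (fun i => (hM.eigenvalues i : ℂ)) * (Vᴴ * S * U)ᴴ := by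
    calc _ = (Vᴴ * V) * diagonal (fun i => (hN.eigenvalues i : ℂ)) * (Vᴴ * V) := by
          rw [hV, one_mul, mul_one]
      _ = Vᴴ * (V * diagonal (fun i => (hN.eigenvalues i : ℂ)) * Vᴴ) * V := by
          simp only [mul_assoc]
      _ = Vᴴ * (S * (U * diagonal (fun i => (hM.eigenvalues i : ℂ)) * Uᴴ) * Sᴴ) * V := by
          rw [← hNV, ← hMU, ← h]
      _ = _ := by
          rw [conjTranspose_mul, conjTranspose_mul, conjTranspose_conjTranspose]
          simp only [mul_assoc]
  refine ⟨card_pos_le_of_congruent h1, card_pos_le_of_congruent (a := fun i => -hN.eigenvalues i)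
    (b := fun i => -hM.eigenvalues i) (G := Vᴴ * S * U) ?_⟩
  have h2 : ∀ x : ι → ℝ, diagonal (fun i => ((-x i : ℝ) : ℂ)) =
      -diagonal (fun i => (x i : ℂ)) := fun x => by simp
  rw [h2, h2, h1, mul_neg, neg_mul]

lemma signature_congruent {M S S' : Matrix ι ι ℂ} (hM : M.IsHermitian) (hS : S' * S = 1) :
    signature (S * M * Sᴴ) = signature M := by
  have hN : (S * M * Sᴴ).IsHermitian := isHermitian_mul_mul_conjTranspose S hM
  have hback : M = S' * (S * M * Sᴴ) * S'ᴴ := by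
    calc M = (S' * S) * M * (S' * S)ᴴ := by simp [hS]
      _ = _ := by rw [conjTranspose_mul]; simp only [mul_assoc]
  have h1 := card_pos_eigenvalues_le hM hN rfl
  have h2 := card_pos_eigenvalues_le hN hM hback
  rw [signature_eq_of_isHermitian hM, signature_eq_of_isHermitian hN]
  omega

/-- The eigenvalues are 1 and -1, so their sum counts them with sign. -/
lemma signature_eq_trace {J : Matrix ι ι ℂ} (hJ : J.IsHermitian) (hJJ : J * J = 1) :
    (signature J : ℂ) = J.trace := by
  obtain ⟨U, hU, hU', hJU⟩ := exists_unitary_eigenvalues hJ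
  have hsq : ∀ i, hJ.eigenvalues i = 1 ∨ hJ.eigenvalues i = -1 := by
    intro i
    set D := diagonal (fun i => (hJ.eigenvalues i : ℂ)) with hD
    have h1 : D = Uᴴ * J * U := by
      calc D = (Uᴴ * U) * D * (Uᴴ * U) := by rw [hU, one_mul, mul_one]
        _ = Uᴴ * (U * D * Uᴴ) * U := by simp only [mul_assoc]
        _ = _ := by rw [← hJU]
    have h2 : D * D = 1 := by
      calc D * D = Uᴴ * J * (U * Uᴴ) * J * U := by rw [h1]; simp only [mul_assoc]
        _ = Uᴴ * (J * J) * U := by rw [hU', mul_one]; simp only [mul_assoc]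
        _ = 1 := by rw [hJJ, mul_one, hU]
    have h3 := congrFun (congrFun h2 i) i
    rw [hD, diagonal_mul_diagonal, diagonal_apply_eq, one_apply_eq] at h3
    have h4 : hJ.eigenvalues i * hJ.eigenvalues i = 1 := by exact_mod_cast h3
    exact mul_self_eq_one_iff.mp h4
  rw [hJ.trace_eq_sum_eigenvalues, signature_eq_of_isHermitian hJ, Fintype.card_subtype,
    Fintype.card_subtype, Finset.card_filter, Finset.card_filter]
  push_cast
  rw [← Finset.sum_sub_distrib]
  refine Finset.sum_congr rfl fun i _ => ?_
  rcases hsq i with h | h <;> rw [h] <;> norm_num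

end Signature

end HermitianWH

namespace HermitianWH

open Matrix LaurentPolynomial

/-! ### Real scalar multiples of the determinant -/

section RealFactors

/-- The real quadratic polynomial with the zeros `b` and `conj b`. -/
noncomputable def realQuadratic (b : ℂ) : Polynomial ℝ :=
  Polynomial.X ^ 2 - Polynomial.C (2 * b.re) * Polynomial.X + Polynomial.C (Complex.normSq b)

lemma realQuadratic_map (b : ℂ) : (realQuadratic b).map Complex.ofRealHom =
    (Polynomial.X - Polynomial.C b) * (Polynomial.X - Polynomial.C (starRingEnd ℂ b)) := by
  have h1 : (2 * b.re : ℂ) = b + starRingEnd ℂ b := by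
    rw [Complex.add_conj]; push_cast; rfl
  have h2 : (Complex.normSq b : ℂ) = b * starRingEnd ℂ b := (Complex.mul_conj b).symm
  simp only [realQuadratic, Polynomial.map_add, Polynomial.map_sub, Polynomial.map_mul,
    Polynomial.map_pow, Polynomial.map_X, Polynomial.map_C, Complex.ofRealHom_eq_coe]
  rw [h2, Complex.ofReal_mul, Complex.ofReal_ofNat, h1]
  simp only [map_add, map_mul]
  ring

lemma norm_eq_of_realQuadratic {S : Multiset ℂ} {z : ℂ}
    (h : (((S.map realQuadratic).prod).map Complex.ofRealHom).eval z = 0) :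
    ∃ b ∈ S, ‖z‖ = ‖b‖ := by
  rw [← Polynomial.coe_mapRingHom, map_multiset_prod, ← Polynomial.coe_evalRingHom,
    map_multiset_prod, Multiset.prod_eq_zero_iff, Multiset.map_map, Multiset.map_map,
    Multiset.mem_map] at h
  obtain ⟨b, hb, h⟩ := h
  refine ⟨b, hb, ?_⟩
  simp only [Function.comp_apply, Polynomial.coe_mapRingHom, Polynomial.coe_evalRingHom,
    realQuadratic_map, Polynomial.eval_mul, Polynomial.eval_sub, Polynomial.eval_X,
    Polynomial.eval_C, mul_eq_zero, sub_eq_zero] at h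
  rcases h with rfl | rfl
  · rfl
  · exact RCLike.norm_conj b

/-- Multiplying by the factors of the conjugate roots, and normalizing, makes g real. Conjugation
preserves the modulus, so the resulting real quadratics can be sorted by side of the circle. -/
lemma exists_real_factors {g : Polynomial ℂ} (hg : ∀ z : ℂ, ‖z‖ = 1 → g.eval z ≠ 0) :
    ∃ (q r : Polynomial ℝ) (w : Polynomial ℂ),
      (∀ z : ℂ, (q.map Complex.ofRealHom).eval z = 0 → 1 < ‖z‖) ∧
      (∀ z : ℂ, (r.map Complex.ofRealHom).eval z = 0 → ‖z‖ < 1) ∧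
      g * w = (q * r).map Complex.ofRealHom := by
  classical
  have hg0 : g ≠ 0 := by
    rintro rfl
    exact hg 1 (by simp) (by simp)
  refine ⟨((g.roots.filter fun b => 1 < ‖b‖).map realQuadratic).prod,
    ((g.roots.filter fun b => ¬ 1 < ‖b‖).map realQuadratic).prod,
    Polynomial.C g.leadingCoeff⁻¹ *
      (g.roots.map fun b => Polynomial.X - Polynomial.C (starRingEnd ℂ b)).prod, ?_, ?_, ?_⟩
  · intro z hz
    obtain ⟨b, hb, h⟩ := norm_eq_of_realQuadratic hz
    rw [h]; exact (Multiset.mem_filter.mp hb).2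
  · intro z hz
    obtain ⟨b, hb, h⟩ := norm_eq_of_realQuadratic hz
    obtain ⟨hb1, hb2⟩ := Multiset.mem_filter.mp hb
    rw [h]
    refine lt_of_le_of_ne (not_lt.mp hb2) fun h1 => hg b h1 ?_
    exact (Polynomial.mem_roots hg0).mp hb1
  · have hs := (IsAlgClosed.splits g).eq_prod_roots
    rw [← Multiset.prod_add, ← Multiset.map_add, Multiset.filter_add_not,
      ← Polynomial.coe_mapRingHom, map_multiset_prod, Multiset.map_map]
    have : (Polynomial.mapRingHom Complex.ofRealHom) ∘ realQuadratic = fun b =>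
        (Polynomial.X - Polynomial.C b) * (Polynomial.X - Polynomial.C (starRingEnd ℂ b)) :=
      funext realQuadratic_map
    rw [this, Multiset.prod_map_mul]
    have h1 : Polynomial.C g.leadingCoeff * Polynomial.C g.leadingCoeff⁻¹ = 1 := by
      rw [← Polynomial.C_mul, mul_inv_cancel₀ (Polynomial.leadingCoeff_ne_zero.mpr hg0),
        Polynomial.C_1]
    set x := (g.roots.map fun b => Polynomial.X - Polynomial.C b).prod
    set y := (g.roots.map fun b => Polynomial.X - Polynomial.C (starRingEnd ℂ b)).prod
    linear_combination (Polynomial.C g.leadingCoeff⁻¹ * y) * hs + (x * y) * h1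

lemma star_eq_invert (x : ℝ[T;T⁻¹]) : star x = invert x := by
  induction x using LaurentPolynomial.induction_on' with
  | add p q hp hq => rw [star_add, map_add, hp, hq]
  | C_mul_T n a => rw [star_monomial, map_mul, invert_C, invert_T, star_trivial]

/-- For real coefficients the involution is z ↦ z⁻¹, so q† is the reversed polynomial up to a power
of z. A common zero with q would be a zero of q whose reciprocal is also one; 0 is excluded by the
leading coefficient. -/
lemma isCoprime_star_of_roots {q : Polynomial ℝ} (hq0 : q ≠ 0)
    (hq : ∀ z w : ℂ, (q.map Complex.ofRealHom).eval z = 0 →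
      (q.map Complex.ofRealHom).eval w = 0 → z * w ≠ 1) :
    IsCoprime (Polynomial.toLaurent q) (star (Polynomial.toLaurent q)) := by
  have h1 : IsCoprime q q.reverse := by
    rw [← Polynomial.isCoprime_map Complex.ofRealHom,
      Polynomial.isCoprime_iff_aeval_ne_zero_of_isAlgClosed ℂ ℂ]
    intro z
    by_contra hcon
    push Not at hcon
    obtain ⟨hz1, hz2⟩ := hcon
    simp only [Polynomial.coe_aeval_eq_eval] at hz1 hz2
    rcases eq_or_ne z 0 with rfl | hz
    · rw [← Polynomial.coeff_zero_eq_eval_zero, Polynomial.coeff_map,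
        Polynomial.coeff_zero_reverse] at hz2
      exact hq0 (Polynomial.leadingCoeff_eq_zero.mp (Complex.ofReal_eq_zero.mp hz2))
    · have : Invertible (z⁻¹) := invertibleOfNonzero (inv_ne_zero hz)
      have hz4 := Polynomial.eval₂_reverse_eq_zero_iff Complex.ofRealHom z⁻¹ q
      rw [invOf_eq_inv, inv_inv, ← Polynomial.eval_map, ← Polynomial.eval_map] at hz4
      exact hq z z⁻¹ hz1 (hz4.mp hz2) (mul_inv_cancel₀ hz)
  have h2 := h1.map (Polynomial.toLaurent : Polynomial ℝ →+* ℝ[T;T⁻¹])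
  rw [toLaurent_reverse, ← star_eq_invert] at h2
  exact h2.of_mul_right_left

/-- The adjugate inverts M up to its determinant, which becomes a polynomial after a shift and then
a real one. -/
lemma exists_scaled_inverse_of_eval {ι : Type} [Fintype ι] [DecidableEq ι]
    (M : Matrix ι ι ℂ[T;T⁻¹])
    (hM : ∀ u : ℂˣ, ‖(u : ℂ)‖ = 1 → LaurentPolynomial.eval₂ (RingHom.id ℂ) u M.det ≠ 0) :
    ∃ (q r : Polynomial ℝ) (N : Matrix ι ι ℂ[T;T⁻¹]),
      (∀ z : ℂ, (q.map Complex.ofRealHom).eval z = 0 → 1 < ‖z‖) ∧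
      (∀ z : ℂ, (r.map Complex.ofRealHom).eval z = 0 → ‖z‖ < 1) ∧
      M * N = Polynomial.toLaurent ((q * r).map Complex.ofRealHom) • 1 := by
  obtain ⟨n, g, hgn⟩ := exists_T_pow M.det
  have hg : ∀ z : ℂ, ‖z‖ = 1 → g.eval z ≠ 0 := by
    intro z hz hgz
    have hz0 : z ≠ 0 := by rintro rfl; simp at hz
    have h2 := congrArg (LaurentPolynomial.eval₂ (RingHom.id ℂ) (Units.mk0 z hz0)) hgn
    rw [map_mul, LaurentPolynomial.eval₂_toLaurent, Units.val_mk0, Polynomial.eval₂_id, hgz] at h2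
    exact mul_ne_zero (hM _ hz) ((isUnit_T (n : ℤ)).map _).ne_zero h2.symm
  obtain ⟨q, r, w, hq, hr, hw⟩ := exists_real_factors hg
  refine ⟨q, r, (T n * Polynomial.toLaurent w) • M.adjugate, hq, hr, ?_⟩
  rw [Matrix.mul_smul, mul_adjugate, smul_smul, ← hw, map_mul, hgn]
  congr 1
  ring

lemma exists_scaled_inverse {ι : Type} [Fintype ι] [DecidableEq ι] {A : MatLaurent ℂ ι}
    (hA : InvertibleOnCircle A) :
    ∃ (q r : Polynomial ℝ) (N : Matrix ι ι ℂ[T;T⁻¹]),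
      (∀ z : ℂ, (q.map Complex.ofRealHom).eval z = 0 → 1 < ‖z‖) ∧
      (∀ z : ℂ, (r.map Complex.ofRealHom).eval z = 0 → ‖z‖ < 1) ∧
      toMatrix A * N = Polynomial.toLaurent ((q * r).map Complex.ofRealHom) • 1 := by
  refine exists_scaled_inverse_of_eval (toMatrix A) fun u hu => ?_
  have h1 := hA u hu
  rw [evalAt_eq u rfl, Matrix.isUnit_iff_isUnit_det, ← RingHom.map_det] at h1
  exact h1.ne_zero

end RealFactors

end HermitianWH

namespace HermitianWH

open Matrix LaurentPolynomial

/-! ### The constant Hermitian involution -/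

section MiddleConstant

variable {d : ℕ} {κ s : Fin d → ℤ}

lemma middleConst_mul_self (hrev : ∀ i, κ i.rev = -κ i) (hs : ∀ i, s i = 1 ∨ s i = -1) :
    middleConst κ s * middleConst κ s = 1 := by
  ext i j
  rw [Matrix.mul_apply, one_apply]
  by_cases h : κ i = 0
  · rw [Finset.sum_eq_single i (fun b _ hb => by simp [middleConst, h, hb.symm]) (by simp)]
    rcases hs i with h1 | h1 <;> simp [middleConst, h, h1]
  · rw [Finset.sum_eq_single i.rev (fun b _ hb => by simp [middleConst, h, hb]) (by simp)]
    simp [middleConst, h, hrev, eq_comm]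

lemma middleConst_transpose (hrev : ∀ i, κ i.rev = -κ i) :
    (middleConst κ s)ᵀ = middleConst κ s := by
  ext i j
  simp only [transpose_apply, middleConst, of_apply]
  have hij : i = j.rev ↔ j = i.rev := ⟨fun h => by rw [h, Fin.rev_rev], fun h => by
    rw [h, Fin.rev_rev]⟩
  by_cases h : i = j
  · subst h; rfl
  · by_cases h' : j = i.rev
    · subst h'; simp [hrev, h, Ne.symm h]
    · simp [h, Ne.symm h, h', hij]

lemma trace_middleConst (hrev : ∀ i, κ i.rev = -κ i) :
    (middleConst κ s).trace = ∑ m with κ m = 0, s m := by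
  rw [Finset.sum_filter, Matrix.trace]
  refine Finset.sum_congr rfl fun i _ => ?_
  simp only [diag_apply, middleConst, of_apply, if_true]
  split_ifs with h1 h2
  · rfl
  · have := hrev i
    rw [← h2] at this
    omega
  · rfl

end MiddleConstant

/-! ### Polynomials in z and in its inverse -/

section Polynomials

lemma inZ_monomial {R n : Type} [Ring R] [Fintype n] [DecidableEq n] (a : Matrix n n R) (r : ℕ) :
    inZ (Polynomial.monomial r a) = C a * T r := by
  rw [inZ, ← Polynomial.C_mul_X_pow_eq_monomial, Polynomial.toLaurent_C_mul_X_pow]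

variable {ι : Type} [Fintype ι] [DecidableEq ι]

lemma evalAt_inZ {z : ℂ} (hz : z ≠ 0) (P : MatPoly ℂ ι) : evalAt (inZ P) z = polyEvalAt P z := by
  induction P using Polynomial.induction_on' with
  | add p q hp hq =>
    rw [polyEvalAt_add, ← hp, ← hq, ← evalAt_add hz, inZ, inZ, inZ, map_add]
  | monomial n a => rw [inZ_monomial, evalAt_monomial, polyEvalAt_monomial, zpow_natCast]

lemma evalAt_one_diagonalFactor (κ : ι → ℤ) :
    evalAt (diagonalFactor κ : MatLaurent ℂ ι) 1 = 1 := by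
  rw [evalAt_eq 1 Units.val_one, toMatrix_diagonalFactor, RingHom.mapMatrix_apply,
    diagonal_map (map_zero _), ← diagonal_one]
  congr 1
  ext i
  simp

/-- Supplies the minus factor: conjugation maps the disk to itself, so Q inherits invertibility
there from P. -/
lemma exists_inZInv_eq_star (P : MatPoly ℂ ι) : ∃ Q : MatPoly ℂ ι, inZInv Q = star (inZ P) ∧
    ∀ z, polyEvalAt Q z = (polyEvalAt P (starRingEnd ℂ z))ᴴ := by
  induction P using Polynomial.induction_on' with
  | add p q hp hq =>
    obtain ⟨p', hp, hp'⟩ := hp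
    obtain ⟨q', hq, hq'⟩ := hq
    refine ⟨p' + q', ?_, fun z => ?_⟩
    · rw [inZInv_add, hp, hq, ← star_add, inZ, inZ, inZ, map_add]
    · rw [polyEvalAt_add, polyEvalAt_add, hp', hq', conjTranspose_add]
  | monomial n a =>
    refine ⟨Polynomial.monomial n aᴴ, ?_, fun z => ?_⟩
    · rw [inZInv_monomial, inZ_monomial, star_monomial, star_eq_conjTranspose]
    · rw [polyEvalAt_monomial, polyEvalAt_monomial, conjTranspose_smul, star_pow,
        starRingEnd_apply, star_star]

lemma polyEvalAt_real (q : Polynomial ℝ) (z : ℂ) :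
    polyEvalAt (q.map (algebraMap ℝ (Matrix ι ι ℂ))) z =
      (q.map Complex.ofRealHom).eval z • (1 : Matrix ι ι ℂ) := by
  induction q using Polynomial.induction_on' with
  | add p q hp hq =>
    rw [Polynomial.map_add, polyEvalAt_add, hp, hq, Polynomial.map_add, Polynomial.eval_add,
      add_smul]
  | monomial n a =>
    rw [Polynomial.map_monomial, polyEvalAt_monomial, Polynomial.map_monomial,
      Polynomial.eval_monomial, Algebra.algebraMap_eq_smul_one, mul_comm, mul_smul]
    congr 1

lemma toLaurent_map {R S : Type} [Semiring R] [Semiring S] (f : R →+* S) (p : Polynomial R) :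
    Polynomial.toLaurent (p.map f) = AddMonoidAlgebra.mapRingHom ℤ f (Polynomial.toLaurent p) := by
  induction p using Polynomial.induction_on' with
  | add p q hp hq => rw [Polynomial.map_add, map_add, hp, hq, map_add, map_add]
  | monomial n a =>
    rw [Polynomial.map_monomial, ← Polynomial.C_mul_X_pow_eq_monomial,
      ← Polynomial.C_mul_X_pow_eq_monomial, Polynomial.toLaurent_C_mul_X_pow,
      Polynomial.toLaurent_C_mul_X_pow, ← single_eq_C_mul_T, ← single_eq_C_mul_T,
      AddMonoidAlgebra.mapRingHom_single]

lemma toMatrix_symm_smul_one {R n : Type} [CommRing R] [Fintype n] [DecidableEq n]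
    (x : R[T;T⁻¹]) (k : ℤ) :
    ((toMatrix (R := R) (n := n)).symm (x • 1)).coeff k = x.coeff k • 1 := by
  ext i j
  rw [← coeff_toMatrix, RingEquiv.apply_symm_apply]
  by_cases h : i = j
  · subst h; simp
  · simp [h]

lemma toMatrix_real {F n : Type} [DivisionRing F] [Algebra ℝ F] [Fintype n] [DecidableEq n]
    (x : ℝ[T;T⁻¹]) :
    toMatrix (AddMonoidAlgebra.mapRingHom ℤ (algebraMap ℝ (Matrix n n F)) x) =
      x • (1 : Matrix n n F[T;T⁻¹]) := by
  ext i j k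
  rw [coeff_toMatrix, AddMonoidAlgebra.coeff_mapRingHom, Matrix.smul_apply, realLaurent_smul]
  by_cases h : i = j
  · subst h; simp [Matrix.algebraMap_matrix_apply]
  · simp [h, Matrix.algebraMap_matrix_apply]

end Polynomials

/-! ### Extending coefficient representations to Laurent polynomials -/

section MapLaurent

variable {R n ι : Type} [Ring R] [Fintype n] [DecidableEq n] [Fintype ι] [DecidableEq ι]
  (ρ : Matrix n n R →+* Matrix ι ι ℂ)

lemma mapLaurent_eq (A : MatLaurent R n) :
    mapLaurent ρ A = AddMonoidAlgebra.mapRingHom ℤ ρ A := by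
  let f : MatLaurent R n →+ MatLaurent ℂ ι :=
    coeffSum fun r => (AddMonoidHom.mulRight (T r : MatLaurent ℂ ι)).comp
      ((C : Matrix ι ι ℂ →+* MatLaurent ℂ ι).toAddMonoidHom.comp ρ.toAddMonoidHom)
  have : f = (AddMonoidAlgebra.mapRingHom ℤ ρ).toAddMonoidHom := by
    refine addHom_ext fun a r => ?_
    rw [coeffSum_monomial]
    change C (ρ a) * T r = AddMonoidAlgebra.mapRingHom ℤ ρ (C a * T r)
    rw [← single_eq_C_mul_T, ← single_eq_C_mul_T, AddMonoidAlgebra.mapRingHom_single]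
  exact DFunLike.congr_fun this A

lemma mapLaurent_mul (A B : MatLaurent R n) :
    mapLaurent ρ (A * B) = mapLaurent ρ A * mapLaurent ρ B := by
  simp only [mapLaurent_eq, map_mul]

lemma coeff_mapLaurent (A : MatLaurent R n) (k : ℤ) :
    (mapLaurent ρ A).coeff k = ρ (A.coeff k) := by
  rw [mapLaurent_eq, AddMonoidAlgebra.coeff_mapRingHom]

lemma mapLaurent_inZ (P : MatPoly R n) : mapLaurent ρ (inZ P) = inZ (P.map ρ) := by
  rw [mapLaurent_eq, inZ, inZ, toLaurent_map]

lemma mapLaurent_mono (k : ℤ) (a : Matrix n n R) : mapLaurent ρ (mono k a) = mono k (ρ a) := by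
  rw [mapLaurent_eq, mono, mono, ← single_eq_C_mul_T, ← single_eq_C_mul_T,
    AddMonoidAlgebra.mapRingHom_single]

lemma mapLaurent_star [StarRing R] (hρ : ∀ a, ρ aᴴ = (ρ a)ᴴ) (A : MatLaurent R n) :
    mapLaurent ρ (star A) = star (mapLaurent ρ A) := by
  ext k i j
  rw [coeff_mapLaurent, coeff_star, coeff_star, coeff_mapLaurent, star_eq_conjTranspose, hρ]
  rfl

lemma mapLaurent_diagonalFactor {f : ι → n}
    (hρ : ∀ m, ρ (Matrix.single m m 1) = diagonal fun i => if f i = m then 1 else 0)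
    (κ : n → ℤ) : mapLaurent ρ (diagonalFactor κ) = diagonalFactor fun i => κ (f i) := by
  have h1 : mapLaurent ρ (diagonalFactor κ) =
      ∑ m, mono (κ m) (diagonal fun i => if f i = m then 1 else 0) := by
    rw [mapLaurent_eq, diagonalFactor, map_sum]
    refine Finset.sum_congr rfl fun m _ => ?_
    rw [← mapLaurent_eq, mapLaurent_mono, hρ]
  apply toMatrix.injective
  rw [h1, map_sum, toMatrix_diagonalFactor]
  ext1 i j
  rw [Matrix.sum_apply]
  simp only [toMatrix_mono]
  rw [Finset.sum_eq_single (f i)]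
  · by_cases h : i = j
    · subst h; simp
    · simp [h]
  · intro b _ hb
    by_cases h : i = j
    · subst h; simp [hb.symm]
    · simp [h]
  · simp

lemma mapCoeff_mapLaurent_mul {ρ : Matrix n n R →+* Matrix ι ι ℂ}
    {π : Matrix ι ι ℂ →+ Matrix n n R} (hπ : ∀ a M, π (ρ a * M) = a * π M)
    (A : MatLaurent R n) (X : MatLaurent ℂ ι) :
    mapCoeff π (mapLaurent ρ A * X) = A * mapCoeff π X := by
  rw [mapLaurent_eq]
  induction A using LaurentPolynomial.induction_on' with
  | add p q hp hq => rw [map_add, add_mul, map_add, hp, hq, add_mul]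
  | C_mul_T r a =>
    induction X using LaurentPolynomial.induction_on' with
    | add p q hp hq => rw [mul_add, map_add, hp, hq, map_add, mul_add]
    | C_mul_T k b =>
      rw [← mapLaurent_eq]
      change mapCoeff π (mapLaurent ρ (mono r a) * _) = _
      rw [mapLaurent_mono, mono, monomial_mul_monomial, mapCoeff_monomial, mapCoeff_monomial,
        monomial_mul_monomial, hπ]

end MapLaurent

end HermitianWH

/-! ### The theorem for a general matrix representation -/

namespace HermitianWH

open Matrix LaurentPolynomial

/-- A representation of matrices over `F` by complex matrices which is compatible with adjoints,
real scalars and diagonal idempotents, each of which has rank `e`. -/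
structure IsMatrixRep {F : Type} [DivisionRing F] [StarRing F] [Algebra ℝ F] {d : ℕ} {ι : Type}
    [Fintype ι] [DecidableEq ι] (ρ : Matrix (Fin d) (Fin d) F →+* Matrix ι ι ℂ) (f : ι → Fin d)
    (e : ℕ) : Prop where
  conjTranspose : ∀ a, ρ aᴴ = (ρ a)ᴴ
  algebraMap : ∀ x : ℝ, ρ (algebraMap ℝ _ x) = algebraMap ℝ _ x
  single : ∀ m, ρ (Matrix.single m m 1) = diagonal fun i => if f i = m then 1 else 0
  trace : ∀ X : Matrix (Fin d) (Fin d) ℤ,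
    (ρ (X.map (Int.cast : ℤ → F))).trace = e * (X.trace : ℂ)
  card_fiber : ∀ m, Fintype.card {i // f i = m} = e
  pos : 0 < e
  exists_proj : ∃ π : Matrix ι ι ℂ →+ Matrix (Fin d) (Fin d) F,
    π 1 = 1 ∧ ∀ a M, π (ρ a * M) = a * π M

namespace IsMatrixRep

variable {F : Type} [DivisionRing F] [StarRing F] [Algebra ℝ F] {d : ℕ} {ι : Type}
  [Fintype ι] [DecidableEq ι] {ρ : Matrix (Fin d) (Fin d) F →+* Matrix ι ι ℂ} {f : ι → Fin d}
  {e : ℕ}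

lemma card_lt (hρ : IsMatrixRep ρ f e) (κ : Fin d → ℤ) (a : ℤ) :
    Fintype.card {i // κ (f i) < a} = Fintype.card {m // κ m < a} * e := by
  classical
  rw [Fintype.card_subtype, Fintype.card_subtype, Finset.card_eq_sum_card_fiberwise (f := f)
    (t := Finset.univ.filter fun m => κ m < a) (fun i hi => by simpa using hi),
    Finset.sum_const_nat]
  intro m hm
  rw [← hρ.card_fiber m, Fintype.card_subtype, Finset.filter_filter]
  congr 1
  ext i
  simp only [Finset.mem_filter, Finset.mem_univ, true_and, and_iff_right_iff_imp]
  rintro rfl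
  simpa using hm

lemma antitone_unique (hρ : IsMatrixRep ρ f e) {κ κ' : Fin d → ℤ} (hκ : Antitone κ)
    (hκ' : Antitone κ') {A : MatLaurent ℂ ι} {Ap Am Bp Bm : MatPoly ℂ ι}
    (hA : IsWienerHopf A (fun i => κ (f i)) Ap Am)
    (hB : IsWienerHopf A (fun i => κ' (f i)) Bp Bm) : κ = κ' := by
  refine antitone_eq_of_card_lt_eq hκ hκ' fun a => ?_
  have h := hA.card_eq hB a
  rw [hρ.card_lt, hρ.card_lt] at h
  exact Nat.eq_of_mul_eq_mul_right hρ.pos h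

/-- The inverse N is found over ℂ, where determinants exist. Left linearity of π gives A·π(N) =
π(ρ(A)N), and the right side is again qr because qr is real. -/
lemma exists_scaled_inverse (hρ : IsMatrixRep ρ f e) {A : MatLaurent F (Fin d)}
    (hA : InvertibleOnCircle (mapLaurent ρ A)) :
    ∃ (q r : Polynomial ℝ) (B : MatLaurent F (Fin d)),
      (∀ z : ℂ, (q.map Complex.ofRealHom).eval z = 0 → 1 < ‖z‖) ∧
      (∀ z : ℂ, (r.map Complex.ofRealHom).eval z = 0 → ‖z‖ < 1) ∧
      toMatrix A * toMatrix B = (Polynomial.toLaurent q * Polynomial.toLaurent r : ℝ[T;T⁻¹]) •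
        (1 : Matrix (Fin d) (Fin d) F[T;T⁻¹]) := by
  obtain ⟨q, r, N, hq, hr, hN⟩ := HermitianWH.exists_scaled_inverse hA
  obtain ⟨π, hπ1, hπ⟩ := hρ.exists_proj
  refine ⟨q, r, mapCoeff π (toMatrix.symm N), hq, hr, ?_⟩
  have h1 : mapLaurent ρ A * toMatrix.symm N =
      toMatrix.symm (Polynomial.toLaurent ((q * r).map Complex.ofRealHom) • 1) := by
    rw [← hN, map_mul, RingEquiv.symm_apply_apply]
  rw [← map_mul, ← mapCoeff_mapLaurent_mul hπ, h1, ← map_mul, ← toMatrix_real]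
  congr 1
  ext k i j
  rw [coeff_mapCoeff, toMatrix_symm_smul_one, toLaurent_map, AddMonoidAlgebra.coeff_mapRingHom,
    AddMonoidAlgebra.coeff_mapRingHom]
  set c := (Polynomial.toLaurent (q * r) : ℝ[T;T⁻¹]).coeff k
  have h2 : (Complex.ofRealHom c • 1 : Matrix ι ι ℂ) = ρ (Algebra.algebraMap ℝ _ c) * 1 := by
    rw [hρ.algebraMap, mul_one, Algebra.algebraMap_eq_smul_one]
    ext i j
    simp
  rw [h2, hπ, hπ1, mul_one]

variable [RealStarField F]

theorem exists_factorization (hρ : IsMatrixRep ρ f e) {A : MatLaurent F (Fin d)}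
    (hA : dagger A = A) (hinv : InvertibleOnCircle (mapLaurent ρ A)) :
    ∃ (κ s : Fin d → ℤ) (P : MatPoly F (Fin d)), Antitone κ ∧ (∀ i, κ i.rev = -κ i) ∧
      (∀ m, s m = 1 ∨ s m = -1) ∧
      (∀ m m', κ m = 0 → κ m' = 0 → m' < m → s m' ≤ s m) ∧
      A = inZ P * middleFactor κ s * dagger (inZ P) ∧ InvertibleOnDisk (P.map ρ) := by
  obtain ⟨q, r, B, hq, hr, hAB⟩ := hρ.exists_scaled_inverse hinv
  have hq0 : q ≠ 0 := by
    rintro rfl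
    have := hq 0 (by simp)
    simp at this
    linarith
  have hr0 : r ≠ 0 := by
    rintro rfl
    have := hr 1 (by simp)
    simp at this
  have hq00 : (Polynomial.toLaurent q : ℝ[T;T⁻¹]).coeff 0 ≠ 0 := by
    intro h
    have h1 := coeff_toLaurent_natCast q 0
    rw [Nat.cast_zero, h] at h1
    have h2 := hq 0 (by
      rw [← Polynomial.coeff_zero_eq_eval_zero, Polynomial.coeff_map, ← h1, map_zero])
    rw [norm_zero] at h2
    linarith
  have hr00 : (Polynomial.toLaurent r : ℝ[T;T⁻¹]) ≠ 0 := fun h =>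
    hr0 (Polynomial.toLaurent_injective (by rw [h, map_zero]))
  -- Two zeros of q have a product of modulus greater than 1; for r below it is less than 1.
  have hqc := isCoprime_star_of_roots hq0 fun z w hz hw h => by
    have h1 := congrArg norm h
    rw [norm_mul, norm_one] at h1
    nlinarith [hq z hz, hq w hw]
  have hrc := isCoprime_star_of_roots hr0 fun z w hz hw h => by
    have h1 := congrArg norm h
    rw [norm_mul, norm_one] at h1
    nlinarith [hr z hz, hr w hw, norm_nonneg z, norm_nonneg w]
  have hA' : star (toMatrix A) = toMatrix A := by
    rw [← toMatrix_star, ← dagger_eq_star, hA]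
  obtain ⟨κ, hκ, hrev, s, E, Y, hs, hsm, hE, hY, hEY, -, hAE⟩ :=
    exists_hermitian_factorization hA' (expGE_toLaurent q) (expGE_toLaurent r) hq00 hr00 hAB hqc hrc
  obtain ⟨E, rfl⟩ := toMatrix.surjective E
  obtain ⟨Y, rfl⟩ := toMatrix.surjective Y
  obtain ⟨P, rfl⟩ := exists_toLaurent (isPolyMatrix_iff.mp hE)
  obtain ⟨Q, rfl⟩ := exists_toLaurent (isPolyMatrix_iff.mp hY)
  refine ⟨κ, s, P, hκ, hrev, hs, fun m m' => hsm m m', ?_, fun z hz => ?_⟩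
  · apply toMatrix.injective
    rw [hAE, dagger_eq_star, map_mul, map_mul, toMatrix_star, toMatrix_middleFactor hrev]
    rfl
  -- The relation EY = q·1 survives the representation, and q has no zeros in the closed disk.
  · have h1 : P * Q = q.map (Algebra.algebraMap ℝ _) := by
      apply Polynomial.toLaurent_injective
      apply toMatrix.injective
      rw [map_mul, map_mul, hEY, toLaurent_map, toMatrix_real]
    have h2 : P.map ρ * Q.map ρ = q.map (Algebra.algebraMap ℝ _) := by
      rw [← Polynomial.map_mul, h1, Polynomial.map_map]
      congr 1
      exact RingHom.ext hρ.algebraMap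
    have h3 : polyEvalAt (P.map ρ) z * polyEvalAt (Q.map ρ) z =
        (q.map Complex.ofRealHom).eval z • 1 := by
      rw [← polyEvalAt_mul, h2, polyEvalAt_real]
    set c := (q.map Complex.ofRealHom).eval z
    have hc : c ≠ 0 := fun h => absurd (hq z h) (not_lt.mpr hz)
    refine IsUnit.of_mul_eq_one (c⁻¹ • polyEvalAt (Q.map ρ) z) ?_
    rw [Matrix.mul_smul, h3, smul_smul, inv_mul_cancel₀ hc, one_smul]

/-- The symmetric factorization becomes a Wiener–Hopf one when J is moved into the plus factor. At z
= 1 the diagonal factor disappears and leaves a congruence with J. -/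
theorem exists_partialIndices (hρ : IsMatrixRep ρ f e) {A : MatLaurent F (Fin d)}
    (hA : dagger A = A) (hinv : InvertibleOnCircle (mapLaurent ρ A)) :
    ∃ κ : Fin d → ℤ,
      (Antitone κ ∧ ∃ Ap Am, IsWienerHopf (mapLaurent ρ A) (fun i => κ (f i)) Ap Am) ∧
      (∀ κ' : Fin d → ℤ, (Antitone κ' ∧
        ∃ Ap Am, IsWienerHopf (mapLaurent ρ A) (fun i => κ' (f i)) Ap Am) → κ' = κ) ∧
      ∃ (s : Fin d → ℤ) (P : MatPoly F (Fin d)),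
        (∀ m, κ m = 0 → s m = 1 ∨ s m = -1) ∧
        (∀ m m', κ m = 0 → κ m' = 0 → m' < m → s m' ≤ s m) ∧
        A = inZ P * middleFactor κ s * dagger (inZ P) ∧
        InvertibleOnDisk (P.map ρ) ∧
        e * ∑ m with κ m = 0, s m = signature (evalAt (mapLaurent ρ A) 1) := by
  obtain ⟨κ, s, P, hκ, hrev, hs, hsm, hAP, hP⟩ := hρ.exists_factorization hA hinv
  set J := ρ ((middleConst κ s).map (Int.cast : ℤ → F)) with hJ
  have hJJ : J * J = 1 := by
    have h1 := congrArg (Int.castRingHom F).mapMatrix (middleConst_mul_self hrev hs)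
    rw [map_mul, map_one] at h1
    rw [hJ, ← map_mul]
    exact (congrArg ρ h1).trans (map_one ρ)
  have hJs : Jᴴ = J := by
    rw [hJ, ← hρ.conjTranspose]
    congr 1
    conv_rhs => rw [← middleConst_transpose hrev]
    ext i j
    simp
  have hmap : mapLaurent ρ A = inZ (P.map ρ) * (mono 0 J * diagonalFactor fun i => κ (f i)) *
      star (inZ (P.map ρ)) := by
    conv_lhs => rw [hAP]
    rw [mapLaurent_mul, mapLaurent_mul, dagger_eq_star, mapLaurent_star ρ hρ.conjTranspose,
      mapLaurent_inZ, middleFactor_eq hrev, mapLaurent_mul, mapLaurent_mono,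
      mapLaurent_diagonalFactor ρ hρ.single]
  obtain ⟨Q, hQ, hQP⟩ := exists_inZInv_eq_star (P.map ρ)
  have hWH : IsWienerHopf (mapLaurent ρ A) (fun i => κ (f i)) (P.map ρ * Polynomial.C J) Q := by
    refine ⟨?_, fun z hz => ?_, fun z hz => ?_⟩
    · rw [hmap, hQ, ← mul_assoc]
      congr 2
      rw [inZ, inZ, map_mul, Polynomial.toLaurent_C, mono, T_zero, mul_one]
    · rw [polyEvalAt_mul, polyEvalAt_C]
      exact (hP z hz).mul (IsUnit.of_mul_eq_one J hJJ)
    · rw [hQP, ← star_eq_conjTranspose]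
      exact (hP _ (by rwa [RCLike.norm_conj])).star
  refine ⟨κ, ⟨hκ, _, _, hWH⟩, fun κ' ⟨hκ', Ap, Am, h⟩ => hρ.antitone_unique hκ' hκ h hWH, s, P,
    fun m _ => hs m, hsm, hAP, hP, ?_⟩
  have hev : evalAt (mapLaurent ρ A) 1 =
      polyEvalAt (P.map ρ) 1 * J * (polyEvalAt (P.map ρ) 1)ᴴ := by
    rw [hmap, evalAt_mul one_ne_zero, evalAt_mul one_ne_zero, evalAt_mul one_ne_zero,
      evalAt_one_star, evalAt_inZ one_ne_zero, evalAt_one_diagonalFactor, mul_one, mono,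
      evalAt_monomial, zpow_zero, one_smul]
  obtain ⟨S', hS'⟩ := (hP 1 (by simp)).exists_left_inv
  rw [hev, signature_congruent hJs hS']
  have htr := signature_eq_trace hJs hJJ
  rw [hJ, hρ.trace, trace_middleConst hrev, ← hJ] at htr
  exact_mod_cast htr.symm

end IsMatrixRep

end HermitianWH

namespace HermitianWH

open Matrix LaurentPolynomial

/-! ### Real, complex and quaternionic representations -/

section Instances

instance : RealStarField ℝ where
  star_algebraMap _ := rfl
  exists_real a _ := ⟨a, rfl⟩

instance : RealStarField ℂ where
  star_algebraMap r := Complex.conj_ofReal r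
  exists_real a h := by
    obtain ⟨r, hr⟩ := Complex.conj_eq_iff_real.mp h
    exact ⟨r, hr.symm⟩

instance : RealStarField (Quaternion ℝ) where
  star_algebraMap r := Quaternion.star_coe r
  exists_real a h := ⟨a.re, (Quaternion.star_eq_self.mp h).symm⟩

lemma isMatrixRep_realRep (d : ℕ) : IsMatrixRep (realRep d) id 1 where
  conjTranspose a := by ext i j; simp [realRep]
  algebraMap x := by
    ext i j
    by_cases h : i = j <;> simp [realRep, Matrix.algebraMap_matrix_apply, h]
  single m := by
    ext i j
    simp only [realRep, RingHom.mapMatrix_apply, map_apply, single_apply, diagonal_apply, id]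
    by_cases h : i = j
    · subst h; simp [eq_comm]
    · simp [h]; rintro rfl; exact fun h' => absurd h' h
  trace X := by simp [realRep, Matrix.trace]
  card_fiber m := by simp
  pos := one_pos
  exists_proj := by
    -- Taking real parts is linear over the real matrices.
    refine ⟨Complex.reAddGroupHom.mapMatrix, ?_, fun a M => ?_⟩
    · ext i j
      by_cases h : i = j
      · subst h; simp
      · simp [h]
    · ext i j
      simp [realRep, Matrix.mul_apply]

lemma isMatrixRep_id (d : ℕ) : IsMatrixRep (RingHom.id (Matrix (Fin d) (Fin d) ℂ)) id 1 where
  conjTranspose a := rfl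
  algebraMap x := rfl
  single m := by
    ext i j
    simp only [RingHom.id_apply, single_apply, diagonal_apply, id]
    by_cases h : i = j
    · subst h; simp [eq_comm]
    · simp [h]; rintro rfl; exact fun h' => absurd h' h
  trace X := by simp [Matrix.trace]
  card_fiber m := by simp
  pos := one_pos
  exists_proj := ⟨AddMonoidHom.id _, rfl, fun _ _ => rfl⟩

/-- The projection of the complex `2 × 2` matrices onto the quaternions. -/
noncomputable def quaternionProj : Matrix (Fin 2) (Fin 2) ℂ →+ Quaternion ℝ where
  toFun M := ⟨((M 0 0).re + (M 1 1).re) / 2, ((M 0 0).im - (M 1 1).im) / 2,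
    ((M 0 1).re - (M 1 0).re) / 2, ((M 0 1).im + (M 1 0).im) / 2⟩
  map_zero' := by
    refine Quaternion.ext _ _ ?_ ?_ ?_ ?_ <;> change _ = (0 : ℝ) <;> simp
  map_add' M N := by
    refine Quaternion.ext _ _ ?_ ?_ ?_ ?_
    · change _ = ((M 0 0).re + (M 1 1).re) / 2 + ((N 0 0).re + (N 1 1).re) / 2
      simp only [Matrix.add_apply, Complex.add_re]; ring
    · change _ = ((M 0 0).im - (M 1 1).im) / 2 + ((N 0 0).im - (N 1 1).im) / 2
      simp only [Matrix.add_apply, Complex.add_im]; ring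
    · change _ = ((M 0 1).re - (M 1 0).re) / 2 + ((N 0 1).re - (N 1 0).re) / 2
      simp only [Matrix.add_apply, Complex.add_re]; ring
    · change _ = ((M 0 1).im + (M 1 0).im) / 2 + ((N 0 1).im + (N 1 0).im) / 2
      simp only [Matrix.add_apply, Complex.add_im]; ring

section

variable (M : Matrix (Fin 2) (Fin 2) ℂ)

lemma re_quaternionProj : (quaternionProj M).re = ((M 0 0).re + (M 1 1).re) / 2 := rfl

lemma imI_quaternionProj : (quaternionProj M).imI = ((M 0 0).im - (M 1 1).im) / 2 := rfl

lemma imJ_quaternionProj : (quaternionProj M).imJ = ((M 0 1).re - (M 1 0).re) / 2 := rfl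

lemma imK_quaternionProj : (quaternionProj M).imK = ((M 0 1).im + (M 1 0).im) / 2 := rfl

end

lemma quaternionProj_one : quaternionProj 1 = 1 := by
  refine Quaternion.ext _ _ ?_ ?_ ?_ ?_
  · rw [re_quaternionProj]; change _ = (1 : ℝ); simp
  · rw [imI_quaternionProj]; change _ = (0 : ℝ); simp
  · rw [imJ_quaternionProj]; change _ = (0 : ℝ); simp
  · rw [imK_quaternionProj]; change _ = (0 : ℝ); simp

/-- The complex 2 × 2 matrices are ℍ ⊕ iℍ with i the central scalar. Both summands are left
ℍ-modules, and the map is the projection onto the first. -/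
lemma quaternionProj_mul (a : Quaternion ℝ) (M : Matrix (Fin 2) (Fin 2) ℂ) :
    quaternionProj (quaternionRep a * M) = a * quaternionProj M := by
  refine Quaternion.ext _ _ ?_ ?_ ?_ ?_
  · rw [Quaternion.re_mul, re_quaternionProj, re_quaternionProj, imI_quaternionProj,
      imJ_quaternionProj, imK_quaternionProj]
    simp [quaternionRep, Matrix.mul_apply, -Matrix.cons_mul]
    ring
  · rw [Quaternion.imI_mul, re_quaternionProj, imI_quaternionProj, imI_quaternionProj,
      imJ_quaternionProj, imK_quaternionProj]
    simp [quaternionRep, Matrix.mul_apply, -Matrix.cons_mul]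
    ring
  · rw [Quaternion.imJ_mul, re_quaternionProj, imI_quaternionProj, imJ_quaternionProj,
      imJ_quaternionProj, imK_quaternionProj]
    simp [quaternionRep, Matrix.mul_apply, -Matrix.cons_mul]
    ring
  · rw [Quaternion.imK_mul, re_quaternionProj, imI_quaternionProj, imJ_quaternionProj,
      imK_quaternionProj, imK_quaternionProj]
    simp [quaternionRep, Matrix.mul_apply, -Matrix.cons_mul]
    ring

lemma quaternionRep_star (a : Quaternion ℝ) : quaternionRep (star a) = (quaternionRep a)ᴴ := by
  ext i j
  fin_cases i <;> fin_cases j <;> simp [quaternionRep, Complex.ext_iff]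

lemma quaternionRep_real (x : ℝ) : quaternionRep (algebraMap ℝ _ x) = algebraMap ℝ _ x := by
  ext i j
  fin_cases i <;> fin_cases j <;> simp [quaternionRep, Complex.ext_iff,
    Matrix.algebraMap_matrix_apply]

lemma quaternionMatrixRep_apply {d : ℕ} (a : Matrix (Fin d) (Fin d) (Quaternion ℝ))
    (p q : Fin d × Fin 2) :
    quaternionMatrixRep d a p q = quaternionRep (a p.1 q.1) p.2 q.2 := rfl

lemma isMatrixRep_quaternionMatrixRep (d : ℕ) :
    IsMatrixRep (quaternionMatrixRep d) Prod.fst 2 where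
  conjTranspose a := by
    ext p q
    rw [conjTranspose_apply, quaternionMatrixRep_apply, quaternionMatrixRep_apply,
      conjTranspose_apply, quaternionRep_star, conjTranspose_apply]
  algebraMap x := by
    ext ⟨i, a⟩ ⟨j, b⟩
    rw [quaternionMatrixRep_apply, Matrix.algebraMap_matrix_apply, Matrix.algebraMap_matrix_apply]
    by_cases h : i = j
    · subst h
      simp only [if_true, quaternionRep_real, Matrix.algebraMap_matrix_apply, Prod.mk.injEq,
        true_and]
    · simp [h]
  single m := by
    ext ⟨i, a⟩ ⟨j, b⟩
    rw [quaternionMatrixRep_apply]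
    simp only [single_apply, diagonal_apply, Prod.mk.injEq]
    by_cases h : i = j
    · subst h
      by_cases h' : m = i
      · subst h'; simp [one_apply]
      · simp [h', Ne.symm h']
    · have : ¬ (m = i ∧ m = j) := fun h' => h (h'.1.symm.trans h'.2)
      simp [h, this]
  trace X := by
    simp only [Matrix.trace, diag_apply, quaternionMatrixRep_apply, Fintype.sum_prod_type,
      Fin.sum_univ_two, map_apply, map_intCast]
    rw [Int.cast_sum, Finset.mul_sum]
    refine Finset.sum_congr rfl fun i _ => ?_
    simp [Matrix.intCast_apply, two_mul]
  card_fiber m := by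
    rw [← Fintype.card_fin 2]
    exact Fintype.card_congr ⟨fun x => x.1.2, fun a => ⟨(m, a), rfl⟩,
      by rintro ⟨⟨i, a⟩, rfl⟩; rfl, fun _ => rfl⟩
  pos := two_pos
  exists_proj := by
    let π : Matrix (Fin d × Fin 2) (Fin d × Fin 2) ℂ →+ Matrix (Fin d) (Fin d) (Quaternion ℝ) :=
      quaternionProj.mapMatrix.comp (Matrix.compRingEquiv (Fin d) (Fin 2) ℂ).symm.toRingHom
    refine ⟨π, ?_, fun a M => ?_⟩
    · change quaternionProj.mapMatrix ((Matrix.compRingEquiv (Fin d) (Fin 2) ℂ).symm 1) = 1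
      rw [map_one]
      ext1 i j
      rw [AddMonoidHom.mapMatrix_apply, map_apply, one_apply, one_apply]
      split_ifs
      · exact quaternionProj_one
      · exact map_zero _
    · obtain ⟨M, rfl⟩ := (Matrix.compRingEquiv (Fin d) (Fin 2) ℂ).surjective M
      change quaternionProj.mapMatrix ((Matrix.compRingEquiv (Fin d) (Fin 2) ℂ).symm
        (Matrix.compRingEquiv (Fin d) (Fin 2) ℂ (quaternionRep.mapMatrix a) *
          Matrix.compRingEquiv (Fin d) (Fin 2) ℂ M)) =
        a * quaternionProj.mapMatrix ((Matrix.compRingEquiv (Fin d) (Fin 2) ℂ).symm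
          (Matrix.compRingEquiv (Fin d) (Fin 2) ℂ M))
      rw [← map_mul, RingEquiv.symm_apply_apply, RingEquiv.symm_apply_apply]
      ext1 i j
      simp only [AddMonoidHom.mapMatrix_apply, RingHom.mapMatrix_apply, map_apply,
        Matrix.mul_apply, map_sum, quaternionProj_mul]

end Instances

end HermitianWH

/-! ### The three coefficient rings -/

theorem mainTheorem3 (d : ℕ) :
    (∀ A : MatLaurent ℝ (Fin d),
      dagger A = A → InvertibleOnCircle (mapLaurent (realRep d) A) →
      ∃ κ : Fin d → ℤ,
        IsPartialIndices (mapLaurent (realRep d) A) κ ∧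
        (∀ κ' : Fin d → ℤ, IsPartialIndices (mapLaurent (realRep d) A) κ' → κ' = κ) ∧
        ∃ (s : Fin d → ℤ) (Ap : MatPoly ℝ (Fin d)),
          (∀ m, κ m = 0 → s m = 1 ∨ s m = -1) ∧
          (∀ m m', κ m = 0 → κ m' = 0 → m' < m → s m' ≤ s m) ∧
          A = inZ Ap * middleFactor κ s * dagger (inZ Ap) ∧
          InvertibleOnDisk (Ap.map (realRep d)) ∧
          ∑ m with κ m = 0, s m = signature (evalAt (mapLaurent (realRep d) A) 1)) ∧
    (∀ A : MatLaurent ℂ (Fin d),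
      dagger A = A → InvertibleOnCircle A →
      ∃ κ : Fin d → ℤ,
        IsPartialIndices A κ ∧
        (∀ κ' : Fin d → ℤ, IsPartialIndices A κ' → κ' = κ) ∧
        ∃ (s : Fin d → ℤ) (Ap : MatPoly ℂ (Fin d)),
          (∀ m, κ m = 0 → s m = 1 ∨ s m = -1) ∧
          (∀ m m', κ m = 0 → κ m' = 0 → m' < m → s m' ≤ s m) ∧
          A = inZ Ap * middleFactor κ s * dagger (inZ Ap) ∧
          InvertibleOnDisk Ap ∧
          ∑ m with κ m = 0, s m = signature (evalAt A 1)) ∧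
    (∀ A : MatLaurent (Quaternion ℝ) (Fin d),
      dagger A = A → InvertibleOnCircle (mapLaurent (quaternionMatrixRep d) A) →
      ∃ κ : Fin d → ℤ,
        IsDoubledPartialIndices (mapLaurent (quaternionMatrixRep d) A) κ ∧
        (∀ κ' : Fin d → ℤ,
          IsDoubledPartialIndices (mapLaurent (quaternionMatrixRep d) A) κ' → κ' = κ) ∧
        ∃ (s : Fin d → ℤ) (Ap : MatPoly (Quaternion ℝ) (Fin d)),
          (∀ m, κ m = 0 → s m = 1 ∨ s m = -1) ∧
          (∀ m m', κ m = 0 → κ m' = 0 → m' < m → s m' ≤ s m) ∧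
          A = inZ Ap * middleFactor κ s * dagger (inZ Ap) ∧
          InvertibleOnDisk (Ap.map (quaternionMatrixRep d)) ∧
          2 * ∑ m with κ m = 0, s m =
            signature (evalAt (mapLaurent (quaternionMatrixRep d) A) 1)) := by
  refine ⟨fun A hA hinv => ?_, fun A hA hinv => ?_, fun A hA hinv => ?_⟩
  · simpa only [Nat.cast_one, one_mul] using!
      (isMatrixRep_realRep d).exists_partialIndices hA hinv
  · have hid : mapLaurent (RingHom.id (Matrix (Fin d) (Fin d) ℂ)) A = A := by
      rw [mapLaurent_eq, AddMonoidAlgebra.mapRingHom_id, RingHom.id_apply]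
    have h := (isMatrixRep_id d).exists_partialIndices hA (by rwa [hid])
    simpa only [hid, Polynomial.map_id, Nat.cast_one, one_mul] using! h
  · exact (isMatrixRep_quaternionMatrixRep d).exists_partialIndices hA hinv
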